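/- All rings are commutative with $1$ and have characteristic $0$. A difference ring $(A,\sigma)$ is a ring $A$ with a ring automorphism $\sigma$; its constants are $\mathrm{const}(A,\sigma)=\{c\in A:\sigma(c)=c\}$. It is constant-stable if $\mathrm{const}(A,\sigma^k)=\mathrm{const}(A,\sigma)$ for all $k>0$. A difference field $(F,\sigma)$ is computable if its elements are coded by natural numbers such that equality is decidable and the field operations and $\sigma$ are computable. **Problems.** Let $G$ be a subgroup of the unit group $A^*$ such that the set of nonzero $c\in A$ with $\sigma(c)=u\,c$ for some $u\in G$ is also a subgroup of $A^*$; assume that $K=\mathrm{const}(A,\sigma)$ is a field. Problem PFLDE in $(A,\sigma)$ for $G$: given $u\in G$, $n\ge 0$ and $f_1,\dots,f_n\in A$, compute a $K$-basis of $$\{(c_1,\dots,c_n,g)\in K^n\times A:\ \sigma(g)-u\,g=c_1f_1+\dots+c_nf_n\}.$$ Problem PMT in $(A,\sigma)$ for $G$: given $n\ge 0$ and $f_1,\dots,f_n\in G$, compute a $\mathbb Z$-basis of $$\{(m_1,\dots,m_n)\in\mathbb Z^n:\ \sigma(g)=f_1^{m_1}\cdots f_n^{m_n}\,g\text{ for some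 }g\in A\setminus\{0\}\}.$$ A problem is called solvable if $G$ satisfies the stated requirements and there is an algorithm for it. **Extensions.** An R$\Pi\Sigma$-extension $(E,\sigma)$ of $(F,\sigma)$ is a difference ring extension $E=F\langle t_1\rangle\cdots\langle t_e\rangle$, $e\ge 0$, such that, for each $i$, with $A=F\langle t_1\rangle\cdots\langle t_{i-1}\rangle$ and $t=t_i$, one has $\mathrm{const}(A\langle t\rangle,\sigma)=\mathrm{const}(A,\sigma)$ and one of the following holds: * ($t$ is an R-monomial of order $\lambda>1$) $A\langle t\rangle=A[t]\cong A[y]/(y^\lambda-1)$ with $t$ corresponding to $y$, and $\sigma(t)=\alpha t$ with $\alpha\in A^*$; * ($t$ is a $\Pi$-monomial) $A\langle t\rangle=A[t,t^{-1}]$ is a ring of Laurent polynomials over $A$ and $\sigma(t)=\alpha t$ with $\alpha\in A^*$; * ($t$ is a $\Sigma$-monomial) $A\langle t\rangle=A[t]$ is a polynomial ring over $A$ and $\sigma(t)-t\in A$. Its product group is $$H=\{g\,t_1^{m_1}\cdots t_e^{m_e}:\ g\in F^*,\ m_i\in\mathbb Z,\ m_i=0\text{ if }t_i\text{ is a }\Sigma\text{-monomial}\},$$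 and the extension is simple if $\sigma(t_i)/t_i\in H$ for every R- or $\Pi$-monomial $t_i$. Elements of $E$ are given to algorithms as finite lists of terms $a\,t_1^{m_1}\cdots t_e^{m_e}$ with $a\in F$. The period of an R-monomial $t_i$ is the least $p>0$ with $\sigma^p(t_i)=t_i$, and $0$ if there is none. **Theorem.** Let $(E,\sigma)$ with $E=F\langle t_1\rangle\cdots\langle t_e\rangle$ be a simple R$\Pi\Sigma$-extension of a constant-stable computable difference field $(F,\sigma)$. Suppose that the periods of all R-monomials are positive and that the orders and periods of the R-monomials are given explicitly. Then Problem PFLDE in $(E,\sigma)$ for $H$ is solvable if one of the following holds: 1. no $t_i$ is a $\Pi$-monomial, and Problem PFLDE is solvable in $(F,\sigma^k)$ for $F^*$ for all $k>0$; 2. Problem PMT is solvable in $(F,\sigma)$ for $F^*$, and Problem PFLDE is solvable in $(F,\sigma^k)$ for $F^*$ for all $k>0$. -/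

import Mathlib

/-! ### Integer powers of units -/

/-- Integer power of an element of a commutative ring. It is meant for units `a`, where it agrees
with the power in the group of units (see `zpowInv_units`). -/
noncomputable def zpowInv {A : Type*} [CommRing A] (a : A) : ℤ → A
  | Int.ofNat n => a ^ n
  | Int.negSucc n => Ring.inverse a ^ (n + 1)

theorem zpowInv_units {A : Type*} [CommRing A] (w : Aˣ) (m : ℤ) :
    zpowInv (w : A) m = ((w ^ m : Aˣ) : A) := by
  cases m with
  | ofNat n => simp [zpowInv]
  | negSucc n => simp [zpowInv, zpow_negSucc]

/-! ### Difference rings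

A difference ring is a commutative ring `A` with a ring automorphism `σ : RingAut A`. -/

/-- The ring of constants `{c | σ c = c}` of a difference ring. -/
def constRing {A : Type*} [CommRing A] (σ : RingAut A) : Subring A :=
  RingHom.eqLocus (σ : A →+* A) (RingHom.id A)

/-- The difference ring `(A, σ)` is constant-stable: for every `k > 0` the constants of `(A, σ ^ k)`
are those of `(A, σ)`. -/
def IsConstantStable {A : Type*} [CommRing A] (σ : RingAut A) : Prop :=
  ∀ k : ℕ, 0 < k → constRing (σ ^ k) = constRing σ

/-- The set `A^*` of invertible elements. -/
def unitSet (A : Type*) [CommRing A] : Set A := {x | IsUnit x}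

/-- `G ≤ A^*`: the subset `G` of `A` consists of units and is a multiplicative group. -/
def IsUnitGroup {A : Type*} [CommRing A] (G : Set A) : Prop :=
  ∃ S : Subgroup Aˣ, Units.val '' (S : Set Aˣ) = G

/-- The semi-constants of `(A, σ)` over `G`. -/
def semiConst {A : Type*} [CommRing A] (σ : RingAut A) (G : Set A) : Set A :=
  {c | ∃ u ∈ G, σ c = u * c}

/-- The difference field `(F, σ)` is computable, with respect to the given coding of the elements of
`F` by natural numbers. (Equality of elements, in particular zero recognition, is decidable since
elements have unique codes.) -/
structure IsComputableDifferenceField {F : Type*} [Field F] [Primcodable F] (σ : RingAut F) :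
    Prop where
  add : Computable₂ fun x y : F => x + y
  neg : Computable fun x : F => -x
  mul : Computable₂ fun x y : F => x * y
  inv : Computable fun x : F => x⁻¹
  aut : Computable fun x : F => σ x

/-! ### The two algorithmic problems

The elements of `A` are handled by algorithms through names: `rep : R → A` sends a name to the
element it denotes. -/

/-- The set `V(u, f, (A, σ))` of all `(c₁, …, cₙ, g)`, with constants `cᵢ` and `g ∈ A`, such that
`σ g - u g = c₁ f₁ + ⋯ + cₙ fₙ`. -/
def solutionSet {A : Type*} [CommRing A] (σ : RingAut A) (u : A) {n : ℕ} (f : Fin n → A) :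
    Set ((Fin n → A) × A) :=
  {x | (∀ i, x.1 i ∈ constRing σ) ∧ σ x.2 - u * x.2 = ∑ i, x.1 i * f i}

/-- The set `M(f, A)` of all `(m₁, …, mₙ) ∈ ℤⁿ` such that `σ g = f₁ ^ m₁ ⋯ fₙ ^ mₙ g` for some
nonzero `g ∈ A`. -/
def multSet {A : Type*} [CommRing A] (σ : RingAut A) {n : ℕ} (f : Fin n → A) :
    Set (Fin n → ℤ) :=
  {m | ∃ g : A, g ≠ 0 ∧ σ g = (∏ i, zpowInv (f i) (m i)) * g}

/-- Problem PFLDE is solvable in `(A, σ)` for `G`. The problem is posed for `G ≤ A^*` whose nonzero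
semi-constants form a subgroup of `A^*`. An algorithm receives names of `u ∈ G` and of
`f₁, …, fₙ ∈ A` (the length `n` is part of the input) and halts with a list of names of vectors
`(c₁, …, cₙ, g)` which form a basis of `V(u, f, (A, σ))` over the constants. -/
def PFLDESolvable {R A : Type*} [Primcodable R] [CommRing A] (rep : R → A) (σ : RingAut A)
    (G : Set A) : Prop :=
  IsUnitGroup G ∧ IsUnitGroup (semiConst σ G \ {0}) ∧
  ∃ alg : R × List R →. List (List R × R), Partrec alg ∧
    ∀ (u : R) (f : List R), rep u ∈ G →
      ∃ B ∈ alg (u, f), ∃ v : Fin B.length → (Fin f.length → A) × A,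
        (∀ j, (B.get j).1.map rep = List.ofFn (v j).1 ∧ rep (B.get j).2 = (v j).2) ∧
        LinearIndependent (constRing σ) v ∧
        (Submodule.span (constRing σ) (Set.range v) : Set ((Fin f.length → A) × A)) =
          solutionSet σ (rep u) (fun i => rep (f.get i))

/-- Problem PMT is solvable in `(A, σ)` for `G`. The problem is posed for `G ≤ A^*` whose nonzero
semi-constants form a subgroup of `A^*`. An algorithm receives names of `f₁, …, fₙ ∈ G` and halts
with a `ℤ`-basis of `M(f, A)`. -/
def PMTSolvable {R A : Type*} [Primcodable R] [CommRing A] (rep : R → A) (σ : RingAut A)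
    (G : Set A) : Prop :=
  IsUnitGroup G ∧ IsUnitGroup (semiConst σ G \ {0}) ∧
  ∃ alg : List R →. List (List ℤ), Partrec alg ∧
    ∀ f : List R, (∀ r ∈ f, rep r ∈ G) →
      ∃ B ∈ alg f, ∃ v : Fin B.length → (Fin f.length → ℤ),
        (∀ j, B.get j = List.ofFn (v j)) ∧
        LinearIndependent ℤ v ∧
        (Submodule.span ℤ (Set.range v) : Set (Fin f.length → ℤ)) =
          multSet σ (fun i => rep (f.get i))

/-! ### Towers of extensions -/

/-- The three types of monomials: an R-monomial (with its order), a Π-monomial, a Σ-monomial. -/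
inductive MonomialKind : Type
  | root (order : ℕ)
  | pi
  | sigma

/-- The subring `F⟨t₁⟩ … ⟨tₖ⟩` generated over `F` by the first `k` of the monomials, and by the
inverses of those of them that are Π-monomials. -/
noncomputable def stage (F : Type*) {E : Type*} [CommRing F] [CommRing E] [Algebra F E] {e : ℕ}
    (kind : Fin e → MonomialKind) (t : Fin e → E) (k : ℕ) : Subalgebra F E :=
  Algebra.adjoin F {x | ∃ j : Fin e, (j : ℕ) < k ∧
    (x = t j ∨ (kind j = MonomialKind.pi ∧ x = Ring.inverse (t j)))}

/-- `t` is a monomial of the given type over the subring `A` of the difference ring `(E, τ)`, apart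
from the condition on the constants.
* R-monomial of order `l > 1`: `A[t]` is `A[y]/(y ^ l - 1)`, and `τ t = α t` with a unit `α` of `A`;
* Π-monomial: `A[t, 1/t]` is a ring of Laurent polynomials, and `τ t = α t` with a unit `α` of `A`;
* Σ-monomial: `A[t]` is a polynomial ring, and `τ t - t ∈ A`. -/
def IsMonomialOver {F E : Type*} [CommRing F] [CommRing E] [Algebra F E] (τ : RingAut E)
    (A : Subalgebra F E) (t : E) : MonomialKind → Prop
  | MonomialKind.root l => 1 < l ∧ t ^ l = 1 ∧ LinearIndependent A (fun j : Fin l => t ^ (j : ℕ)) ∧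
      ∃ α : Aˣ, τ t = ((α : A) : E) * t
  | MonomialKind.pi => IsUnit t ∧ Transcendental A t ∧ ∃ α : Aˣ, τ t = ((α : A) : E) * t
  | MonomialKind.sigma => Transcendental A t ∧ τ t - t ∈ A

/-- `(E, τ)` with `E = F⟨t₁⟩ … ⟨tₑ⟩` is a (nested) RΠΣ-extension of the difference ring `(F, σ)`. -/
structure IsRPSExtension {F E : Type*} [CommRing F] [CommRing E] [Algebra F E] (σ : RingAut F)
    (τ : RingAut E) {e : ℕ} (kind : Fin e → MonomialKind) (t : Fin e → E) : Prop where
  injective : Function.Injective (algebraMap F E)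
  extends_aut : ∀ a : F, τ (algebraMap F E a) = algebraMap F E (σ a)
  generates : stage F kind t e = ⊤
  monomial : ∀ i : Fin e, IsMonomialOver τ (stage F kind t i) (t i) (kind i)
  constants : ∀ i : Fin e, ∀ c ∈ stage F kind t (i + 1), τ c = c → c ∈ stage F kind t i

/-- The power `x ^ m` of a monomial `x`; for a Σ-monomial only `m ≥ 0` is meaningful, and a negative
exponent is read as `0`. -/
noncomputable def genPow {E : Type*} [CommRing E] (x : E) (m : ℤ) : MonomialKind → E
  | MonomialKind.sigma => x ^ m.toNat
  | _ => zpowInv x m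

/-- The product group over `F^*`: all `g t₁ ^ m₁ ⋯ tₑ ^ mₑ` with `g ∈ F^*`, `mᵢ ∈ ℤ`, and `mᵢ = 0` if
`tᵢ` is a Σ-monomial. -/
def productGroup (F : Type*) {E : Type*} [CommRing F] [CommRing E] [Algebra F E] {e : ℕ}
    (kind : Fin e → MonomialKind) (t : Fin e → E) : Set E :=
  {x | ∃ g ∈ unitSet F, ∃ m : Fin e → ℤ, (∀ i, kind i = MonomialKind.sigma → m i = 0) ∧
    x = algebraMap F E g * ∏ i, genPow (t i) (m i) (kind i)}

/-- The extension is simple: `τ(tᵢ)/tᵢ` lies in the product group over `F^*` for each R- or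
Π-monomial `tᵢ`. -/
def IsSimpleExtension (F : Type*) {E : Type*} [CommRing F] [CommRing E] [Algebra F E]
    (τ : RingAut E) {e : ℕ} (kind : Fin e → MonomialKind) (t : Fin e → E) : Prop :=
  ∀ i, kind i ≠ MonomialKind.sigma → ∃ h ∈ productGroup F kind t, τ (t i) = h * t i

/-- The element of `E = F⟨t₁⟩ … ⟨tₑ⟩` given by a list of terms: a pair `(m, a)` stands for the term
`a t₁ ^ m₁ ⋯ tₑ ^ mₑ`, and the list stands for the sum of its terms. -/
noncomputable def evalTerms {F E : Type*} [CommRing F] [CommRing E] [Algebra F E] {e : ℕ}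
    (kind : Fin e → MonomialKind) (t : Fin e → E) (w : List ((Fin e → ℤ) × F)) : E :=
  (w.map fun p => algebraMap F E p.2 * ∏ i, genPow (t i) (p.1 i) (kind i)).sum

/-! ### Computable functions on lists and integers -/

section Computability

/-! The algorithm climbs the tower, with all R-monomials moved to the bottom. The factor `τ t / t`
of an R-monomial is a root of unity in the product group, so it contains no Π-monomial
(`IsSimpleExtension.exists_factor_root`); hence the R-monomials together with the first `k`
monomials (`level kind k`) generate a subring stable under `τ`. Monomials with reduced exponents
form an `F`-basis of `E`, which makes equality of term lists decidable and yields unique codes with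
effective operations. The tower is fixed, so finitely many data attached to it (periods, the
elements `τ tᵢ`) are built into the algorithm. Every equation is a linear problem over the
constants, and solvers are chained by one piece of linear algebra (`composed_basis`,
`Solvable.compose`).

Bottom level (`IsEffective.solvableAt_rootSet`). Some power `τ ^ k` fixes all R-monomials, and the
norms `u τ(u) ⋯ τ ^ (k - 1) (u)` of the elements `u` of the product group over the R-monomials lie
in `F`. A solution of `τ x - u x = z` thus solves an equation for `τ ^ k` with coefficient in `F`,
which decouples into parametrized equations in `(F, σ ^ k)`, one for each product of R-monomials.
Constant-stability ensures that these have the same constants. The original equation is then imposed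
by linear algebra over the constants.

Semi-constants (`IsRPSExtension.semiconst`). A nonzero `x` with `τ x = u x`, `u` in the product
group, is a unit of the form `γ P`, where `γ` is a combination of products of R-monomials and `P` is
a product of powers of Π-monomials. For combinations of R-monomials, Maschke's theorem gives von
Neumann regularity, and the idempotent attached to `x` is constant, hence `1`. The induction step
looks at one coefficient.

Σ-monomial. The degree of a solution exceeds that of the right-hand side by at most one; otherwise
the two top coefficients would produce a new constant that involves the monomial. With a degree
bound, coefficients are compared from the top down, each comparison being an equation one level
below (`IsEffective.solvable_top`).

Π-monomial `t`, with `u = w t ^ m`. If `m ≠ 0`, there is at most one solution for each right-hand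
side, and iteration of `x ↦ u⁻¹ (τ x - z)` followed by truncation finds it. If `m = 0`, powers of
`t` do not interact, and only the exponents `j` for which `g t ^ j` can solve the homogeneous
equation have to be bounded. By the structure of semi-constants such an exponent yields a
multiplicative relation in `F`; Problem PMT gives all relations. Either one of them determines the
exponents up to a nonzero integer factor, or a rational linear functional certifies that there is no
nonzero semi-constant (`IsEffective.exists_bound`). An unbounded search finds one of the two. -/

theorem List.foldl_eq_natRec {β γ : Type*} (l : List β) (s : γ) (h : γ → β → γ) :
    Nat.rec s (fun i t => Option.casesOn (l[i]?) t (fun b => h t b)) l.length = l.foldl h s := by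
  have key : ∀ n, n ≤ l.length →
      Nat.rec s (fun i t => Option.casesOn (l[i]?) t (fun b => h t b)) n = (l.take n).foldl h s := by
    intro n
    induction n with
    | zero => simp
    | succ n ih =>
      intro hn
      have hn' : n < l.length := hn
      simp only [ih hn'.le, List.getElem?_eq_getElem hn']
      rw [List.take_add_one, List.getElem?_eq_getElem hn']
      simp [-List.take_append_getElem]
  simpa using key l.length le_rfl

variable {α β γ δ : Type*} [Primcodable α] [Primcodable β] [Primcodable γ] [Primcodable δ]

theorem Computable.list_foldl {f : α → List β} {g : α → γ} {h : α → γ × β → γ}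
    (hf : Computable f) (hg : Computable g) (hh : Computable₂ h) :
    Computable fun a => (f a).foldl (fun s b => h a (s, b)) (g a) := by
  have key : Computable fun a => (Nat.rec (g a)
      (fun i t => Option.casesOn ((f a)[i]?) t (fun b => h a (t, b))) (f a).length : γ) := by
    refine Computable.nat_rec
      (h := fun a p => Option.casesOn ((f a)[p.1]?) p.2 (fun b => h a (p.2, b)))
      (Computable.list_length.comp hf) hg ?_
    refine Computable.option_casesOn (f := fun q : α × ℕ × γ => q.2.2)
      (g := fun q b => h q.1 (q.2.2, b)) ?_ ?_ ?_
    · exact Computable.list_getElem?.comp (hf.comp Computable.fst)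
        (Computable.fst.comp Computable.snd)
    · exact Computable.snd.comp Computable.snd
    · exact hh.comp (Computable.fst.comp Computable.fst)
        ((Computable.snd.comp (Computable.snd.comp Computable.fst)).pair Computable.snd)
  exact key.of_eq fun a => List.foldl_eq_natRec _ _ _

theorem Computable.list_map {f : α → List β} {g : α → β → γ} (hf : Computable f)
    (hg : Computable₂ g) : Computable fun a => (f a).map (g a) := by
  have := Computable.list_foldl (f := f) (g := fun _ => ([] : List γ))
    (h := fun a p => p.1 ++ [g a p.2]) hf (Computable.const _)
    (Computable.list_concat.comp (Computable.fst.comp Computable.snd)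
      (hg.comp Computable.fst (Computable.snd.comp Computable.snd)))
  refine this.of_eq fun a => ?_
  have key : ∀ (l : List β) (s : List γ), l.foldl (fun s b => s ++ [g a b]) s = s ++ l.map (g a) := by
    intro l
    induction l with
    | nil => simp
    | cons b l ih => intro s; simp [ih]
  simpa using key (f a) []

theorem Computable.list_filter {f : α → List β} {g : α → β → Bool} (hf : Computable f)
    (hg : Computable₂ g) : Computable fun a => (f a).filter (g a) := by
  have := Computable.list_foldl (f := f) (g := fun _ => ([] : List β))
    (h := fun a p => bif g a p.2 then p.1 ++ [p.2] else p.1) hf (Computable.const _)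
    (Computable.cond (hg.comp Computable.fst (Computable.snd.comp Computable.snd))
      (Computable.list_concat.comp (Computable.fst.comp Computable.snd)
        (Computable.snd.comp Computable.snd)) (Computable.fst.comp Computable.snd))
  refine this.of_eq fun a => ?_
  have key : ∀ (l s : List β), l.foldl (fun s b => bif g a b then s ++ [b] else s) s
      = s ++ l.filter (g a) := by
    intro l
    induction l with
    | nil => simp
    | cons b l ih => intro s; by_cases h : g a b <;> simp [ih, h]
  simpa using key (f a) []

theorem Computable.list_sum [AddCommMonoid γ] (hadd : Computable₂ fun x y : γ => x + y)
    {f : α → List γ} (hf : Computable f) : Computable fun a => (f a).sum := by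
  have := Computable.list_foldl (f := f) (g := fun _ => (0 : γ))
    (h := fun _ p => p.1 + p.2) hf (Computable.const _)
    (hadd.comp (Computable.fst.comp Computable.snd) (Computable.snd.comp Computable.snd))
  exact this.of_eq fun a => List.sum_eq_foldl.symm

theorem Computable.list_all {f : α → List β} {g : α → β → Bool} (hf : Computable f)
    (hg : Computable₂ g) : Computable fun a => (f a).all (g a) := by
  have := Computable.list_foldl (f := f) (g := fun _ => true)
    (h := fun a p => bif g a p.2 then p.1 else false) hf (Computable.const _)
    (Computable.cond (hg.comp Computable.fst (Computable.snd.comp Computable.snd))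
      (Computable.fst.comp Computable.snd) (Computable.const _))
  refine this.of_eq fun a => ?_
  have key : ∀ (l : List β) (s : Bool), l.foldl (fun s b => bif g a b then s else false) s
      = (s && l.all (g a)) := by
    intro l
    induction l with
    | nil => simp
    | cons b l ih =>
      intro s
      rw [List.foldl_cons, ih]
      by_cases h : g a b <;> cases s <;> simp [h]
  simpa using key (f a) true

theorem Computable.list_getD (d : β) : Computable₂ fun (l : List β) (n : ℕ) => l.getD n d :=
  (Primrec.list_getD d).to_comp

theorem Computable.decide_eq [DecidableEq β] {f g : α → β} (hf : Computable f)
    (hg : Computable g) : Computable fun a => decide (f a = g a) := by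
  have h := (Primrec.eq (α := β)).decide
  exact Computable₂.comp (f := fun x y : β => decide (x = y)) h.to_comp hf hg

theorem Computable.decide_le {f g : α → ℕ} (hf : Computable f)
    (hg : Computable g) : Computable fun a => decide (f a ≤ g a) := by
  have h := Primrec.nat_le.decide
  exact Computable₂.comp (f := fun x y : ℕ => decide (x ≤ y)) h.to_comp hf hg

theorem Computable.and {f g : α → Bool} (hf : Computable f) (hg : Computable g) :
    Computable fun a => f a && g a := Primrec.and.to_comp.comp hf hg

/-- Unbounded search. -/
theorem Computable.exists_search {t : α → β → Bool} (ht : Computable₂ t) :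
    ∃ f : α →. β, Partrec f ∧ (∀ a, ∀ b ∈ f a, t a b = true) ∧
      ∀ a, (∃ b, t a b = true) → (f a).Dom := by
  have hc : Computable₂ fun (a : α) (n : ℕ) =>
      (Encodable.decode (α := β) n).bind fun b => bif t a b then some b else none := by
    refine Computable.option_bind (Computable.decode.comp Computable.snd) ?_
    exact Computable.cond (ht.comp (Computable.fst.comp Computable.fst) Computable.snd)
      (Computable.option_some.comp Computable.snd) (Computable.const _)
  refine ⟨_, Partrec.rfindOpt hc, fun a b hb => ?_, fun a ⟨b, hb⟩ => ?_⟩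
  · obtain ⟨n, hn⟩ := Nat.rfindOpt_spec hb
    simp only [Option.mem_def, Option.bind_eq_some_iff] at hn
    obtain ⟨b', -, h⟩ := hn
    by_cases h' : t a b' <;> simp_all
  · rw [Nat.rfindOpt_dom]
    exact ⟨Encodable.encode b, b, by simp [hb]⟩

theorem Computable.exists_choice {t : α → β → Bool} (ht : Computable₂ t)
    (h : ∀ a, ∃ b, t a b = true) : ∃ f : α → β, Computable f ∧ ∀ a, t a (f a) = true := by
  obtain ⟨f, hf, h1, h2⟩ := Computable.exists_search ht
  refine ⟨fun a => (f a).get (h2 a (h a)), hf.of_eq_tot fun a => Part.get_mem _,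
    fun a => h1 a _ (Part.get_mem _)⟩

/-! ### Integers -/

theorem Computable.int_ofNat : Computable Int.ofNat := by
  rw [← Computable.encode_iff]
  exact ((Primrec.nat_mul.comp (Primrec.const 2) Primrec.id).to_comp).of_eq fun n => rfl

theorem Computable.int_negSucc : Computable Int.negSucc := by
  rw [← Computable.encode_iff]
  exact ((Primrec.nat_add.comp (Primrec.nat_mul.comp (Primrec.const 2) Primrec.id)
    (Primrec.const 1)).to_comp).of_eq fun n => rfl

/-- In the coding of `ℤ` the code of `Int.ofNat n` is `2 * n` and that of `Int.negSucc n` is `2 * n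
+ 1`, so the parity of the code decides the case. -/
theorem Computable.int_cases {f : α → ℤ} {g h : α → ℕ → β} (hf : Computable f)
    (hg : Computable₂ g) (hh : Computable₂ h) :
    Computable fun a => (Int.casesOn (f a) (g a) (h a) : β) := by
  have he : Computable fun a => Encodable.encode (f a) := Computable.encode.comp hf
  have := Computable.cond (Computable.nat_bodd.comp he)
    (hh.comp Computable.id (Computable.nat_div2.comp he))
    (hg.comp Computable.id (Computable.nat_div2.comp he))
  refine this.of_eq fun a => ?_
  rcases hfa : f a with n | n
  · have : Encodable.encode (Int.ofNat n) = 2 * n := rfl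
    simp only [this, Nat.bodd_mul, Nat.div2_val, id]
    simp
  · have : Encodable.encode (Int.negSucc n) = 2 * n + 1 := rfl
    simp only [this, Nat.bodd_add, Nat.bodd_mul, Nat.div2_val, id]
    have : (2 * n + 1) / 2 = n := by omega
    simp [this]

theorem Computable.int_toNat : Computable Int.toNat :=
  (Computable.int_cases (g := fun _ n => n) (h := fun _ _ => 0) Computable.id Computable.snd
    (Computable.const 0)).of_eq fun z => by cases z <;> rfl

theorem Computable.int_neg : Computable fun z : ℤ => -z := by
  have h1 : Computable fun n : ℕ => (-(n : ℤ)) :=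
    (Computable.nat_casesOn (g := fun _ => (0 : ℤ)) (h := fun _ m => Int.negSucc m)
      Computable.id (Computable.const 0) (Computable.int_negSucc.comp Computable.snd)).of_eq
      fun n => by cases n <;> rfl
  exact (Computable.int_cases (g := fun _ n => -(n : ℤ)) (h := fun _ n => Int.ofNat (n + 1))
    Computable.id (h1.comp Computable.snd)
    (Computable.int_ofNat.comp (Computable.succ.comp Computable.snd))).of_eq
      fun z => by cases z <;> rfl

theorem Computable.int_sub_nat : Computable₂ fun m n : ℕ => (m : ℤ) - n := by
  have hsub : Computable₂ fun m n : ℕ => m - n := Primrec.nat_sub.to_comp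
  have hle : Computable fun p : ℕ × ℕ => decide (p.2 ≤ p.1) :=
    Computable.decide_le Computable.snd Computable.fst
  refine (Computable.cond hle (Computable.int_ofNat.comp hsub)
    (Computable.int_neg.comp (Computable.int_ofNat.comp
      (hsub.comp Computable.snd Computable.fst)))).of_eq fun p => ?_
  by_cases h : p.2 ≤ p.1
  · simp [h]
  · have : p.1 ≤ p.2 := by omega
    simp [h, this]

/-- Splitting integers into positive and negative parts reduces the operation to arithmetic in `ℕ`.
-/
theorem Computable.int_add : Computable₂ fun x y : ℤ => x + y := by
  have hadd : Computable₂ fun m n : ℕ => m + n := Primrec.nat_add.to_comp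
  have h1 := Computable.int_toNat
  have h2 := Computable.int_toNat.comp Computable.int_neg
  refine (Computable.int_sub_nat.comp
    (hadd.comp (h1.comp (Computable.fst (α := ℤ) (β := ℤ))) (h1.comp Computable.snd))
    (hadd.comp (h2.comp Computable.fst) (h2.comp Computable.snd))).of_eq fun p => ?_
  have e1 := Int.toNat_sub_toNat_neg p.1
  have e2 := Int.toNat_sub_toNat_neg p.2
  push_cast
  linarith

theorem Computable.int_mul : Computable₂ fun x y : ℤ => x * y := by
  have hadd : Computable₂ fun m n : ℕ => m + n := Primrec.nat_add.to_comp
  have hmul : Computable₂ fun m n : ℕ => m * n := Primrec.nat_mul.to_comp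
  have h1 := Computable.int_toNat
  have h2 := Computable.int_toNat.comp Computable.int_neg
  have a1 := h1.comp (Computable.fst (α := ℤ) (β := ℤ))
  have a2 := h2.comp (Computable.fst (α := ℤ) (β := ℤ))
  have b1 := h1.comp (Computable.snd (α := ℤ) (β := ℤ))
  have b2 := h2.comp (Computable.snd (α := ℤ) (β := ℤ))
  refine (Computable.int_sub_nat.comp
    (hadd.comp (hmul.comp a1 b1) (hmul.comp a2 b2))
    (hadd.comp (hmul.comp a1 b2) (hmul.comp a2 b1))).of_eq fun p => ?_
  have e1 := Int.toNat_sub_toNat_neg p.1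
  have e2 := Int.toNat_sub_toNat_neg p.2
  push_cast
  calc _ = ((p.1.toNat : ℤ) - (-p.1).toNat) * ((p.2.toNat : ℤ) - (-p.2).toNat) := by ring
    _ = _ := by rw [e1, e2]

theorem Computable.int_natAbs : Computable Int.natAbs :=
  (Computable.int_cases (g := fun _ n => n) (h := fun _ n => n + 1) Computable.id Computable.snd
    (Computable.succ.comp Computable.snd)).of_eq fun z => by cases z <;> rfl

theorem Computable.int_emod_nat (l : ℕ) : Computable fun z : ℤ => z % (l : ℤ) := by
  have hmod : Computable fun n : ℕ => n % l :=
    (Primrec.nat_mod.comp Primrec.id (Primrec.const l)).to_comp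
  -- The residue of `-(n + 1)` is `l - (n % l + 1)`. For `l = 0`, where `z % 0 = z`, the formula
  -- remains correct.
  refine (Computable.int_cases (g := fun _ n => Int.ofNat (n % l))
    (h := fun _ n => (l : ℤ) + -(Int.ofNat (n % l + 1))) Computable.id
    (Computable.int_ofNat.comp (hmod.comp Computable.snd))
    (Computable.int_add.comp (Computable.const _) (Computable.int_neg.comp
      (Computable.int_ofNat.comp (Computable.succ.comp (hmod.comp Computable.snd)))))).of_eq
      fun z => ?_
  cases z with
  | ofNat n => rfl
  | negSucc n =>
    simp only [id, Int.ofNat_eq_natCast]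
    rcases Nat.eq_zero_or_pos l with rfl | hl
    · simp [Int.negSucc_eq]
    · rw [Int.negSucc_emod _ (by exact_mod_cast hl)]
      push_cast
      ring

theorem Computable.fin_pi {n : ℕ} {f : α → Fin n → β} (hf : ∀ i, Computable fun a => f a i) :
    Computable f := by
  have h := Computable.vector_ofFn (f := fun i a => f a i) hf
  have : f = fun a i => (List.Vector.ofFn (f a)).get i := by ext a i; simp
  rw [this]
  have h2 : Computable fun a => (Equiv.vectorEquivFin β n) (List.Vector.ofFn (f a)) := by
    rw [← Computable.encode_iff] at h ⊢
    refine h.of_eq fun a => ?_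
    change _ = Encodable.encode ((Equiv.vectorEquivFin β n).symm (Equiv.vectorEquivFin β n _))
    simp
  exact h2

theorem Computable.fin_apply {n : ℕ} (i : Fin n) : Computable fun m : Fin n → β => m i :=
  Computable₂.comp (f := fun (m : Fin n → β) i => m i) Computable.fin_app Computable.id
    (Computable.const i)

theorem Computable.finset_sum [AddCommMonoid γ] (hadd : Computable₂ fun x y : γ => x + y)
    {ι : Type*} (s : Finset ι) {f : ι → α → γ} (hf : ∀ i, Computable (f i)) :
    Computable fun a => ∑ i ∈ s, f i a := by
  classical
  induction s using Finset.induction_on with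
  | empty => simpa using Computable.const (0 : γ)
  | insert i s hi ih => simpa [Finset.sum_insert hi] using hadd.comp (hf i) ih

theorem Computable.finset_prod [CommMonoid γ] (hmul : Computable₂ fun x y : γ => x * y)
    {ι : Type*} (s : Finset ι) {f : ι → α → γ} (hf : ∀ i, Computable (f i)) :
    Computable fun a => ∏ i ∈ s, f i a := by
  classical
  induction s using Finset.induction_on with
  | empty => simpa using Computable.const (1 : γ)
  | insert i s hi ih => simpa [Finset.prod_insert hi] using hmul.comp (hf i) ih

/-! ### Unique codes -/

/-- A structure with a surjective naming by codes and a decidable equality of names can be given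
unique codes, in such a way that passing from a name to the element and back is computable. -/
theorem exists_primcodable_of_names {R E : Type*} [Primcodable R] [Inhabited R] [Infinite E]
    (ev : R → E) (hev : Function.Surjective ev) {t : R → R → Bool} (ht : Computable₂ t)
    (htev : ∀ r s, t r s = true ↔ ev r = ev s) :
    ∃ _ : Primcodable E, Computable ev ∧ ∃ s : E → R, Computable s ∧ ∀ x, ev (s x) = x := by
  classical
  let r : ℕ → R := fun n => (Encodable.decode n).getD default
  have hr : Computable r := Computable.option_getD Computable.decode (Computable.const _)
  have hrs : ∀ x : E, ∃ n, ev (r n) = x := fun x => by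
    obtain ⟨y, rfl⟩ := hev x
    exact ⟨Encodable.encode y, by simp [r]⟩
  -- `q n` says that `n` is the least code denoting its element; such codes are canonical.
  let q : ℕ → Bool := fun n => (List.range n).all fun k => !t (r k) (r n)
  have hq : Computable q := Computable.list_all Primrec.list_range.to_comp
    (Primrec.not.to_comp.comp (ht.comp (hr.comp Computable.snd) (hr.comp Computable.fst)))
  have hqs : ∀ n, q n = true ↔ ∀ k < n, ev (r k) ≠ ev (r n) := fun n => by
    simp only [q, List.all_eq_true, List.mem_range, ne_eq, ← htev]
    simp
  have hinj : ∀ m n, q m = true → q n = true → ev (r m) = ev (r n) → m = n := by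
    intro m n hm hn h
    rcases lt_trichotomy m n with h' | h' | h'
    · exact absurd h ((hqs n).1 hn m h')
    · exact h'
    · exact absurd h.symm ((hqs m).1 hm n h')
  have hex : ∀ x : E, ∃ n, q n = true ∧ ev (r n) = x := fun x => by
    refine ⟨Nat.find (hrs x), ?_, Nat.find_spec (hrs x)⟩
    rw [hqs]
    intro k hk
    rw [Nat.find_spec (hrs x)]
    exact Nat.find_min (hrs x) hk
  choose c hcq hcr using hex
  -- There are infinitely many canonical codes since `E` is infinite, so their ranks exhaust `ℕ`.
  have hinf : {n | q n = true}.Infinite := by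
    refine Set.infinite_of_injective_forall_mem (f := c) (fun x y h => ?_) hcq
    rw [← hcr x, ← hcr y, h]
  have hcount : Computable fun n => Nat.count (fun n => q n = true) n := by
    refine (Computable.nat_rec (g := fun _ => 0) (h := fun _ p => bif q p.1 then p.2 + 1 else p.2)
      Computable.id (Computable.const 0) (Computable.cond
        (hq.comp (Computable.fst.comp Computable.snd))
        (Computable.succ.comp (Computable.snd.comp Computable.snd))
        (Computable.snd.comp Computable.snd))).of_eq fun n => ?_
    induction n with
    | zero => simp
    | succ n ih =>
      rw [Nat.count_succ, ← ih]
      cases h : q n <;> simp [h]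
  have hnth : Computable fun n => Nat.nth (fun n => q n = true) n := by
    have hd : Computable₂ fun n m : ℕ =>
        q m && decide (Nat.count (fun n => q n = true) m = n) :=
      Computable.and (hq.comp Computable.snd)
        (Computable.decide_eq (hcount.comp Computable.snd) Computable.fst)
    obtain ⟨f, hf, h⟩ := Computable.exists_choice hd fun n =>
      ⟨Nat.nth (fun n => q n = true) n, by
        simp [Nat.nth_mem_of_infinite hinf, Nat.count_nth_of_infinite hinf]⟩
    refine hf.of_eq fun n => ?_
    have := h n
    simp only [Bool.and_eq_true, decide_eq_true_eq] at this
    rw [← this.2, Nat.nth_count this.1]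
    rw [this.2]
  -- The new code of `x` is the rank of its canonical code.
  let eqv : E ≃ ℕ :=
    { toFun := fun x => Nat.count (fun n => q n = true) (c x)
      invFun := fun n => ev (r (Nat.nth (fun n => q n = true) n))
      left_inv := fun x => by
        simp only [Nat.nth_count (p := fun n => q n = true) (hcq x), hcr]
      right_inv := fun n => by
        have h1 := Nat.nth_mem_of_infinite hinf n
        have : c (ev (r (Nat.nth (fun n => q n = true) n))) = Nat.nth (fun n => q n = true) n :=
          hinj _ _ (hcq _) h1 (hcr _)
        simp only [this, Nat.count_nth_of_infinite hinf] }
  let _ : Primcodable E := Primcodable.ofEquiv ℕ eqv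
  have heqv : Computable eqv := Primrec.of_equiv.to_comp
  have hsymm : Computable eqv.symm := Primrec.of_equiv_symm.to_comp
  refine ⟨inferInstance, ?_, fun x => r (c x), ?_, hcr⟩
  · have hd : Computable₂ fun (y : R) (n : ℕ) => q n && t (r n) y :=
      Computable.and (hq.comp Computable.snd) (ht.comp (hr.comp Computable.snd) Computable.fst)
    obtain ⟨f, hf, h⟩ := Computable.exists_choice hd fun y =>
      ⟨c (ev y), by simp [hcq, htev, hcr]⟩
    refine (hsymm.comp (hcount.comp hf)).of_eq fun y => ?_
    have := h y
    simp only [Bool.and_eq_true, htev] at this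
    rw [Equiv.symm_apply_eq]
    change _ = Nat.count _ (c (ev y))
    rw [hinj _ _ this.1 (hcq (ev y)) (this.2.trans (hcr _).symm)]
  · refine hr.comp ((hnth.comp heqv).of_eq fun x => ?_)
    exact Nat.nth_count (p := fun n => q n = true) (hcq x)

end Computability

/-! ### Linear problems and their composition

A linear problem over a ring of constants `K` is a `K`-submodule `S` of `E × E`; a pair `(x, z)` in
`S` says that `x` is a solution for the right-hand side `z`. Solving it for `Y₁, …, Yₙ` means to
find a basis of all `(c₁, …, cₙ, x)` with constants `cᵢ` such that `x` is a solution for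
`c₁ Y₁ + ⋯ + cₙ Yₙ`. -/

section LinearProblems

variable {E : Type*} [CommRing E] (K : Subring E)

/-- The solutions of a linear problem for the right-hand sides `Y`. -/
def linSol (S : Submodule K (E × E)) {n : ℕ} (Y : Fin n → E) : Set ((Fin n → E) × E) :=
  {x | (∀ i, x.1 i ∈ K) ∧ (x.2, ∑ i, x.1 i * Y i) ∈ S}

/-- The list `B` consists of the members of a basis of `V`. -/
def IsBasisList {n : ℕ} (B : List (List E × E)) (V : Set ((Fin n → E) × E)) : Prop :=
  ∃ (r : ℕ) (v : Fin r → (Fin n → E) × E),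
    B = List.ofFn (fun j => (List.ofFn (v j).1, (v j).2)) ∧ LinearIndependent K v ∧
    (Submodule.span K (Set.range v) : Set ((Fin n → E) × E)) = V

variable {K}

/-- The map by which a solution `(κ, x)` of the second problem gives the solution of the composed
problem. -/
def combineMap {n r : ℕ} (v : Fin r → (Fin n → E) × E) (μ : E →ₗ[K] E) :
    ((Fin r → E) × E) →ₗ[K] (Fin n → E) × E where
  toFun y := (fun i => ∑ l, y.1 l * (v l).1 i, ∑ l, y.1 l * (v l).2 + μ y.2)
  map_add' y y' := by
    ext
    · simp [add_mul, Finset.sum_add_distrib]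
    · simp [add_mul, Finset.sum_add_distrib]; abel
  map_smul' a y := by
    ext
    · simp [Finset.smul_sum]
    · simp [Finset.smul_sum]

theorem combineMap_eq {n r : ℕ} (v : Fin r → (Fin n → E) × E) (μ : E →ₗ[K] E) (κ : Fin r → K)
    (x : E) : combineMap v μ (fun l => (κ l : E), x) = ∑ l, κ l • v l + (0, μ x) := by
  ext
  · simp [combineMap, Prod.fst_sum, Subring.smul_def]
  · simp [combineMap, Prod.snd_sum, Subring.smul_def]

theorem mem_linSol_of_mem_span {S : Submodule K (E × E)} {n r : ℕ} {Y : Fin n → E}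
    {v : Fin r → (Fin n → E) × E}
    (hv : (Submodule.span K (Set.range v) : Set ((Fin n → E) × E)) = linSol K S Y)
    (κ : Fin r → K) : ∑ l, κ l • v l ∈ linSol K S Y := by
  rw [← hv]
  exact Submodule.sum_mem _ fun l _ => Submodule.smul_mem _ _ (Submodule.subset_span ⟨l, rfl⟩)

/-- A solution `(c, x₁ + μ x₂)` of the composed problem comes from a solution `(c, x₁)` of the first
one, which is a combination of the `v l` with unique constants `κ`, and then `(κ, x₂)` solves the
second problem for the right-hand sides attached to the `v l`. `combineMap` reverses this passage.
It is injective on the solutions of the second problem by `huniq`, so it sends the basis `w` to a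
basis. -/
theorem composed_basis {S S₁ S₂ : Submodule K (E × E)} {n r s : ℕ} {Y Y₁ : Fin n → E}
    {v : Fin r → (Fin n → E) × E} {w : Fin s → (Fin r → E) × E}
    {μ : E →ₗ[K] E} {δ : E × E →ₗ[K] E}
    (hv : LinearIndependent K v)
    (hvs : (Submodule.span K (Set.range v) : Set ((Fin n → E) × E)) = linSol K S₁ Y₁)
    (hw : LinearIndependent K w)
    (hws : (Submodule.span K (Set.range w) : Set ((Fin r → E) × E)) =
      linSol K S₂ fun l => δ ((v l).2, ∑ i, (v l).1 i * Y i))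
    (hdec : ∀ c : Fin n → E, (∀ i, c i ∈ K) → ∀ x, (x, ∑ i, c i * Y i) ∈ S ↔
      ∃ x₁ x₂, x = x₁ + μ x₂ ∧ (x₁, ∑ i, c i * Y₁ i) ∈ S₁ ∧
        (x₂, δ (x₁, ∑ i, c i * Y i)) ∈ S₂)
    (huniq : ∀ x₁ x₂, (x₁, 0) ∈ S₁ → (x₂, δ (x₁, 0)) ∈ S₂ → x₁ + μ x₂ = 0 → x₁ = 0 ∧ x₂ = 0) :
    LinearIndependent K (fun j => combineMap v μ (w j)) ∧
    (Submodule.span K (Set.range fun j => combineMap v μ (w j)) : Set ((Fin n → E) × E)) =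
      linSol K S Y := by
  -- By linearity of `δ`, the right-hand side attached to a combination of the `v l` is the
  -- combination of their right-hand sides.
  have key : ∀ κ : Fin r → K, ∑ l, (κ l : E) * δ ((v l).2, ∑ i, (v l).1 i * Y i) =
      δ ((∑ l, κ l • v l).2, ∑ i, (∑ l, κ l • v l).1 i * Y i) := by
    intro κ
    have : ∑ l, (κ l : E) * δ ((v l).2, ∑ i, (v l).1 i * Y i) =
        δ (∑ l, κ l • ((v l).2, ∑ i, (v l).1 i * Y i)) := by
      rw [map_sum]
      exact Finset.sum_congr rfl fun l _ => (δ.map_smul (κ l) _).symm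
    rw [this]
    congr 1
    ext
    · simp [Prod.fst_sum, Prod.snd_sum]
    · simp only [Prod.snd_sum, Prod.smul_snd, Prod.fst_sum, Prod.smul_fst, Finset.sum_apply,
        Pi.smul_apply, Subring.smul_def, smul_eq_mul, Finset.mul_sum, Finset.sum_mul, mul_assoc]
      rw [Finset.sum_comm]
  have lift : ∀ y ∈ Submodule.span K (Set.range w), ∃ κ : Fin r → K, y = (fun l => (κ l : E), y.2) ∧
      (y.2, δ ((∑ l, κ l • v l).2, ∑ i, (∑ l, κ l • v l).1 i * Y i)) ∈ S₂ := by
    intro y hy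
    have hy' : y ∈ linSol K S₂ fun l => δ ((v l).2, ∑ i, (v l).1 i * Y i) := by
      rwa [← hws]
    refine ⟨fun l => ⟨y.1 l, hy'.1 l⟩, rfl, ?_⟩
    have := hy'.2
    rw [← key]
    exact this
  -- If the image vanishes, its constants are zero, so `x₁` solves the first problem for `0`;
  -- `huniq` gives `x₁ = x₂ = 0`, and independence of `v` gives `κ = 0`.
  have hinj : Set.InjOn (combineMap v μ) (Submodule.span K (Set.range w)) := by
    suffices h : ∀ y ∈ Submodule.span K (Set.range w), combineMap v μ y = 0 → y = 0 by
      intro y hy y' hy' h'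
      exact sub_eq_zero.1 (h _ (Submodule.sub_mem _ hy hy') (by rw [map_sub, h', sub_self]))
    intro y hy h0
    obtain ⟨κ, hκ, hy2⟩ := lift y hy
    rw [hκ, combineMap_eq] at h0
    have hm := mem_linSol_of_mem_span hvs κ
    have h1 : (∑ l, κ l • v l).1 = 0 := by simpa using congrArg Prod.fst h0
    have h2 : (∑ l, κ l • v l).2 + μ y.2 = 0 := by simpa using congrArg Prod.snd h0
    have hs1 := hm.2
    simp only [h1, Pi.zero_apply, zero_mul, Finset.sum_const_zero] at hs1 hy2
    obtain ⟨e1, e2⟩ := huniq _ _ hs1 hy2 h2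
    have : ∑ l, κ l • v l = 0 := Prod.ext h1 e1
    have hκ0 := Fintype.linearIndependent_iff.1 hv κ this
    rw [hκ, e2]
    ext <;> simp [hκ0]
  refine ⟨hw.map_injOn _ hinj, ?_⟩
  have hr : (Set.range fun j => combineMap v μ (w j)) = combineMap v μ '' Set.range w := by
    rw [← Set.range_comp]; rfl
  rw [hr, Submodule.span_image]
  ext ⟨c, x⟩
  simp only [Submodule.map_coe, Set.mem_image, SetLike.mem_coe]
  constructor
  · rintro ⟨y, hy, hyx⟩
    obtain ⟨κ, hκ, hy2⟩ := lift y hy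
    rw [hκ, combineMap_eq] at hyx
    have hm := mem_linSol_of_mem_span hvs κ
    have h1 : (∑ l, κ l • v l).1 = c := by simpa using congrArg Prod.fst hyx
    have h2 : (∑ l, κ l • v l).2 + μ y.2 = x := by simpa using congrArg Prod.snd hyx
    rw [h1] at hy2
    have hc : ∀ i, c i ∈ K := h1 ▸ hm.1
    refine ⟨hc, (hdec c hc x).2 ⟨_, _, h2.symm, ?_, hy2⟩⟩
    have := hm.2
    rwa [h1] at this
  · rintro ⟨hc, hx⟩
    obtain ⟨x₁, x₂, rfl, h1, h2⟩ := (hdec c hc x).1 hx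
    have : ((c, x₁) : (Fin n → E) × E) ∈ Submodule.span K (Set.range v) := by
      have : ((c, x₁) : (Fin n → E) × E) ∈ linSol K S₁ Y₁ := ⟨hc, h1⟩
      rwa [← hvs] at this
    obtain ⟨κ, hκ⟩ := (Submodule.mem_span_range_iff_exists_fun K).1 this
    refine ⟨(fun l => (κ l : E), x₂), ?_, ?_⟩
    · have : ((fun l => (κ l : E), x₂) : (Fin r → E) × E) ∈
          linSol K S₂ fun l => δ ((v l).2, ∑ i, (v l).1 i * Y i) := by
        refine ⟨fun l => (κ l).2, ?_⟩
        change (x₂, ∑ l, (κ l : E) * δ ((v l).2, ∑ i, (v l).1 i * Y i)) ∈ S₂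
        rw [key, hκ]
        exact h2
      rwa [← hws] at this
    · rw [combineMap_eq, hκ]
      ext <;> simp

end LinearProblems

/-! ### Algorithms for linear problems and their composition -/

section Solvers

variable {E : Type*} [CommRing E] (K : Subring E)

/-- The sum of the products of the entries of two lists. -/
def listDot (a b : List E) : E :=
  ((List.range a.length).map fun i => a.getD i 0 * b.getD i 0).sum

theorem sum_map_range_eq {n : ℕ} (f : ℕ → E) : ((List.range n).map f).sum = ∑ i : Fin n, f i := by
  rw [← Fin.sum_ofFn, List.ofFn_eq_map, ← List.map_coe_finRange_eq_range, List.map_map]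
  rfl

theorem getD_ofFn {α : Type*} {n : ℕ} (f : Fin n → α) (d : α) (i : Fin n) :
    (List.ofFn f).getD i d = f i := by
  simp [List.getD_eq_getElem?_getD]

theorem listDot_ofFn {n : ℕ} (a b : Fin n → E) :
    listDot (List.ofFn a) (List.ofFn b) = ∑ i, a i * b i := by
  simp only [listDot, List.length_ofFn, sum_map_range_eq, getD_ofFn]

theorem map_range_eq_ofFn {α : Type*} (n : ℕ) (f : ℕ → α) :
    (List.range n).map f = List.ofFn fun i : Fin n => f i := by
  rw [List.ofFn_eq_map, ← List.map_coe_finRange_eq_range, List.map_map]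
  rfl

/-- The combination of a solution of the second problem with the solutions of the first one. -/
def listCombine (n : ℕ) (B : List (List E × E)) (b : List E × E) (m : E) : List E × E :=
  ((List.range n).map fun i => listDot b.1 (B.map fun c => c.1.getD i 0),
    listDot b.1 (B.map Prod.snd) + m)

theorem listCombine_ofFn {n r : ℕ} (v : Fin r → (Fin n → E) × E) (μ : E →ₗ[K] E)
    (y : (Fin r → E) × E) :
    listCombine n (List.ofFn fun j => (List.ofFn (v j).1, (v j).2)) (List.ofFn y.1, y.2) (μ y.2) =
      (List.ofFn (combineMap v μ y).1, (combineMap v μ y).2) := by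
  simp only [listCombine, List.map_ofFn, map_range_eq_ofFn, combineMap, LinearMap.coe_mk,
    AddHom.coe_mk, Function.comp_def, listDot_ofFn, getD_ofFn]

variable [Primcodable E]
variable {P Q : Type*} [Primcodable P] [Primcodable Q]

/-- There is an algorithm that solves the linear problems `S p`, for valid parameters `p` and
right-hand sides in `dom p`. -/
def Solvable (S : P → Submodule K (E × E)) (valid : P → Prop) (dom : P → Submodule K E) : Prop :=
  ∃ alg : P × List E →. List (List E × E), Partrec alg ∧
    ∀ p, valid p → ∀ (n : ℕ) (Y : Fin n → E), (∀ i, Y i ∈ dom p) →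
      ∃ B ∈ alg (p, List.ofFn Y), IsBasisList K B (linSol K (S p) Y)

variable {K}

variable (hadd : Computable₂ fun x y : E => x + y) (hmul : Computable₂ fun x y : E => x * y)

section
include hadd hmul

theorem computable_listDot : Computable₂ (listDot (E := E)) := by
  refine Computable.list_sum hadd (Computable.list_map (g := fun (p : List E × List E) i =>
    p.1.getD i 0 * p.2.getD i 0)
    (Primrec.list_range.to_comp.comp (Computable.list_length.comp Computable.fst)) ?_)
  exact hmul.comp
    ((Computable.list_getD 0).comp (Computable.fst.comp Computable.fst) Computable.snd)
    ((Computable.list_getD 0).comp (Computable.snd.comp Computable.fst) Computable.snd)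

theorem computable_listCombine : Computable
    fun p : (ℕ × List (List E × E)) × (List E × E) × E => listCombine p.1.1 p.1.2 p.2.1 p.2.2 := by
  have hdot := computable_listDot hadd hmul
  have hb : Computable fun p : (ℕ × List (List E × E)) × (List E × E) × E => p.2.1.1 :=
    Computable.fst.comp (Computable.fst.comp Computable.snd)
  have hB : Computable fun p : (ℕ × List (List E × E)) × (List E × E) × E => p.1.2 :=
    Computable.snd.comp Computable.fst
  have hcol : Computable₂ fun (p : (ℕ × List (List E × E)) × (List E × E) × E) (i : ℕ) =>
      p.1.2.map fun c => c.1.getD i 0 := by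
    have hg : Computable₂ fun (q : ((ℕ × List (List E × E)) × (List E × E) × E) × ℕ)
        (c : List E × E) => c.1.getD q.2 0 :=
      (Computable.list_getD 0).comp (Computable.fst.comp Computable.snd)
        (Computable.snd.comp Computable.fst)
    exact Computable.list_map (hB.comp Computable.fst) hg
  have hentry : Computable₂ fun (p : (ℕ × List (List E × E)) × (List E × E) × E) (i : ℕ) =>
      listDot p.2.1.1 (p.1.2.map fun c => c.1.getD i 0) :=
    hdot.comp (hb.comp Computable.fst) hcol
  have hrange : Computable fun p : (ℕ × List (List E × E)) × (List E × E) × E =>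
      List.range p.1.1 := Primrec.list_range.to_comp.comp (Computable.fst.comp Computable.fst)
  have hlast : Computable fun p : (ℕ × List (List E × E)) × (List E × E) × E =>
      p.1.2.map Prod.snd := Computable.list_map hB (Computable.snd.comp Computable.snd)
  exact (Computable.list_map hrange hentry).pair
    (hadd.comp (hdot.comp hb hlast) (Computable.snd.comp Computable.snd))

/-- The algorithm that passes from a basis for the first problem to one for the composed problem. -/
theorem exists_composition_step {S₂ : Q → Submodule K (E × E)} {valid₂ : Q → Prop}
    {dom₂ : Q → Submodule K E} (h₂ : Solvable K S₂ valid₂ dom₂) {q : P → Q} (hq : Computable q)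
    {μ : P → E →ₗ[K] E} (hμ : Computable₂ fun p x => μ p x)
    {δ : P → E × E →ₗ[K] E} (hδ : Computable₂ fun p x => δ p x) :
    ∃ step : P × List E × List (List E × E) →. List (List E × E), Partrec step ∧
      ∀ (p : P) (S S₁ : Submodule K (E × E)) (n : ℕ) (Y Y₁ : Fin n → E) (B₁ : List (List E × E)),
        valid₂ (q p) → IsBasisList K B₁ (linSol K S₁ Y₁) →
        (∀ c : Fin n → E, (∀ i, c i ∈ K) → ∀ x₁, (x₁, ∑ i, c i * Y₁ i) ∈ S₁ →
          δ p (x₁, ∑ i, c i * Y i) ∈ dom₂ (q p)) →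
        (∀ c : Fin n → E, (∀ i, c i ∈ K) → ∀ x, (x, ∑ i, c i * Y i) ∈ S ↔
          ∃ x₁ x₂, x = x₁ + μ p x₂ ∧ (x₁, ∑ i, c i * Y₁ i) ∈ S₁ ∧
            (x₂, δ p (x₁, ∑ i, c i * Y i)) ∈ S₂ (q p)) →
        (∀ x₁ x₂, (x₁, 0) ∈ S₁ → (x₂, δ p (x₁, 0)) ∈ S₂ (q p) → x₁ + μ p x₂ = 0 →
          x₁ = 0 ∧ x₂ = 0) →
        ∃ B ∈ step (p, List.ofFn Y, B₁), IsBasisList K B (linSol K S Y) := by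
  obtain ⟨alg, halg, hspec⟩ := h₂
  -- Each basis vector of the first problem contributes one right-hand side to the second.
  let rhs : P × List E × List (List E × E) → List E := fun a =>
    a.2.2.map fun b => δ a.1 (b.2, listDot b.1 a.2.1)
  have hrhs : Computable rhs := by
    refine Computable.list_map (Computable.snd.comp Computable.snd) ?_
    refine hδ.comp (Computable.fst.comp Computable.fst)
      ((Computable.snd.comp Computable.snd).pair ((computable_listDot hadd hmul).comp
        (Computable.fst.comp Computable.snd)
        (Computable.fst.comp (Computable.snd.comp Computable.fst))))
  refine ⟨fun a => (alg (q a.1, rhs a)).map fun B₂ =>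
    B₂.map fun b => listCombine a.2.1.length a.2.2 b (μ a.1 b.2), ?_, ?_⟩
  · refine Partrec.map (halg.comp ((hq.comp Computable.fst).pair hrhs)) ?_
    refine Computable.list_map Computable.snd ?_
    refine Computable₂.mk ?_
    refine Computable.comp (f := fun p : (ℕ × List (List E × E)) × (List E × E) × E =>
      listCombine p.1.1 p.1.2 p.2.1 p.2.2)
      (g := fun p : ((P × List E × List (List E × E)) × List (List E × E)) × (List E × E) =>
        ((p.1.1.2.1.length, p.1.1.2.2), (p.2, μ p.1.1.1 p.2.2)))
      (computable_listCombine hadd hmul)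
      ((Computable.pair (Computable.list_length.comp ?_) ?_).pair (Computable.snd.pair ?_))
    · exact Computable.fst.comp (Computable.snd.comp (Computable.fst.comp Computable.fst))
    · exact Computable.snd.comp (Computable.snd.comp (Computable.fst.comp Computable.fst))
    · exact hμ.comp (Computable.fst.comp (Computable.fst.comp Computable.fst))
        (Computable.snd.comp Computable.snd)
  · rintro p S S₁ n Y Y₁ B₁ hval ⟨r, v, rfl, hv, hvs⟩ hdom hdec huniq
    have hr : rhs (p, List.ofFn Y, List.ofFn fun j => (List.ofFn (v j).1, (v j).2)) =
        List.ofFn fun l => δ p ((v l).2, ∑ i, (v l).1 i * Y i) := by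
      simp only [rhs, List.map_ofFn, Function.comp_def, listDot_ofFn]
    obtain ⟨B, hB, s, w, rfl, hw, hws⟩ := hspec (q p) hval r
      (fun l => δ p ((v l).2, ∑ i, (v l).1 i * Y i)) (fun l => by
        have : v l ∈ linSol K S₁ Y₁ := hvs ▸ Submodule.subset_span ⟨l, rfl⟩
        exact hdom _ this.1 _ this.2)
    refine ⟨_, Part.mem_map _ (hr ▸ hB), s, fun j => combineMap v (μ p) (w j), ?_,
      composed_basis hv hvs hw hws hdec huniq⟩
    simp only [List.map_ofFn, Function.comp_def, List.length_ofFn, listCombine_ofFn]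

/-- Composition of two linear problems: a solution `x` is `x₁ + μ x₂`, where `x₁` solves the first
problem, and `x₂` solves the second one for a right-hand side that depends on `x₁`. -/
theorem Solvable.compose {S S₁ : P → Submodule K (E × E)} {S₂ : Q → Submodule K (E × E)}
    {valid valid₁ : P → Prop} {valid₂ : Q → Prop}
    {dom dom₁ : P → Submodule K E} {dom₂ : Q → Submodule K E}
    (h₁ : Solvable K S₁ valid₁ dom₁) (h₂ : Solvable K S₂ valid₂ dom₂)
    {q : P → Q} (hq : Computable q) {ρ : P → E →ₗ[K] E} (hρ : Computable₂ fun p x => ρ p x)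
    {μ : P → E →ₗ[K] E} (hμ : Computable₂ fun p x => μ p x)
    {δ : P → E × E →ₗ[K] E} (hδ : Computable₂ fun p x => δ p x)
    (hval₁ : ∀ p, valid p → valid₁ p) (hval₂ : ∀ p, valid p → valid₂ (q p))
    (hdom₁ : ∀ p, valid p → ∀ z ∈ dom p, ρ p z ∈ dom₁ p)
    (hdom₂ : ∀ p, valid p → ∀ z ∈ dom p, ∀ x₁, (x₁, ρ p z) ∈ S₁ p → δ p (x₁, z) ∈ dom₂ (q p))
    (hdec : ∀ p, valid p → ∀ z ∈ dom p, ∀ x, (x, z) ∈ S p ↔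
      ∃ x₁ x₂, x = x₁ + μ p x₂ ∧ (x₁, ρ p z) ∈ S₁ p ∧ (x₂, δ p (x₁, z)) ∈ S₂ (q p))
    (huniq : ∀ p, valid p → ∀ x₁ x₂, (x₁, 0) ∈ S₁ p → (x₂, δ p (x₁, 0)) ∈ S₂ (q p) →
      x₁ + μ p x₂ = 0 → x₁ = 0 ∧ x₂ = 0) : Solvable K S valid dom := by
  obtain ⟨step, hstep, hspec⟩ := exists_composition_step hadd hmul h₂ hq hμ hδ
  obtain ⟨alg, halg, h⟩ := h₁
  refine ⟨fun a => (alg (a.1, a.2.map (ρ a.1))).bind fun B => step (a.1, a.2, B), ?_, ?_⟩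
  · refine Partrec.bind (halg.comp (Computable.fst.pair (Computable.list_map Computable.snd ?_)))
      (hstep.comp ?_)
    · exact hρ.comp (Computable.fst.comp Computable.fst) Computable.snd
    · exact (Computable.fst.comp Computable.fst).pair
        ((Computable.snd.comp Computable.fst).pair Computable.snd)
  · intro p hp n Y hY
    obtain ⟨B₁, hB₁, hb₁⟩ := h p (hval₁ p hp) n (fun i => ρ p (Y i))
      fun i => hdom₁ p hp _ (hY i)
    have hs : ∀ c : Fin n → E, (∀ i, c i ∈ K) → ∑ i, c i * ρ p (Y i) = ρ p (∑ i, c i * Y i) := by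
      intro c hc
      rw [map_sum]
      exact Finset.sum_congr rfl fun i _ => ((ρ p).map_smul ⟨c i, hc i⟩ (Y i)).symm
    have hd : ∀ c : Fin n → E, (∀ i, c i ∈ K) → ∑ i, c i * Y i ∈ dom p := fun c hc =>
      Submodule.sum_mem _ fun i _ => Submodule.smul_mem _ (⟨c i, hc i⟩ : K) (hY i)
    obtain ⟨B, hB, hb⟩ := hspec p (S p) (S₁ p) n Y (fun i => ρ p (Y i)) B₁ (hval₂ p hp) hb₁
      (fun c hc x₁ hx₁ => hdom₂ p hp _ (hd c hc) _ (hs c hc ▸ hx₁))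
      (fun c hc x => by rw [hs c hc]; exact hdec p hp _ (hd c hc) x) (huniq p hp)
    refine ⟨B, Part.mem_bind_iff.2 ⟨B₁, ?_, hB⟩, hb⟩
    simpa only [List.map_ofFn, Function.comp_def] using hB₁

/-- Iterated composition. -/
theorem Solvable.iterate {S : P → ℕ → Submodule K (E × E)} {S₂ : Q → Submodule K (E × E)}
    {valid : P → Prop} {vstep : P → ℕ → Prop} {valid₂ : Q → Prop}
    {dom : P → Submodule K E} {dom₂ : Q → Submodule K E}
    (h₀ : Solvable K (fun p => S p 0) valid dom) (h₂ : Solvable K S₂ valid₂ dom₂)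
    {q : P × ℕ → Q} (hq : Computable q)
    {μ : P × ℕ → E →ₗ[K] E} (hμ : Computable₂ fun p x => μ p x)
    {δ : P × ℕ → E × E →ₗ[K] E} (hδ : Computable₂ fun p x => δ p x)
    (hval₂ : ∀ p, valid p → ∀ i, vstep p i → valid₂ (q (p, i)))
    (hdom₂ : ∀ p, valid p → ∀ i, vstep p i → ∀ z ∈ dom p, ∀ x₁, (x₁, z) ∈ S p i →
      δ (p, i) (x₁, z) ∈ dom₂ (q (p, i)))
    (hdec : ∀ p, valid p → ∀ i, vstep p i → ∀ z ∈ dom p, ∀ x, (x, z) ∈ S p (i + 1) ↔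
      ∃ x₁ x₂, x = x₁ + μ (p, i) x₂ ∧ (x₁, z) ∈ S p i ∧ (x₂, δ (p, i) (x₁, z)) ∈ S₂ (q (p, i)))
    (huniq : ∀ p, valid p → ∀ i, vstep p i → ∀ x₁ x₂, (x₁, 0) ∈ S p i →
      (x₂, δ (p, i) (x₁, 0)) ∈ S₂ (q (p, i)) → x₁ + μ (p, i) x₂ = 0 → x₁ = 0 ∧ x₂ = 0) :
    Solvable K (fun p : P × ℕ => S p.1 p.2) (fun p => valid p.1 ∧ ∀ i < p.2, vstep p.1 i)
      (fun p => dom p.1) := by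
  obtain ⟨step, hstep, hspec⟩ := exists_composition_step hadd hmul h₂ hq hμ hδ
  obtain ⟨alg, halg, h⟩ := h₀
  -- The number of compositions is part of the input, so the recursion has to take place inside the
  -- algorithm.
  refine ⟨fun a => Nat.rec (alg (a.1.1, a.2))
    (fun i B => B.bind fun B => step ((a.1.1, i), a.2, B)) a.1.2, ?_, ?_⟩
  · refine Partrec.nat_rec (f := fun a : (P × ℕ) × List E => a.1.2)
      (g := fun a => alg (a.1.1, a.2)) (h := fun a b => step ((a.1.1, b.1), a.2, b.2))
      (Computable.snd.comp Computable.fst) (halg.comp ?_) (hstep.comp ?_)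
    · exact (Computable.fst.comp Computable.fst).pair Computable.snd
    · exact ((Computable.fst.comp (Computable.fst.comp Computable.fst)).pair
        (Computable.fst.comp Computable.snd)).pair ((Computable.snd.comp Computable.fst).pair
          (Computable.snd.comp Computable.snd))
  · rintro ⟨p, m⟩ ⟨hp, hm⟩ n Y hY
    have hd : ∀ c : Fin n → E, (∀ i, c i ∈ K) → ∑ i, c i * Y i ∈ dom p := fun c hc =>
      Submodule.sum_mem _ fun i _ => Submodule.smul_mem _ (⟨c i, hc i⟩ : K) (hY i)
    dsimp only at hm hY ⊢
    induction m with
    | zero => exact h p hp n Y hY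
    | succ m ih =>
      obtain ⟨B₁, hB₁, hb₁⟩ := ih hp fun i hi => hm i (Nat.lt_succ_of_lt hi)
      have hv := hm m (Nat.lt_succ_self m)
      obtain ⟨B, hB, hb⟩ := hspec (p, m) (S p (m + 1)) (S p m) n Y Y B₁ (hval₂ p hp m hv) hb₁
        (fun c hc x₁ hx₁ => hdom₂ p hp m hv _ (hd c hc) _ hx₁)
        (fun c hc x => hdec p hp m hv _ (hd c hc) x) (huniq p hp m hv)
      exact ⟨B, Part.mem_bind_iff.2 ⟨B₁, hB₁, hB⟩, hb⟩

end

/-- Linear problems with a unique solution, which is given explicitly. -/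
theorem Solvable.of_graph {R : P → E →ₗ[K] E} (hR : Computable₂ fun p x => R p x)
    {S : P → Submodule K (E × E)} {valid : P → Prop} {dom : P → Submodule K E}
    (hS : ∀ p, valid p → ∀ z ∈ dom p, ∀ x, (x, z) ∈ S p ↔ x = R p z) : Solvable K S valid dom := by
  refine ⟨fun a => Part.some ((List.range a.2.length).map fun j =>
    ((List.range a.2.length).map fun i => bif decide (i = j) then (1 : E) else 0,
      R a.1 (a.2.getD j 0))), ?_, ?_⟩
  · refine Computable.partrec (f := fun a : P × List E => (List.range a.2.length).map fun j =>
      ((List.range a.2.length).map fun i => bif decide (i = j) then (1 : E) else 0,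
      R a.1 (a.2.getD j 0))) ?_
    have hr : Computable fun a : P × List E => List.range a.2.length :=
      Primrec.list_range.to_comp.comp (Computable.list_length.comp Computable.snd)
    refine Computable.list_map hr (Computable.pair ?_ ?_)
    · refine Computable.list_map (hr.comp Computable.fst) ?_
      exact Computable.cond (Computable.decide_eq Computable.snd
        (Computable.snd.comp Computable.fst)) (Computable.const _) (Computable.const _)
    · exact hR.comp (Computable.fst.comp Computable.fst)
        ((Computable.list_getD 0).comp (Computable.snd.comp Computable.fst) Computable.snd)
  · intro p hp n Y hY
    have hd : ∀ c : Fin n → E, (∀ i, c i ∈ K) → ∑ i, c i * Y i ∈ dom p := fun c hc =>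
      Submodule.sum_mem _ fun i _ => Submodule.smul_mem _ (⟨c i, hc i⟩ : K) (hY i)
    have hs : ∀ κ : Fin n → K, ∑ l, κ l • ((Pi.single l 1, R p (Y l)) : (Fin n → E) × E) =
        (fun i => (κ i : E), R p (∑ i, κ i * Y i)) := by
      intro κ
      ext
      · simp [Prod.fst_sum, Subring.smul_def, Pi.single_apply]
      · simp only [Prod.snd_sum, Prod.smul_snd, map_sum]
        exact Finset.sum_congr rfl fun i _ => ((R p).map_smul (κ i) (Y i)).symm
    refine ⟨_, Part.mem_some _, n, fun j => (Pi.single j 1, R p (Y j)), ?_, ?_, ?_⟩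
    · simp only [List.length_ofFn, map_range_eq_ofFn, getD_ofFn]
      refine congrArg List.ofFn (funext fun j => ?_)
      rw [Prod.mk.injEq]
      refine ⟨congrArg List.ofFn (funext fun i => ?_), rfl⟩
      simp only [Pi.single_apply, Fin.ext_iff, cond_eq_ite, decide_eq_true_eq]
    · rw [Fintype.linearIndependent_iff]
      intro κ hκ i
      rw [hs] at hκ
      exact Subtype.ext (congrFun (congrArg Prod.fst hκ) i)
    · ext ⟨c, x⟩
      rw [SetLike.mem_coe, Submodule.mem_span_range_iff_exists_fun]
      simp only [hs]
      constructor
      · rintro ⟨κ, h⟩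
        rw [Prod.mk.injEq] at h
        obtain ⟨rfl, rfl⟩ := h
        exact ⟨fun i => (κ i).2, (hS p hp _ (hd _ fun i => (κ i).2) _).2 rfl⟩
      · rintro ⟨hc, hx⟩
        refine ⟨fun i => ⟨c i, hc i⟩, ?_⟩
        rw [Prod.mk.injEq]
        exact ⟨rfl, ((hS p hp _ (hd _ hc) _).1 hx).symm⟩

/-- Change of the problem and its parameter, which may depend on the right-hand sides. -/
theorem Solvable.comap {S : P → Submodule K (E × E)} {S' : Q → Submodule K (E × E)}
    {valid : P → Prop} {valid' : Q → Prop} {dom : P → Submodule K E} {dom' : Q → Submodule K E}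
    (h : Solvable K S' valid' dom') {q : P × List E →. Q} (hq : Partrec q)
    (hS : ∀ p, valid p → ∀ (n : ℕ) (Y : Fin n → E), (∀ i, Y i ∈ dom p) →
      ∃ b ∈ q (p, List.ofFn Y), valid' b ∧ (∀ i, Y i ∈ dom' b) ∧
        ∀ c : Fin n → E, (∀ i, c i ∈ K) → ∀ x,
          (x, ∑ i, c i * Y i) ∈ S p ↔ (x, ∑ i, c i * Y i) ∈ S' b) :
    Solvable K S valid dom := by
  obtain ⟨alg, halg, h⟩ := h
  refine ⟨fun a => (q a).bind fun b => alg (b, a.2), ?_, ?_⟩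
  · exact Partrec.bind hq (halg.comp (Computable.snd.pair (Computable.snd.comp Computable.fst)))
  · intro p hp n Y hY
    obtain ⟨b, hb, hb', hY', hS'⟩ := hS p hp n Y hY
    obtain ⟨B, hB, hbas⟩ := h b hb' n Y hY'
    refine ⟨B, Part.mem_bind_iff.2 ⟨b, hb, hB⟩, ?_⟩
    have : linSol K (S p) Y = linSol K (S' b) Y := by
      ext ⟨c, x⟩
      exact and_congr_right fun hc => hS' c hc x
    rwa [this]

/-- Case distinction. -/
theorem Solvable.cond {S : P → Submodule K (E × E)} {valid : P → Prop} {dom : P → Submodule K E}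
    {t : P → Bool} (ht : Computable t)
    (h₁ : Solvable K S (fun p => valid p ∧ t p = true) dom)
    (h₂ : Solvable K S (fun p => valid p ∧ t p = false) dom) : Solvable K S valid dom := by
  obtain ⟨alg₁, halg₁, h₁⟩ := h₁
  obtain ⟨alg₂, halg₂, h₂⟩ := h₂
  refine ⟨fun a => bif t a.1 then alg₁ a else alg₂ a,
    Partrec.cond (ht.comp Computable.fst) halg₁ halg₂, fun p hp n Y hY => ?_⟩
  cases h : t p
  · simpa [h] using h₂ p ⟨hp, h⟩ n Y hY
  · simpa [h] using h₁ p ⟨hp, h⟩ n Y hY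

end Solvers

/-! ### Monomials of an RΠΣ-extension -/

section MonomialPowers

/-- The exponents in normal form of a monomial. -/
def IsNormalExp : MonomialKind → ℤ → Prop
  | MonomialKind.root l, j => 0 ≤ j ∧ j < l
  | MonomialKind.pi, _ => True
  | MonomialKind.sigma, j => 0 ≤ j

/-- The normal form of an exponent. -/
def normalExp : MonomialKind → ℤ → ℤ
  | MonomialKind.root l, j => j % l
  | MonomialKind.pi, j => j
  | MonomialKind.sigma, j => j.toNat

/-- A unit, or root of unity, as required of a monomial of the given type. -/
def IsMonomialBase {E : Type*} [CommRing E] (x : E) : MonomialKind → Prop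
  | MonomialKind.root l => 1 < l ∧ x ^ l = 1
  | MonomialKind.pi => IsUnit x
  | MonomialKind.sigma => True

variable {E : Type*} [CommRing E] {x : E} {k : MonomialKind}

theorem IsMonomialBase.isUnit (h : IsMonomialBase x k) (hk : k ≠ MonomialKind.sigma) :
    IsUnit x := by
  cases k with
  | root l => exact IsUnit.of_pow_eq_one h.2 (by have := h.1; omega)
  | pi => exact h
  | sigma => exact absurd rfl hk

theorem genPow_unit (w : Eˣ) (m : ℤ) (hk : k ≠ MonomialKind.sigma) :
    genPow (w : E) m k = ((w ^ m : Eˣ) : E) := by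
  cases k with
  | root l => exact zpowInv_units w m
  | pi => exact zpowInv_units w m
  | sigma => exact absurd rfl hk

@[simp] theorem genPow_zero : genPow x 0 k = 1 := by
  cases k <;> simp [genPow, zpowInv]

theorem genPow_natCast (n : ℕ) : genPow x (n : ℤ) k = x ^ n := by
  cases k <;> simp [genPow, zpowInv]

theorem genPow_one : genPow x 1 k = x := by simpa using genPow_natCast (x := x) (k := k) 1

theorem IsMonomialBase.genPow_add (h : IsMonomialBase x k) {a b : ℤ}
    (ha : k = MonomialKind.sigma → 0 ≤ a) (hb : k = MonomialKind.sigma → 0 ≤ b) :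
    genPow x (a + b) k = genPow x a k * genPow x b k := by
  by_cases hk : k = MonomialKind.sigma
  · subst hk
    simp only [genPow]
    rw [Int.toNat_add (ha rfl) (hb rfl), pow_add]
  · obtain ⟨w, rfl⟩ := h.isUnit hk
    simp only [genPow_unit w _ hk, zpow_add, Units.val_mul]

theorem IsMonomialBase.genPow_normalExp (h : IsMonomialBase x k) (a : ℤ) :
    genPow x (normalExp k a) k = genPow x a k := by
  cases k with
  | root l =>
    obtain ⟨w, rfl⟩ := h.isUnit (by simp)
    rw [genPow_unit w _ (by simp), genPow_unit w _ (by simp)]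
    have hw : w ^ (l : ℤ) = 1 := by
      ext
      simpa using h.2
    congr 1
    simp only [normalExp]
    conv_rhs => rw [← Int.mul_ediv_add_emod a l, zpow_add, zpow_mul, hw, one_zpow, one_mul]
  | pi => rfl
  | sigma => simp only [genPow, normalExp, Int.toNat_natCast]

theorem IsMonomialBase.isNormalExp (h : IsMonomialBase x k) (a : ℤ) :
    IsNormalExp k (normalExp k a) := by
  cases k with
  | root l =>
    have : (0 : ℤ) < l := by have := h.1; omega
    exact ⟨Int.emod_nonneg _ this.ne', Int.emod_lt_of_pos _ this⟩
  | pi => trivial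
  | sigma => simp [IsNormalExp, normalExp]

theorem normalExp_zero : normalExp k 0 = 0 := by cases k <;> simp [normalExp]

theorem IsNormalExp.nonneg {a : ℤ} (h : IsNormalExp k a) (hk : k = MonomialKind.sigma) : 0 ≤ a := by
  subst hk; exact h

theorem isNormalExp_zero (h : IsMonomialBase x k) : IsNormalExp k 0 := by
  simpa [normalExp_zero] using h.isNormalExp 0

theorem Transcendental.linearIndependent_pow {A : Type*} [CommRing A] [Algebra A E]
    (h : Transcendental A x) : LinearIndependent A fun n : ℕ => x ^ n := by
  rw [linearIndependent_iff']
  intro s g hg i hi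
  rw [transcendental_iff_injective] at h
  have h0 : (∑ n ∈ s, Polynomial.monomial n (g n) : Polynomial A) = 0 := by
    apply h
    simp only [map_sum, Polynomial.aeval_monomial, map_zero]
    simpa [Algebra.smul_def] using hg
  have := congrArg (fun p => Polynomial.coeff p i) h0
  simpa [Polynomial.finsetSum_coeff, Polynomial.coeff_monomial, hi] using this

/-- A relation between finitely many integer powers turns into one between natural powers after
multiplication by a high power of `w`. -/
theorem Transcendental.linearIndependent_zpow {A : Type*} [CommRing A] [Algebra A E] {w : Eˣ}
    (h : Transcendental A (w : E)) : LinearIndependent A fun n : ℤ => ((w ^ n : Eˣ) : E) := by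
  have hp := h.linearIndependent_pow
  rw [linearIndependent_iff']
  intro s g hg
  set N : ℕ := ∑ j ∈ s, j.natAbs with hN
  have hle : ∀ j ∈ s, 0 ≤ j + N := fun j hj => by
    have : j.natAbs ≤ N := Finset.single_le_sum (f := Int.natAbs) (fun _ _ => Nat.zero_le _) hj
    omega
  have hs : LinearIndependent A fun j : s => (w : E) ^ ((j : ℤ) + N).toNat := by
    refine hp.comp (fun j : s => ((j : ℤ) + N).toNat) ?_
    intro i j hij
    have h1 := hle i i.2
    have h2 := hle j j.2
    apply Subtype.ext
    dsimp only at hij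
    omega
  have h0 : ∑ j : s, g j • (w : E) ^ ((j : ℤ) + N).toNat = 0 := by
    have : ∀ j : s, g j • (w : E) ^ ((j : ℤ) + N).toNat =
        (w : E) ^ N * (g j • ((w ^ (j : ℤ) : Eˣ) : E)) := by
      intro j
      rw [mul_smul_comm]
      congr 1
      have h1 := hle j j.2
      rw [← Units.val_pow_eq_pow_val, ← Units.val_pow_eq_pow_val, ← Units.val_mul]
      congr 1
      rw [← zpow_natCast, ← zpow_natCast, ← zpow_add, Int.toNat_of_nonneg h1, add_comm]
    simp only [this]
    rw [← Finset.mul_sum, Finset.sum_coe_sort s (fun j => g j • ((w ^ j : Eˣ) : E)), hg, mul_zero]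
  intro i hi
  exact Fintype.linearIndependent_iff.1 hs (fun j => g j) h0 ⟨i, hi⟩

theorem IsMonomialOver.isMonomialBase {F : Type*} [CommRing F] [Algebra F E] {τ : RingAut E}
    {A : Subalgebra F E} (h : IsMonomialOver τ A x k) : IsMonomialBase x k := by
  cases k with
  | root l => exact ⟨h.1, h.2.1⟩
  | pi => exact h.1
  | sigma => trivial

/-- This puts the three kinds of monomials on the same footing: over the ring below, the powers with
reduced exponents are independent. -/
theorem IsMonomialOver.linearIndependent {F : Type*} [CommRing F] [Algebra F E] {τ : RingAut E}
    {A : Subalgebra F E} (h : IsMonomialOver τ A x k) :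
    LinearIndependent A fun j : {j : ℤ // IsNormalExp k j} => genPow x j k := by
  cases k with
  | root l =>
    have := h.2.2.1.comp (fun j : {j : ℤ // IsNormalExp (MonomialKind.root l) j} =>
      (⟨(j : ℤ).toNat, by obtain ⟨j, h1, h2⟩ := j; simp only; omega⟩ : Fin l)) (by
        rintro ⟨i, h1, h2⟩ ⟨j, h3, h4⟩ hij
        simp only [Fin.mk.injEq] at hij
        apply Subtype.ext
        simp only
        omega)
    have hfun : (fun j : {j : ℤ // IsNormalExp (MonomialKind.root l) j} =>
        genPow x j (MonomialKind.root l)) = fun j : {j : ℤ // IsNormalExp (MonomialKind.root l) j} => x ^ (j : ℤ).toNat := by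
      funext ⟨j, h1, h2⟩
      obtain ⟨n, rfl⟩ := Int.eq_ofNat_of_zero_le h1
      simp [genPow_natCast]
    rw [hfun]
    exact this
  | pi =>
    obtain ⟨⟨w, rfl⟩, ht, -⟩ := h
    have := ht.linearIndependent_zpow.comp
      (fun j : {j : ℤ // IsNormalExp MonomialKind.pi j} => (j : ℤ)) Subtype.val_injective
    have hfun : (fun j : {j : ℤ // IsNormalExp MonomialKind.pi j} =>
        genPow (w : E) j MonomialKind.pi) = fun j : {j : ℤ // IsNormalExp MonomialKind.pi j} => ((w ^ (j : ℤ) : Eˣ) : E) := by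
      funext j
      exact genPow_unit w _ (by simp)
    rw [hfun]
    exact this
  | sigma =>
    exact h.1.linearIndependent_pow.comp
      (fun j : {j : ℤ // IsNormalExp MonomialKind.sigma j} => (j : ℤ).toNat) (by
        rintro ⟨i, h1⟩ ⟨j, h2⟩ hij
        simp only [IsNormalExp] at h1 h2 hij
        apply Subtype.ext
        simp only
        omega)

end MonomialPowers

/-! ### Monomials and the subalgebras spanned by them -/

section Monomials

variable {F E : Type*} [Field F] [CommRing E] [Algebra F E] {e : ℕ}
variable (kind : Fin e → MonomialKind) (t : Fin e → E)

/-- The monomial with exponents `m`. -/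
noncomputable def mon (m : Fin e → ℤ) : E := ∏ i, genPow (t i) (m i) (kind i)

/-- The exponents in normal form, with support in `S`. -/
def normalExps (S : Set (Fin e)) : Set (Fin e → ℤ) :=
  {m | (∀ i, IsNormalExp (kind i) (m i)) ∧ ∀ i ∉ S, m i = 0}

/-- The normal form of exponents. -/
def normalizeExp (m : Fin e → ℤ) : Fin e → ℤ := fun i => normalExp (kind i) (m i)

/-- The subalgebra generated by the monomials in `S`. -/
noncomputable def monAlg (F : Type*) {E : Type*} [Field F] [CommRing E] [Algebra F E] {e : ℕ}
    (kind : Fin e → MonomialKind) (t : Fin e → E) (S : Set (Fin e)) : Subalgebra F E :=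
  Algebra.adjoin F {x | ∃ j ∈ S, x = t j ∨ (kind j = MonomialKind.pi ∧ x = Ring.inverse (t j))}

theorem stage_eq_monAlg (k : ℕ) : stage F kind t k = monAlg F kind t {j | (j : ℕ) < k} := rfl

variable {kind t}

@[simp] theorem mon_zero : mon kind t 0 = 1 := by simp [mon]

theorem mon_single (i : Fin e) (j : ℤ) : mon kind t (Pi.single i j) = genPow (t i) j (kind i) := by
  rw [mon, Finset.prod_eq_single i]
  · simp
  · intro b _ hb; simp [Pi.single_eq_of_ne hb]
  · simp

variable (hb : ∀ i, IsMonomialBase (t i) (kind i))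
include hb

theorem mon_add {m m' : Fin e → ℤ} (hm : ∀ i, kind i = MonomialKind.sigma → 0 ≤ m i)
    (hm' : ∀ i, kind i = MonomialKind.sigma → 0 ≤ m' i) :
    mon kind t (m + m') = mon kind t m * mon kind t m' := by
  rw [mon, mon, mon, ← Finset.prod_mul_distrib]
  exact Finset.prod_congr rfl fun i _ => (hb i).genPow_add (hm i) (hm' i)

theorem mon_normalizeExp (m : Fin e → ℤ) : mon kind t (normalizeExp kind m) = mon kind t m :=
  Finset.prod_congr rfl fun i _ => (hb i).genPow_normalExp (m i)

theorem normalizeExp_mem {S : Set (Fin e)} {m : Fin e → ℤ} (hm : ∀ i ∉ S, m i = 0) :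
    normalizeExp kind m ∈ normalExps kind S :=
  ⟨fun i => (hb i).isNormalExp _, fun i hi => by simp [normalizeExp, hm i hi, normalExp_zero]⟩

theorem mon_mul_normal {m m' : Fin e → ℤ} (hm : ∀ i, IsNormalExp (kind i) (m i))
    (hm' : ∀ i, IsNormalExp (kind i) (m' i)) :
    mon kind t m * mon kind t m' = mon kind t (normalizeExp kind (m + m')) := by
  rw [mon_normalizeExp hb, mon_add hb (fun i => (hm i).nonneg) (fun i => (hm' i).nonneg)]

theorem single_mem_normalExps {S : Set (Fin e)} {i : Fin e} (hi : i ∈ S) (j : ℤ) :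
    normalizeExp kind (Pi.single i j) ∈ normalExps kind S :=
  normalizeExp_mem hb fun k hk => by
    rw [Pi.single_eq_of_ne]
    rintro rfl
    exact hk hi

/-- After reduction of the exponents, a product of two reduced monomials is again a reduced
monomial, so their span is closed under multiplication. -/
theorem monAlg_toSubmodule (S : Set (Fin e)) :
    Subalgebra.toSubmodule (monAlg F kind t S) =
      Submodule.span F (mon kind t '' normalExps kind S) := by
  apply le_antisymm
  · intro x hx
    have h1 : (1 : E) ∈ Submodule.span F (mon kind t '' normalExps kind S) :=
      Submodule.subset_span ⟨0, ⟨fun i => isNormalExp_zero (hb i), fun _ _ => rfl⟩, mon_zero⟩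
    refine Algebra.adjoin_induction (p := fun x _ => x ∈ Submodule.span F
      (mon kind t '' normalExps kind S)) ?_ ?_ ?_ ?_ hx
    · rintro x ⟨j, hj, rfl | ⟨hk, rfl⟩⟩
      · refine Submodule.subset_span ⟨_, single_mem_normalExps hb hj 1, ?_⟩
        rw [mon_normalizeExp hb, mon_single, genPow_one]
      · refine Submodule.subset_span ⟨_, single_mem_normalExps hb hj (-1), ?_⟩
        rw [mon_normalizeExp hb, mon_single, hk]
        exact pow_one _
    · intro r
      rw [Algebra.algebraMap_eq_smul_one]
      exact Submodule.smul_mem _ _ h1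
    · intro x y _ _ hx hy
      exact Submodule.add_mem _ hx hy
    · intro x y _ _ hx hy
      refine Submodule.span_induction (p := fun x _ => x * y ∈ Submodule.span F
        (mon kind t '' normalExps kind S)) ?_ ?_ ?_ ?_ hx
      · rintro _ ⟨m, hm, rfl⟩
        refine Submodule.span_induction (p := fun y _ => mon kind t m * y ∈ Submodule.span F
          (mon kind t '' normalExps kind S)) ?_ ?_ ?_ ?_ hy
        · rintro _ ⟨m', hm', rfl⟩
          rw [mon_mul_normal hb hm.1 hm'.1]
          refine Submodule.subset_span ⟨_, normalizeExp_mem hb fun i hi => ?_, rfl⟩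
          simp [hm.2 i hi, hm'.2 i hi]
        · simp
        · intro x y _ _ hx hy; rw [mul_add]; exact Submodule.add_mem _ hx hy
        · intro a x _ hx; rw [mul_smul_comm]; exact Submodule.smul_mem _ _ hx
      · simp
      · intro x y _ _ hx hy; rw [add_mul]; exact Submodule.add_mem _ hx hy
      · intro a x _ hx; rw [smul_mul_assoc]; exact Submodule.smul_mem _ _ hx
  · rw [Submodule.span_le]
    rintro _ ⟨m, hm, rfl⟩
    refine Subalgebra.prod_mem _ fun i _ => ?_
    by_cases hi : i ∈ S
    · have ht : t i ∈ monAlg F kind t S := Algebra.subset_adjoin ⟨i, hi, Or.inl rfl⟩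
      have hn := hm.1 i
      rcases hk : kind i with l | _ | _
      · rw [hk] at hn
        obtain ⟨n, hn'⟩ := Int.eq_ofNat_of_zero_le hn.1
        rw [hn', genPow_natCast]
        exact pow_mem ht n
      · rcases hmi : m i with n | n
        · rw [Int.ofNat_eq_natCast, genPow_natCast]
          exact pow_mem ht n
        · have hinv : Ring.inverse (t i) ∈ monAlg F kind t S :=
            Algebra.subset_adjoin ⟨i, hi, Or.inr ⟨hk, rfl⟩⟩
          exact pow_mem hinv (n + 1)
      · exact pow_mem ht _
    · rw [hm.2 i hi, genPow_zero]
      exact one_mem _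

theorem mon_mem_monAlg {S : Set (Fin e)} {m : Fin e → ℤ} (hm : ∀ i ∉ S, m i = 0) :
    mon kind t m ∈ monAlg F kind t S := by
  rw [← mon_normalizeExp hb, ← Subalgebra.mem_toSubmodule, monAlg_toSubmodule hb]
  exact Submodule.subset_span (Set.mem_image_of_mem _ (normalizeExp_mem hb hm))

end Monomials

/-! ### Linear independence of the monomials over the ground field -/

section MonomialBasis

variable {F E : Type*} [Field F] [CommRing E] [Algebra F E] {σ : RingAut F} {τ : RingAut E} {e : ℕ}
variable {kind : Fin e → MonomialKind} {t : Fin e → E} (hE : IsRPSExtension σ τ kind t)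
include hE

theorem IsRPSExtension.isMonomialBase (i : Fin e) : IsMonomialBase (t i) (kind i) :=
  (hE.monomial i).isMonomialBase

/-- The tower law for bases: the monomials below are independent over `F`, the reduced powers of the
next monomial are independent over the ring below, and the products of the two families are
independent over `F`. -/
theorem IsRPSExtension.linearIndependent_below (k : ℕ) (hk : k ≤ e) :
    LinearIndependent F fun m : normalExps kind {j : Fin e | (j : ℕ) < k} => mon kind t m := by
  induction k with
  | zero =>
    have h0 : ∀ m : normalExps kind {j : Fin e | (j : ℕ) < 0}, (m : Fin e → ℤ) = 0 := fun m =>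
      funext fun i => m.2.2 i (by simp)
    have : Subsingleton (normalExps kind {j : Fin e | (j : ℕ) < 0}) :=
      ⟨fun a b => Subtype.ext ((h0 a).trans (h0 b).symm)⟩
    have : Nontrivial E := hE.injective.nontrivial
    refine .of_subsingleton ⟨0, fun i => isNormalExp_zero (hE.isMonomialBase i), fun _ _ => rfl⟩ ?_
    simp
  | succ k ih =>
    have hk' : k < e := hk
    let i : Fin e := ⟨k, hk'⟩
    have hb := hE.isMonomialBase
    have h1 := ih hk'.le
    have h2 := (hE.monomial i).linearIndependent
    have h3 : LinearIndependent F fun m : normalExps kind {j : Fin e | (j : ℕ) < k} =>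
        (⟨mon kind t m, mon_mem_monAlg hb m.2.2⟩ : stage F kind t i) := by
      refine LinearIndependent.of_comp (stage F kind t i).val.toLinearMap ?_
      exact h1
    have h4 := linearIndependent_smul h3 h2
    -- An exponent vector is split into the exponents below `i` and the exponent at `i`.
    let f : normalExps kind {j : Fin e | (j : ℕ) < k + 1} →
        normalExps kind {j : Fin e | (j : ℕ) < k} × {j : ℤ // IsNormalExp (kind i) j} := fun m =>
      (⟨Function.update m i 0, fun j => by
          rcases eq_or_ne j i with rfl | hj
          · simpa using isNormalExp_zero (hb i)
          · simpa [hj] using m.2.1 j, fun j hj => by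
          rcases eq_or_ne j i with rfl | hj'
          · simp
          · rw [Function.update_of_ne hj']
            refine m.2.2 j fun h => hj ?_
            have : (j : ℕ) ≠ k := fun h => hj' (Fin.ext h)
            simp only [Set.mem_ofPred_eq] at h ⊢
            omega⟩, ⟨m.1 i, m.2.1 i⟩)
    have hf : Function.Injective f := by
      intro m m' h
      simp only [f, Prod.mk.injEq, Subtype.mk.injEq] at h
      apply Subtype.ext
      funext j
      rcases eq_or_ne j i with rfl | hj
      · exact h.2
      · simpa [hj] using congrFun (congrArg Subtype.val h.1) j
    have hfun : (fun m : normalExps kind {j : Fin e | (j : ℕ) < k + 1} => mon kind t m) =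
        (fun p : normalExps kind {j : Fin e | (j : ℕ) < k} × {j : ℤ // IsNormalExp (kind i) j} =>
          (⟨mon kind t p.1, mon_mem_monAlg hb p.1.2.2⟩ : stage F kind t i) •
            genPow (t i) p.2 (kind i)) ∘ f := by
      funext m
      change _ = mon kind t (Function.update m i 0) * genPow (t i) (m.1 i) (kind i)
      rw [← mon_single, ← mon_add hb]
      · congr 1
        funext j
        rcases eq_or_ne j i with rfl | hj
        · simp
        · simp [hj]
      · intro j hj
        by_cases hj' : j = i
        · simp [hj']
        · simpa [hj'] using (m.2.1 j).nonneg hj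
      · intro j hj
        by_cases hj' : j = i
        · rw [hj'] at hj ⊢
          simpa using (m.2.1 i).nonneg hj
        · simp [hj']
    rw [hfun]
    exact h4.comp f hf

end MonomialBasis

/-! ### The monomial basis and coefficients with respect to it -/

section MonomialBasis

variable {F E : Type*} [Field F] [CommRing E] [Algebra F E] {σ : RingAut F} {τ : RingAut E} {e : ℕ}
variable {kind : Fin e → MonomialKind} {t : Fin e → E} (hE : IsRPSExtension σ τ kind t)

/-- The basis of the monomials with exponents in normal form. -/
noncomputable def IsRPSExtension.basis :
    Module.Basis (normalExps kind (Set.univ : Set (Fin e))) F E :=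
  Module.Basis.mk (v := fun m : normalExps kind (Set.univ : Set (Fin e)) => mon kind t m)
    (by
      have h := hE.linearIndependent_below e le_rfl
      have hu : {j : Fin e | (j : ℕ) < e} = Set.univ := by ext j; simp
      rwa [hu] at h)
    (by
      have h := hE.generates
      have hu : {j : Fin e | (j : ℕ) < e} = Set.univ := by ext j; simp
      rw [stage_eq_monAlg, hu] at h
      have h2 := monAlg_toSubmodule (F := F) hE.isMonomialBase Set.univ
      rw [h, Set.image_eq_range] at h2
      rw [← h2, Algebra.top_toSubmodule])

@[simp] theorem IsRPSExtension.basis_apply (m : normalExps kind (Set.univ : Set (Fin e))) :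
    hE.basis m = mon kind t m := by
  simp [IsRPSExtension.basis]

open Classical in
/-- The coefficient of a monomial with exponents in normal form. -/
noncomputable def IsRPSExtension.coeff (m : Fin e → ℤ) : E →ₗ[F] F :=
  if h : m ∈ normalExps kind (Set.univ : Set (Fin e)) then hE.basis.coord ⟨m, h⟩ else 0

theorem normalExps_mono {S S' : Set (Fin e)} (h : S ⊆ S') :
    normalExps kind S ⊆ normalExps kind S' :=
  fun _ hm => ⟨hm.1, fun i hi => hm.2 i fun h' => hi (h h')⟩

theorem IsRPSExtension.coeff_mon [DecidableEq (Fin e → ℤ)] {m m' : Fin e → ℤ}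
    (hm' : m' ∈ normalExps kind (Set.univ : Set (Fin e))) :
    hE.coeff m (mon kind t m') = if m = m' then 1 else 0 := by
  rw [← hE.basis_apply ⟨m', hm'⟩]
  by_cases hm : m ∈ normalExps kind (Set.univ : Set (Fin e))
  · rw [coeff, dif_pos hm, Module.Basis.coord_apply, Module.Basis.repr_self, Finsupp.single_apply]
    simp only [Subtype.mk.injEq, eq_comm]
  · rw [coeff, dif_neg hm, if_neg]
    · rfl
    · rintro rfl
      exact hm hm'

theorem IsRPSExtension.ext {x y : E}
    (h : ∀ m ∈ normalExps kind (Set.univ : Set (Fin e)), hE.coeff m x = hE.coeff m y) : x = y := by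
  apply hE.basis.repr.injective
  ext m
  have := h m m.2
  simpa [coeff, m.2] using this

theorem IsRPSExtension.coeff_of_not_mem {m : Fin e → ℤ}
    (hm : m ∉ normalExps kind (Set.univ : Set (Fin e))) (x : E) : hE.coeff m x = 0 := by
  rw [coeff, dif_neg hm]; rfl

include hE in
/-- Induction on elements of the subalgebra generated by some of the monomials. -/
theorem IsRPSExtension.monAlg_induction {S : Set (Fin e)} {p : E → Prop}
    (hmon : ∀ m ∈ normalExps kind S, p (mon kind t m)) (h0 : p 0)
    (hadd : ∀ x y, p x → p y → p (x + y)) (hsmul : ∀ (a : F) x, p x → p (a • x)) {x : E}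
    (hx : x ∈ monAlg F kind t S) : p x := by
  rw [← Subalgebra.mem_toSubmodule, monAlg_toSubmodule hE.isMonomialBase] at hx
  refine Submodule.span_induction (p := fun x _ => p x) ?_ h0 (fun x y _ _ => hadd x y)
    (fun a x _ => hsmul a x) hx
  rintro _ ⟨m, hm, rfl⟩
  exact hmon m hm

include hE in
theorem IsRPSExtension.monAlg_univ : monAlg F kind t Set.univ = ⊤ := by
  have h := hE.generates
  have hu : {j : Fin e | (j : ℕ) < e} = Set.univ := by ext j; simp
  rwa [stage_eq_monAlg, hu] at h

include hE in
theorem IsRPSExtension.induction {p : E → Prop}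
    (hmon : ∀ m ∈ normalExps kind (Set.univ : Set (Fin e)), p (mon kind t m)) (h0 : p 0)
    (hadd : ∀ x y, p x → p y → p (x + y)) (hsmul : ∀ (a : F) x, p x → p (a • x)) (x : E) : p x :=
  hE.monAlg_induction hmon h0 hadd hsmul (hE.monAlg_univ ▸ Algebra.mem_top)

theorem IsRPSExtension.coeff_eq_zero_of_mem {S : Set (Fin e)} {x : E}
    (hx : x ∈ monAlg F kind t S) {m : Fin e → ℤ} (hm : m ∉ normalExps kind S) :
    hE.coeff m x = 0 := by
  classical
  refine hE.monAlg_induction (p := fun x => hE.coeff m x = 0) ?_ ?_ ?_ ?_ hx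
  · intro m' hm'
    rw [hE.coeff_mon (normalExps_mono (Set.subset_univ _) hm'), if_neg]
    rintro rfl
    exact hm hm'
  · simp
  · intro x y hx hy; simp [hx, hy]
  · intro a x hx; simp [hx]

theorem IsRPSExtension.sum_coeff (x : E) :
    ∃ s : Finset (Fin e → ℤ), (∀ m ∈ s, m ∈ normalExps kind (Set.univ : Set (Fin e)) ∧
      hE.coeff m x ≠ 0) ∧ x = ∑ m ∈ s, hE.coeff m x • mon kind t m := by
  classical
  refine ⟨(hE.basis.repr x).support.image Subtype.val, ?_, ?_⟩
  · intro m hm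
    obtain ⟨m, hm, rfl⟩ := Finset.mem_image.1 hm
    refine ⟨m.2, ?_⟩
    simpa [coeff, m.2] using hm
  · rw [Finset.sum_image fun _ _ _ _ h => Subtype.ext h]
    conv_lhs => rw [← hE.basis.linearCombination_repr x]
    rw [Finsupp.linearCombination_apply, Finsupp.sum]
    refine Finset.sum_congr rfl fun m _ => ?_
    simp [coeff, m.2]

theorem IsRPSExtension.mem_monAlg_iff {S : Set (Fin e)} {x : E} :
    x ∈ monAlg F kind t S ↔ ∀ m ∉ normalExps kind S, hE.coeff m x = 0 := by
  refine ⟨fun hx m hm => hE.coeff_eq_zero_of_mem hx hm, fun h => ?_⟩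
  obtain ⟨s, hs, hx⟩ := hE.sum_coeff x
  rw [hx]
  refine Subalgebra.sum_mem _ fun m hm => Subalgebra.smul_mem _ ?_ _
  have : m ∈ normalExps kind S := by
    by_contra h'
    exact (hs m hm).2 (h m h')
  exact mon_mem_monAlg hE.isMonomialBase this.2

include hE in
/-- Distinct monomials with exponents in normal form are not proportional. -/
theorem IsRPSExtension.smul_mon_inj {m m' : Fin e → ℤ}
    (hm : m ∈ normalExps kind (Set.univ : Set (Fin e)))
    (hm' : m' ∈ normalExps kind (Set.univ : Set (Fin e))) {a a' : F} (ha : a ≠ 0)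
    (h : a • mon kind t m = a' • mon kind t m') : m = m' ∧ a = a' := by
  classical
  have h1 := congrArg (hE.coeff m) h
  rw [map_smul, map_smul, hE.coeff_mon hm, hE.coeff_mon hm', if_pos rfl] at h1
  by_cases hmm : m = m'
  · exact ⟨hmm, by simpa [hmm] using h1⟩
  · simp [hmm, ha] at h1

/-! ### Coefficients with respect to one of the monomials -/

/-- The coefficient of the `j`-th power of the monomial `t i`. -/
noncomputable def IsRPSExtension.coeffAt (i : Fin e) (j : ℤ) : E →ₗ[F] E :=
  hE.basis.constr F fun m => if m.1 i = j then mon kind t (Function.update m.1 i 0) else 0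

theorem IsRPSExtension.coeffAt_mon (i : Fin e) (j : ℤ) {m : Fin e → ℤ}
    (hm : m ∈ normalExps kind (Set.univ : Set (Fin e))) :
    hE.coeffAt i j (mon kind t m) =
      if m i = j then mon kind t (Function.update m i 0) else 0 := by
  rw [← hE.basis_apply ⟨m, hm⟩, coeffAt, Module.Basis.constr_basis]

include hE in
theorem IsRPSExtension.mon_update_mul {m : Fin e → ℤ} (i : Fin e)
    (hm : ∀ k, kind k = MonomialKind.sigma → 0 ≤ m k) (hmi : m i = 0) {j : ℤ}
    (hj : IsNormalExp (kind i) j) :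
    mon kind t m * genPow (t i) j (kind i) = mon kind t (Function.update m i j) := by
  rw [← mon_single, ← mon_add hE.isMonomialBase hm]
  · congr 1
    funext k
    by_cases hk : k = i
    · subst hk; simp [hmi]
    · simp [hk]
  · intro k hk
    by_cases hk' : k = i
    · subst hk'; simpa using hj.nonneg hk
    · simp [hk']

theorem IsRPSExtension.update_mem_normalExps {S : Set (Fin e)} {m : Fin e → ℤ} {i : Fin e}
    (hm : m ∈ normalExps kind S) {j : ℤ} (hj : IsNormalExp (kind i) j) :
    Function.update m i j ∈ normalExps kind (insert i S) := by
  refine ⟨fun k => ?_, fun k hk => ?_⟩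
  · by_cases hk : k = i
    · subst hk; simpa using hj
    · simpa [hk] using hm.1 k
  · rw [Set.mem_insert_iff, not_or] at hk
    simpa [hk.1] using hm.2 k hk.2

theorem IsRPSExtension.coeffAt_mem {S : Set (Fin e)} {i : Fin e} {x : E}
    (hx : x ∈ monAlg F kind t (insert i S)) (j : ℤ) :
    hE.coeffAt i j x ∈ monAlg F kind t S := by
  refine hE.monAlg_induction (p := fun x => hE.coeffAt i j x ∈ monAlg F kind t S) ?_ ?_ ?_ ?_ hx
  · intro m hm
    rw [hE.coeffAt_mon i j (normalExps_mono (Set.subset_univ _) hm)]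
    split_ifs
    · refine mon_mem_monAlg hE.isMonomialBase fun k hk => ?_
      by_cases hk' : k = i
      · subst hk'; simp
      · rw [Function.update_of_ne hk']
        exact hm.2 k (by simp [hk', hk])
    · exact zero_mem _
  · simp
  · intro x y hx hy; rw [map_add]; exact add_mem hx hy
  · intro a x hx; rw [map_smul]; exact Subalgebra.smul_mem _ hx _

theorem IsRPSExtension.coeffAt_mul_genPow {S : Set (Fin e)} {i : Fin e} (hi : i ∉ S) {x : E}
    (hx : x ∈ monAlg F kind t S) (j : ℤ) {j' : ℤ} (hj' : IsNormalExp (kind i) j') :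
    hE.coeffAt i j (x * genPow (t i) j' (kind i)) = if j' = j then x else 0 := by
  refine hE.monAlg_induction (p := fun x => hE.coeffAt i j (x * genPow (t i) j' (kind i)) =
    if j' = j then x else 0) ?_ ?_ ?_ ?_ hx
  · intro m hm
    rw [hE.mon_update_mul i (fun k => (hm.1 k).nonneg) (hm.2 i hi) hj', hE.coeffAt_mon i j
      (normalExps_mono (Set.subset_univ _) (update_mem_normalExps hm hj'))]
    have : Function.update m i 0 = m := by
      rw [← hm.2 i hi, Function.update_eq_self]
    simp [this]
  · simp
  · intro x y hx hy; rw [add_mul, map_add, hx, hy]; split_ifs <;> simp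
  · intro a x hx; rw [smul_mul_assoc, map_smul, hx]; split_ifs <;> simp

theorem IsRPSExtension.coeffAt_of_mem {S : Set (Fin e)} {i : Fin e} (hi : i ∉ S) {x : E}
    (hx : x ∈ monAlg F kind t S) (j : ℤ) : hE.coeffAt i j x = if 0 = j then x else 0 := by
  have := hE.coeffAt_mul_genPow hi hx j (isNormalExp_zero (hE.isMonomialBase i))
  rwa [genPow_zero, mul_one] at this

/-- The coefficients vanish for exponents of absolute value greater than `D`. -/
def IsRPSExtension.DegLE (i : Fin e) (D : ℕ) (x : E) : Prop :=
  ∀ j : ℤ, D < j.natAbs → hE.coeffAt i j x = 0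

theorem IsRPSExtension.DegLE.mono {i : Fin e} {D D' : ℕ} {x : E} (h : hE.DegLE i D x)
    (hD : D ≤ D') : hE.DegLE i D' x := fun j hj => h j (lt_of_le_of_lt hD hj)

/-- All `D ≥ D₀` are admitted so that the bounds for two summands can be merged. -/
theorem IsRPSExtension.exists_degLE (i : Fin e) (x : E) :
    ∃ D₀, ∀ D ≥ D₀, hE.DegLE i D x ∧
      x = ∑ j ∈ Finset.Icc (-D : ℤ) D, hE.coeffAt i j x * genPow (t i) j (kind i) := by
  refine hE.induction (p := fun x => ∃ D₀, ∀ D ≥ D₀, hE.DegLE i D x ∧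
      x = ∑ j ∈ Finset.Icc (-D : ℤ) D, hE.coeffAt i j x * genPow (t i) j (kind i)) ?_ ?_ ?_ ?_ x
  · intro m hm
    refine ⟨(m i).natAbs, fun D hD => ⟨fun j hj => ?_, ?_⟩⟩
    · rw [hE.coeffAt_mon i j hm, if_neg]
      rintro rfl
      omega
    · rw [Finset.sum_eq_single (m i)]
      · rw [hE.coeffAt_mon i _ hm, if_pos rfl, hE.mon_update_mul i _ (by simp) (hm.1 i)]
        · simp
        · intro k hk
          by_cases hk' : k = i
          · subst hk'; simp
          · simpa [hk'] using (hm.1 k).nonneg hk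
      · intro j _ hj
        rw [hE.coeffAt_mon i _ hm, if_neg hj.symm, zero_mul]
      · intro h
        exact absurd (Finset.mem_Icc.2 (by omega)) h
  · exact ⟨0, fun D _ => ⟨fun j _ => by simp, by simp⟩⟩
  · rintro x y ⟨D₁, h₁⟩ ⟨D₂, h₂⟩
    refine ⟨max D₁ D₂, fun D hD => ?_⟩
    obtain ⟨h3, h4⟩ := h₁ D (le_trans (le_max_left _ _) hD)
    obtain ⟨h5, h6⟩ := h₂ D (le_trans (le_max_right _ _) hD)
    refine ⟨fun j hj => by rw [map_add, h3 j hj, h5 j hj, add_zero], ?_⟩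
    simp only [map_add, add_mul, Finset.sum_add_distrib]
    rw [← h4, ← h6]
  · rintro a x ⟨D₁, h₁⟩
    refine ⟨D₁, fun D hD => ?_⟩
    obtain ⟨h3, h4⟩ := h₁ D hD
    refine ⟨fun j hj => by rw [map_smul, h3 j hj, smul_zero], ?_⟩
    simp only [map_smul, smul_mul_assoc, ← Finset.smul_sum]
    rw [← h4]

theorem IsRPSExtension.ext_coeffAt (i : Fin e) {x y : E}
    (h : ∀ j, hE.coeffAt i j x = hE.coeffAt i j y) : x = y := by
  obtain ⟨D₁, h₁⟩ := hE.exists_degLE i x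
  obtain ⟨D₂, h₂⟩ := hE.exists_degLE i y
  rw [(h₁ (max D₁ D₂) (le_max_left _ _)).2, (h₂ (max D₁ D₂) (le_max_right _ _)).2]
  exact Finset.sum_congr rfl fun j _ => by rw [h]

theorem IsRPSExtension.coeffAt_of_not_normal (i : Fin e) {j : ℤ} (hj : ¬ IsNormalExp (kind i) j)
    (x : E) : hE.coeffAt i j x = 0 := by
  refine hE.induction (p := fun x => hE.coeffAt i j x = 0) ?_ ?_ ?_ ?_ x
  · intro m hm
    rw [hE.coeffAt_mon i j hm, if_neg]
    rintro rfl
    exact hj (hm.1 i)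
  · simp
  · intro x y hx hy; simp [hx, hy]
  · intro a x hx; simp [hx]

end MonomialBasis

/-! ### The product group and the action of the automorphism -/

section ProductGroup

variable {F E : Type*} [Field F] [CommRing E] [Algebra F E] {σ : RingAut F} {τ : RingAut E} {e : ℕ}
variable {kind : Fin e → MonomialKind} {t : Fin e → E}

/-- The exponents of a member of the product group with support in `S`. -/
def groupExps (kind : Fin e → MonomialKind) (S : Set (Fin e)) : AddSubgroup (Fin e → ℤ) where
  carrier := {m | (∀ i, kind i = MonomialKind.sigma → m i = 0) ∧ ∀ i ∉ S, m i = 0}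
  zero_mem' := ⟨fun _ _ => rfl, fun _ _ => rfl⟩
  add_mem' := fun h h' => ⟨fun i hi => by simp [h.1 i hi, h'.1 i hi],
    fun i hi => by simp [h.2 i hi, h'.2 i hi]⟩
  neg_mem' := fun h => ⟨fun i hi => by simp [h.1 i hi], fun i hi => by simp [h.2 i hi]⟩

theorem mon_add_group (hb : ∀ i, IsMonomialBase (t i) (kind i)) {S : Set (Fin e)}
    {m m' : Fin e → ℤ} (hm : m ∈ groupExps kind S) (hm' : m' ∈ groupExps kind S) :
    mon kind t (m + m') = mon kind t m * mon kind t m' :=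
  mon_add hb (fun i hi => (hm.1 i hi).ge) (fun i hi => (hm'.1 i hi).ge)

theorem mon_mul_neg (hb : ∀ i, IsMonomialBase (t i) (kind i)) {S : Set (Fin e)}
    {m : Fin e → ℤ} (hm : m ∈ groupExps kind S) : mon kind t m * mon kind t (-m) = 1 := by
  rw [← mon_add_group hb hm (neg_mem hm), add_neg_cancel, mon_zero]

theorem groupExps_mono {S S' : Set (Fin e)} (h : S ⊆ S') :
    groupExps kind S ≤ groupExps kind S' :=
  fun _ hm => ⟨hm.1, fun i hi => hm.2 i fun h' => hi (h h')⟩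

/-- The subgroup of the product group of the elements that involve only the monomials in `S`. -/
def prodGroup (F : Type*) [Field F] [Algebra F E]
    (hb : ∀ i, IsMonomialBase (t i) (kind i)) (S : Set (Fin e)) : Subgroup Eˣ where
  carrier := {u | ∃ a : F, a ≠ 0 ∧ ∃ m ∈ groupExps kind S, (u : E) = a • mon kind t m}
  one_mem' := ⟨1, one_ne_zero, 0, zero_mem _, by simp⟩
  mul_mem' := by
    rintro u v ⟨a, ha, m, hm, hu⟩ ⟨b, hb', m', hm', hv⟩
    refine ⟨a * b, mul_ne_zero ha hb', m + m', add_mem hm hm', ?_⟩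
    rw [Units.val_mul, hu, hv, mon_add_group hb hm hm', smul_mul_smul_comm]
  inv_mem' := by
    rintro u ⟨a, ha, m, hm, hu⟩
    refine ⟨a⁻¹, inv_ne_zero ha, -m, neg_mem hm, ?_⟩
    rw [Units.inv_eq_of_mul_eq_one_right]
    rw [hu, smul_mul_smul_comm, mul_inv_cancel₀ ha, mon_mul_neg hb hm, one_smul]

variable (hb : ∀ i, IsMonomialBase (t i) (kind i))

theorem prodGroup_mono {S S' : Set (Fin e)} (h : S ⊆ S') :
    prodGroup F hb S ≤ prodGroup F hb S' :=
  fun _ ⟨a, ha, m, hm, hu⟩ => ⟨a, ha, m, groupExps_mono h hm, hu⟩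

include hb in
theorem isUnit_smul_mon {S : Set (Fin e)} {a : F} (ha : a ≠ 0) {m : Fin e → ℤ}
    (hm : m ∈ groupExps kind S) : IsUnit (a • mon kind t m) :=
  IsUnit.of_mul_eq_one (a⁻¹ • mon kind t (-m)) (by
    rw [smul_mul_smul_comm, mul_inv_cancel₀ ha, mon_mul_neg hb hm, one_smul])

theorem exists_prodGroup {S : Set (Fin e)} {a : F} (ha : a ≠ 0) {m : Fin e → ℤ}
    (hm : m ∈ groupExps kind S) : ∃ u ∈ prodGroup F hb S, (u : E) = a • mon kind t m :=
  ⟨(isUnit_smul_mon hb ha hm).unit, ⟨a, ha, m, hm, rfl⟩, rfl⟩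

theorem prodGroup_mem_monAlg {S : Set (Fin e)} {u : Eˣ} (hu : u ∈ prodGroup F hb S) :
    (u : E) ∈ monAlg F kind t S := by
  obtain ⟨a, -, m, hm, h⟩ := hu
  rw [h]
  exact Subalgebra.smul_mem _ (mon_mem_monAlg hb hm.2) _

theorem productGroup_eq :
    productGroup F kind t = Units.val '' (prodGroup F hb Set.univ : Set Eˣ) := by
  ext x
  constructor
  · rintro ⟨a, ha, m, hm, rfl⟩
    obtain ⟨u, hu, hx⟩ := exists_prodGroup hb (S := Set.univ)
      (IsUnit.ne_zero ha) (m := m) ⟨hm, by simp⟩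
    exact ⟨u, hu, by rw [hx, Algebra.smul_def]; rfl⟩
  · rintro ⟨u, ⟨a, ha, m, hm, hu⟩, rfl⟩
    exact ⟨a, ha.isUnit, m, hm.1, by rw [hu, Algebra.smul_def]; rfl⟩

theorem monAlg_mono {S S' : Set (Fin e)} (h : S ⊆ S') :
    monAlg F kind t S ≤ monAlg F kind t S' :=
  Algebra.adjoin_mono fun _ ⟨j, hj, hx⟩ => ⟨j, h hj, hx⟩

/-- The indices of the R-monomials. -/
def rootSet (kind : Fin e → MonomialKind) : Set (Fin e) := {i | ∃ l, kind i = MonomialKind.root l}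

/-- The indices of the R-monomials and of the first `k` monomials. -/
def level (kind : Fin e → MonomialKind) (k : ℕ) : Set (Fin e) := {i | i ∈ rootSet kind ∨ (i : ℕ) < k}

theorem level_zero : level kind 0 = rootSet kind := by ext i; simp [level]

theorem level_top : level kind e = Set.univ := by ext i; simp [level]

theorem level_succ (i : Fin e) : level kind (i + 1) = insert i (level kind i) := by
  ext j
  simp only [level, Set.mem_ofPred_eq, Set.mem_insert_iff, Fin.ext_iff, Nat.lt_succ_iff_lt_or_eq]
  tauto

theorem not_mem_level (i : Fin e) (hi : i ∉ rootSet kind) : i ∉ level kind i := by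
  simp [level, hi]

theorem rootSet_subset_level (k : ℕ) : rootSet kind ⊆ level kind k := fun _ h => Or.inl h

/-- The automorphism acts on the monomials in `S`. -/
structure IsClosedUnder (F : Type*) [Field F] [Algebra F E] (τ : RingAut E)
    (hb : ∀ i, IsMonomialBase (t i) (kind i)) (S : Set (Fin e)) : Prop where
  mul : ∀ i ∈ S, kind i ≠ MonomialKind.sigma → ∃ h ∈ prodGroup F hb S, τ (t i) = h * t i
  add : ∀ i ∈ S, kind i = MonomialKind.sigma → τ (t i) - t i ∈ monAlg F kind t S

variable {hb}

theorem map_genPow_of_unit {x : E} {k : MonomialKind} (hx : IsUnit x) (hk : k ≠ MonomialKind.sigma)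
    {h : Eˣ} (hτ : τ x = h * x) (j : ℤ) : τ (genPow x j k) = ((h ^ j : Eˣ) : E) * genPow x j k := by
  obtain ⟨w, rfl⟩ := hx
  have h1 : Units.map (τ : E →* E) w = h * w := Units.ext hτ
  have h2 : τ ((w ^ j : Eˣ) : E) = ((Units.map (τ : E →* E) w ^ j : Eˣ) : E) := by
    rw [← map_zpow]; rfl
  rw [genPow_unit w j hk, h2, h1, mul_zpow, Units.val_mul]

section
variable {S : Set (Fin e)} (hS : IsClosedUnder F τ hb S)
include hS

theorem IsClosedUnder.map_genPow {i : Fin e} (hi : i ∈ S) (hk : kind i ≠ MonomialKind.sigma)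
    (j : ℤ) : ∃ h ∈ prodGroup F hb S, τ (genPow (t i) j (kind i)) = h * genPow (t i) j (kind i) := by
  obtain ⟨h, hh, hτ⟩ := hS.mul i hi hk
  exact ⟨h ^ j, zpow_mem hh j, map_genPow_of_unit ((hb i).isUnit hk) hk hτ j⟩

theorem IsClosedUnder.map_mon {m : Fin e → ℤ} (hm : m ∈ groupExps kind S) :
    ∃ h ∈ prodGroup F hb S, τ (mon kind t m) = h * mon kind t m := by
  have : ∀ i, ∃ h ∈ prodGroup F hb S,
      τ (genPow (t i) (m i) (kind i)) = h * genPow (t i) (m i) (kind i) := by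
    intro i
    by_cases hi : m i = 0
    · exact ⟨1, one_mem _, by simp [hi]⟩
    · refine hS.map_genPow ?_ (fun h => hi (hm.1 i h)) _
      by_contra h
      exact hi (hm.2 i h)
  choose h hh hτ using this
  refine ⟨∏ i, h i, Subgroup.prod_mem _ fun i _ => hh i, ?_⟩
  rw [mon, map_prod, Finset.prod_congr rfl fun i _ => hτ i, Finset.prod_mul_distrib, Units.coe_prod]

theorem IsClosedUnder.map_monAlg (hext : ∀ a : F, τ (algebraMap F E a) = algebraMap F E (σ a))
    {x : E} (hx : x ∈ monAlg F kind t S) :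
    τ x ∈ monAlg F kind t S := by
  refine Algebra.adjoin_induction (p := fun x _ => τ x ∈ monAlg F kind t S) ?_ ?_ ?_ ?_ hx
  · rintro x ⟨j, hj, rfl | ⟨hk, rfl⟩⟩
    · by_cases hk : kind j = MonomialKind.sigma
      · rw [← sub_add_cancel (τ (t j)) (t j)]
        exact add_mem (hS.add j hj hk) (Algebra.subset_adjoin ⟨j, hj, Or.inl rfl⟩)
      · obtain ⟨h, hh, hτ⟩ := hS.mul j hj hk
        rw [hτ]
        exact mul_mem (prodGroup_mem_monAlg hb hh) (Algebra.subset_adjoin ⟨j, hj, Or.inl rfl⟩)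
    · obtain ⟨h, hh, hτ⟩ := hS.map_genPow hj (by rw [hk]; simp) (-1)
      have h1 : genPow (t j) (-1) (kind j) = Ring.inverse (t j) := by
        rw [hk]; exact pow_one _
      rw [h1] at hτ
      rw [hτ]
      exact mul_mem (prodGroup_mem_monAlg hb hh)
        (Algebra.subset_adjoin ⟨j, hj, Or.inr ⟨hk, rfl⟩⟩)
  · intro a
    rw [hext]
    exact Subalgebra.algebraMap_mem _ _
  · intro x y _ _ hx hy; rw [map_add]; exact add_mem hx hy
  · intro x y _ _ hx hy; rw [map_mul]; exact mul_mem hx hy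

theorem IsClosedUnder.map_prodGroup
    (hext : ∀ a : F, τ (algebraMap F E a) = algebraMap F E (σ a)) {u : Eˣ}
    (hu : u ∈ prodGroup F hb S) : Units.map (τ : E →* E) u ∈ prodGroup F hb S := by
  obtain ⟨a, ha, m, hm, hu⟩ := hu
  obtain ⟨h, hh, hτ⟩ := hS.map_mon hm
  obtain ⟨v, hv, hv'⟩ := exists_prodGroup hb (S := S) (a := σ a)
    (by simpa using ha) hm
  have : Units.map (τ : E →* E) u = h * v := by
    ext
    rw [Units.val_mul, hv', Units.coe_map]
    change τ (u : E) = _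
    rw [hu, Algebra.smul_def, map_mul, hext, hτ, Algebra.smul_def]
    ring
  rw [this]
  exact mul_mem hh hv

end

section
variable (hE : IsRPSExtension σ τ kind t) (hs : IsSimpleExtension F τ kind t)

include hE in
theorem IsRPSExtension.smul_mon_eq {m m' : Fin e → ℤ} {a a' : F} (ha : a ≠ 0)
    (h : a • mon kind t m = a' • mon kind t m') :
    normalizeExp kind m = normalizeExp kind m' ∧ a = a' := by
  rw [← mon_normalizeExp hE.isMonomialBase m, ← mon_normalizeExp hE.isMonomialBase m'] at h
  exact hE.smul_mon_inj (normalizeExp_mem hE.isMonomialBase (by simp))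
    (normalizeExp_mem hE.isMonomialBase (by simp)) ha h

include hE hs in
theorem IsSimpleExtension.exists_factor {i : Fin e} (hi : kind i ≠ MonomialKind.sigma) :
    ∃ h ∈ prodGroup F hE.isMonomialBase Set.univ, τ (t i) = h * t i := by
  obtain ⟨h, hh, hτ⟩ := hs i hi
  rw [productGroup_eq hE.isMonomialBase] at hh
  obtain ⟨u, hu, rfl⟩ := hh
  exact ⟨u, hu, hτ⟩

include hE hs in
-- Applying `τ` to `t i ^ l = 1` shows that the factor is an `l`-th root of unity. Its `l`-th power
-- has the exponents multiplied by `l`, and comparison with the monomial `1` forces the exponents of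
-- the Π-monomials to vanish.
theorem IsSimpleExtension.exists_factor_root {i : Fin e} (hi : i ∈ rootSet kind) :
    ∃ h ∈ prodGroup F hE.isMonomialBase (rootSet kind), τ (t i) = h * t i := by
  obtain ⟨l, hl⟩ := hi
  obtain ⟨h, ⟨a, ha, m, hm, hu⟩, hτ⟩ := hs.exists_factor hE (i := i) (by rw [hl]; simp)
  have hbi := hE.isMonomialBase i
  rw [hl] at hbi
  have hpow : ∀ n : ℕ, mon kind t m ^ n = mon kind t (n • m) := by
    intro n
    induction n with
    | zero => simp
    | succ n ih =>
      rw [pow_succ, ih, succ_nsmul, mon_add_group hE.isMonomialBase (nsmul_mem hm n) hm]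
  have h1 : (h : E) ^ l = 1 := by
    have h2 := congrArg (· ^ l) hτ
    rw [← map_pow, mul_pow, hbi.2, map_one, mul_one] at h2
    exact h2.symm
  rw [hu, smul_pow, hpow] at h1
  have h2 := hE.smul_mon_eq (m := l • m) (m' := 0) (a' := 1) (pow_ne_zero l ha) (by simpa using h1)
  refine ⟨h, ⟨a, ha, m, ⟨hm.1, fun j hj => ?_⟩, hu⟩, hτ⟩
  have h3 := congrFun h2.1 j
  rcases hk : kind j with l' | _ | _
  · exact absurd ⟨l', hk⟩ hj
  · simp only [normalizeExp, hk, normalExp, Pi.smul_apply, Pi.zero_apply, nsmul_eq_mul,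
      mul_eq_zero, Nat.cast_eq_zero] at h3
    have := hbi.1
    omega
  · exact hm.1 j hk

include hE hs in
-- Cancelling the unit `t i` identifies the factor from the product group with the one from the ring
-- below. The expansion of the latter contains only earlier monomials, so the reduced exponents of
-- the former vanish at all other indices.
theorem IsSimpleExtension.exists_factor_pi {i : Fin e} (hi : kind i = MonomialKind.pi) :
    ∃ h ∈ prodGroup F hE.isMonomialBase {j : Fin e | (j : ℕ) < i}, τ (t i) = h * t i := by
  have hb := hE.isMonomialBase
  obtain ⟨h, ⟨a, ha, m, hm, hu⟩, hτ⟩ := hs.exists_factor hE (i := i) (by rw [hi]; simp)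
  refine ⟨h, ⟨a, ha, normalizeExp kind m, ⟨fun j hj => ?_, ?_⟩, ?_⟩, hτ⟩
  · simp [normalizeExp, hm.1 j hj, normalExp_zero]
  · have hmon := hE.monomial i
    rw [hi] at hmon
    obtain ⟨hut, -, α, hα⟩ := hmon
    have hαh : ((α : stage F kind t i) : E) = h := by
      apply hut.mul_right_cancel
      rw [← hα, ← hτ]
    have hmem : (h : E) ∈ monAlg F kind t {j : Fin e | (j : ℕ) < i} := hαh ▸ (α : stage F kind t i).2
    have hn := normalizeExp_mem hb (S := Set.univ) (m := m) (by simp)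
    by_contra hcon
    classical
    have := hE.coeff_eq_zero_of_mem hmem (m := normalizeExp kind m)
      fun h' => hcon h'.2
    rw [hu, map_smul, ← mon_normalizeExp hb m, hE.coeff_mon hn] at this
    simp [ha] at this
  · rw [mon_normalizeExp hb, hu]

include hE hs in
-- This justifies moving all R-monomials to the bottom of the tower.
theorem IsSimpleExtension.isClosedUnder_level (k : ℕ) :
    IsClosedUnder F τ hE.isMonomialBase (level kind k) where
  mul i hi hk := by
    by_cases hr : i ∈ rootSet kind
    · obtain ⟨h, hh, hτ⟩ := hs.exists_factor_root hE hr
      exact ⟨h, prodGroup_mono _ (rootSet_subset_level k) hh, hτ⟩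
    · have hpi : kind i = MonomialKind.pi := by
        rcases hki : kind i with l | _ | _
        · exact absurd ⟨l, hki⟩ hr
        · rfl
        · exact absurd hki hk
      obtain ⟨h, hh, hτ⟩ := hs.exists_factor_pi hE hpi
      refine ⟨h, prodGroup_mono _ (fun j hj => Or.inr ?_) hh, hτ⟩
      exact lt_trans hj (hi.resolve_left hr)
  add i hi hk := by
    have hmon := hE.monomial i
    rw [hk] at hmon
    refine monAlg_mono (fun j hj => Or.inr ?_) hmon.2
    have hr : i ∉ rootSet kind := fun ⟨l, hl⟩ => by rw [hl] at hk; simp at hk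
    exact lt_trans hj (hi.resolve_left hr)

include hE in
-- No monomial adds constants, so a constant descends the tower step by step down to `F`.
theorem IsRPSExtension.const_mem {c : E} (hc : τ c = c) : ∃ a : F, σ a = a ∧ c = algebraMap F E a := by
  have key : ∀ k ≤ e, c ∈ stage F kind t (e - k) := by
    intro k
    induction k with
    | zero => intro _; rw [Nat.sub_zero, hE.generates]; exact Algebra.mem_top
    | succ k ih =>
      intro hk
      have h1 : e - (k + 1) < e := by omega
      have h2 := hE.constants ⟨e - (k + 1), h1⟩ c
      simp only at h2
      rw [show e - (k + 1) + 1 = e - k by omega] at h2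
      exact h2 (ih (by omega)) hc
  have h0 := key e le_rfl
  have : stage F kind t (e - e) = ⊥ := by
    rw [Nat.sub_self, stage, ← Algebra.adjoin_empty]
    congr 1
    ext x
    simp
  rw [this, Algebra.mem_bot] at h0
  obtain ⟨a, rfl⟩ := h0
  rw [hE.extends_aut] at hc
  exact ⟨a, hE.injective hc, rfl⟩

end

end ProductGroup

/-! ### The R-monomials -/

section Roots

/-- The ideal `(p)` has a complement `J`. In `1 = q p + b` with `b ∈ J` one has `p b ∈ (p) ∩ J = 0`,
and multiplication by `p` gives the claim. -/
theorem exists_eq_mul_mul_of_isSemisimpleRing {R : Type*} [CommRing R] [IsSemisimpleRing R]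
    (p : R) : ∃ q, p = p * p * q := by
  obtain ⟨J, hJ⟩ := exists_isCompl (Ideal.span {p})
  have h1 : (1 : R) ∈ Ideal.span {p} ⊔ J := by rw [hJ.sup_eq_top]; trivial
  obtain ⟨a, ha, b, hb, hab⟩ := Submodule.mem_sup.1 h1
  obtain ⟨q, rfl⟩ := Ideal.mem_span_singleton'.1 ha
  have h0 : p * b = 0 := by
    have h2 : p * b ∈ Ideal.span {p} ⊓ J :=
      ⟨Ideal.mul_mem_right _ _ (Ideal.mem_span_singleton_self p), Ideal.mul_mem_left _ _ hb⟩
    rwa [hJ.inf_eq_bot] at h2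
  refine ⟨q, ?_⟩
  calc p = p * (q * p + b) := by rw [hab, mul_one]
    _ = p * p * q := by rw [mul_add, h0]; ring

variable {F E : Type*} [Field F] [CommRing E] [Algebra F E] {σ : RingAut F} {τ : RingAut E} {e : ℕ}
variable {kind : Fin e → MonomialKind} {t : Fin e → E}

theorem groupExps_rootSet {m : Fin e → ℤ} : m ∈ groupExps kind (rootSet kind) ↔
    ∀ i ∉ rootSet kind, m i = 0 :=
  ⟨fun h => h.2, fun h => ⟨fun i hi => h i fun ⟨l, hl⟩ => by simp [hl] at hi, h⟩⟩

/-- A common multiple of the orders of the R-monomials. -/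
theorem exists_mon_pow_eq_one (hb : ∀ i, IsMonomialBase (t i) (kind i)) : ∃ l : ℕ, 0 < l ∧
    ∀ m ∈ groupExps kind (rootSet kind), mon kind t m ^ l = 1 := by
  have h1 : ∀ i, ∃ l : ℕ, 0 < l ∧ (i ∈ rootSet kind → t i ^ l = 1) := by
    intro i
    by_cases hi : i ∈ rootSet kind
    · obtain ⟨l, hl⟩ := hi
      have := hb i
      rw [hl] at this
      exact ⟨l, by have := this.1; omega, fun _ => this.2⟩
    · exact ⟨1, one_pos, fun h => absurd h hi⟩
  choose l hl hl' using h1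
  refine ⟨∏ i, l i, Finset.prod_pos fun i _ => hl i, fun m hm => ?_⟩
  rw [mon, ← Finset.prod_pow]
  refine Finset.prod_eq_one fun i _ => ?_
  by_cases hi : i ∈ rootSet kind
  · have hk : kind i ≠ MonomialKind.sigma := by
      obtain ⟨l, hl⟩ := hi
      simp [hl]
    obtain ⟨w, hw⟩ := (hb i).isUnit hk
    have hw' : w ^ (∏ i, l i) = 1 := by
      have h2 : t i ^ (∏ i, l i) = 1 := by
        obtain ⟨c, hc⟩ := Finset.dvd_prod_of_mem l (Finset.mem_univ i)
        rw [hc, pow_mul, hl' i hi, one_pow]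
      ext
      rw [Units.val_pow_eq_pow_val, hw, h2, Units.val_one]
    rw [← hw, genPow_unit w _ hk, ← Units.val_pow_eq_pow_val, ← zpow_natCast, zpow_comm,
      zpow_natCast, hw', one_zpow, Units.val_one]
  · rw [hm.2 i hi, genPow_zero, one_pow]

/-- The powers of the R-monomials, as a group. -/
def rootGroup (hb : ∀ i, IsMonomialBase (t i) (kind i)) : Subgroup Eˣ where
  carrier := {u | ∃ m ∈ groupExps kind (rootSet kind), (u : E) = mon kind t m}
  one_mem' := ⟨0, zero_mem _, by simp⟩
  mul_mem' := by
    rintro u v ⟨m, hm, hu⟩ ⟨m', hm', hv⟩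
    exact ⟨m + m', add_mem hm hm', by rw [Units.val_mul, hu, hv, mon_add_group hb hm hm']⟩
  inv_mem' := by
    rintro u ⟨m, hm, hu⟩
    refine ⟨-m, neg_mem hm, ?_⟩
    rw [Units.inv_eq_of_mul_eq_one_right]
    rw [hu, mon_mul_neg hb hm]

theorem finite_normalExps_rootSet : (normalExps kind (rootSet kind)).Finite := by
  have : ∀ i, ∃ s : Set ℤ, s.Finite ∧ ∀ m ∈ normalExps kind (rootSet kind), m i ∈ s := by
    intro i
    by_cases hi : i ∈ rootSet kind
    · obtain ⟨l, hl⟩ := hi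
      refine ⟨Set.Ico 0 (l : ℤ), Set.finite_Ico _ _, fun m hm => ?_⟩
      have := hm.1 i
      rwa [hl] at this
    · exact ⟨{0}, Set.finite_singleton _, fun m hm => hm.2 i hi⟩
  choose s hs hs' using this
  exact (Set.Finite.pi' hs).subset fun m hm i => hs' i m hm

theorem finite_rootGroup (hb : ∀ i, IsMonomialBase (t i) (kind i)) : Finite (rootGroup hb) := by
  have hfin : Finite (normalExps kind (rootSet kind)) := finite_normalExps_rootSet
  have : ∀ u : rootGroup hb, ∃ m : normalExps kind (rootSet kind), ((u : Eˣ) : E) = mon kind t m := by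
    rintro ⟨u, m, hm, hu⟩
    exact ⟨⟨_, normalizeExp_mem hb hm.2⟩, by rw [hu, mon_normalizeExp hb]⟩
  choose f hf using this
  refine Finite.of_injective f fun u v h => ?_
  apply Subtype.ext
  ext
  rw [hf u, hf v, h]

variable [CharZero F] (hE : IsRPSExtension σ τ kind t)
include hE

/-- The subring generated by the R-monomials is an image of the group algebra over `F` of a finite
group. In characteristic zero the group algebra is semisimple by Maschke's theorem, hence von
Neumann regular, and regularity passes to images. -/
theorem IsRPSExtension.exists_eq_mul_mul {x : E} (hx : x ∈ monAlg F kind t (rootSet kind)) :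
    ∃ y, x = x * x * y := by
  have hb := hE.isMonomialBase
  have := finite_rootGroup hb
  let φ : MonoidAlgebra F (rootGroup hb) →ₐ[F] E :=
    MonoidAlgebra.lift F E (rootGroup hb) ((Units.coeHom E).comp (rootGroup hb).subtype)
  have hφ : ∃ p, φ p = x := by
    refine hE.monAlg_induction (p := fun x => ∃ p, φ p = x) ?_ ?_ ?_ ?_ hx
    · intro m hm
      have hm' : m ∈ groupExps kind (rootSet kind) := groupExps_rootSet.2 hm.2
      have hu : IsUnit (mon kind t m) := by
        simpa using isUnit_smul_mon (F := F) hb one_ne_zero hm'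
      refine ⟨MonoidAlgebra.of F _ ⟨hu.unit, m, hm', rfl⟩, ?_⟩
      simp [φ]
    · exact ⟨0, map_zero _⟩
    · rintro _ _ ⟨p, rfl⟩ ⟨q, rfl⟩
      exact ⟨p + q, map_add _ _ _⟩
    · rintro a _ ⟨p, rfl⟩
      exact ⟨a • p, map_smul _ _ _⟩
  obtain ⟨p, rfl⟩ := hφ
  have hne : NeZero (Nat.card (rootGroup hb) : F) := ⟨by exact_mod_cast Nat.card_pos.ne'⟩
  have hss : IsSemisimpleRing (MonoidAlgebra F (rootGroup hb)) := inferInstance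
  obtain ⟨q, hq⟩ := exists_eq_mul_mul_of_isSemisimpleRing p
  exact ⟨φ q, by rw [← map_mul, ← map_mul, ← hq]⟩

/-- Semi-constants among the combinations of R-monomials are units. -/
theorem IsRPSExtension.isUnit_of_root {x : E} (hx : x ∈ monAlg F kind t (rootSet kind))
    (h0 : x ≠ 0) {u : E} (hu : IsUnit u) (h : τ x = u * x) : IsUnit x := by
  -- The element `x * y` is an idempotent with `x * (x * y) = x`. The relation `τ x = u x` makes it
  -- invariant under `τ`, so it is an idempotent of the field `F`; it is not `0`, since `x ≠ 0`.
  obtain ⟨y, hy⟩ := hE.exists_eq_mul_mul hx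
  have h1 : τ x = τ x * τ x * τ y := by rw [← map_mul, ← map_mul, ← hy]
  have h2 : τ (x * y) * x = x := by
    apply hu.mul_left_cancel
    rw [map_mul]
    calc u * (τ x * τ y * x) = τ x * τ y * (u * x) := by ring
      _ = τ x * τ x * τ y := by rw [← h]; ring
      _ = u * x := by rw [← h1, h]
  have h3 : τ (x * y) = x * y := by
    have e1 : τ (x * y) * (x * y) = x * y := by rw [← mul_assoc, h2]
    have e2 : τ (x * y) * (x * y) = τ (x * y) := by
      rw [map_mul, h]
      calc u * x * τ y * (x * y) = u * (x * x * y) * τ y := by ring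
        _ = u * x * τ y := by rw [← hy]
    rw [← e2, e1]
  obtain ⟨a, -, ha⟩ := hE.const_mem h3
  have hidem : (x * y) * (x * y) = x * y := by
    calc x * y * (x * y) = x * x * y * y := by ring
      _ = x * y := by rw [← hy]
  rw [ha, ← map_mul] at hidem
  have ha' := hE.injective hidem
  rcases IsIdempotentElem.iff_eq_zero_or_one.1 ha' with h' | h'
  · rw [h', map_zero] at ha
    exact absurd (by rw [hy, mul_assoc, ha, mul_zero]) h0
  · exact IsUnit.of_mul_eq_one y (by rw [ha, h', map_one])

end Roots

/-! ### Norms with respect to powers of the automorphism -/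

section Iterates

/-- The product `u τ(u) ⋯ τ ^ (k - 1) (u)`. -/
def iterProd {E : Type*} [CommRing E] (τ : RingAut E) (u : E) (k : ℕ) : E :=
  ∏ i ∈ Finset.range k, (τ ^ i) u

/-- The cocycle identity for norms. -/
theorem iterProd_add {E : Type*} [CommRing E] (τ : RingAut E) (u : E) (k l : ℕ) :
    iterProd τ u (k + l) = iterProd τ u k * (τ ^ k) (iterProd τ u l) := by
  simp only [iterProd, Finset.prod_range_add, map_prod, pow_add, RingAut.mul_apply]

theorem iterProd_succ {E : Type*} [CommRing E] (τ : RingAut E) (u : E) (k : ℕ) :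
    iterProd τ u (k + 1) = u * τ (iterProd τ u k) := by
  rw [add_comm, iterProd_add]
  simp [iterProd]

variable {F E : Type*} [Field F] [CommRing E] [Algebra F E] {σ : RingAut F} {τ : RingAut E} {e : ℕ}
variable {kind : Fin e → MonomialKind} {t : Fin e → E}

theorem pow_algebraMap (hext : ∀ a : F, τ (algebraMap F E a) = algebraMap F E (σ a)) (k : ℕ) (a : F) :
    (τ ^ k) (algebraMap F E a) = algebraMap F E ((σ ^ k) a) := by
  induction k generalizing a with
  | zero => simp
  | succ k ih => rw [pow_succ, RingAut.mul_apply, hext, ih, pow_succ, RingAut.mul_apply]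

theorem pow_smul_map (hext : ∀ a : F, τ (algebraMap F E a) = algebraMap F E (σ a)) (k : ℕ) (a : F)
    (x : E) : (τ ^ k) (a • x) = (σ ^ k) a • (τ ^ k) x := by
  rw [Algebra.smul_def, map_mul, pow_algebraMap hext, ← Algebra.smul_def]

theorem pow_apply_iterate {E : Type*} [CommRing E] (τ : RingAut E) (k : ℕ) (x : E) :
    (τ ^ k) x = τ^[k] x := by
  induction k with
  | zero => rfl
  | succ k ih => rw [pow_succ', RingAut.mul_apply, ih, Function.iterate_succ_apply']

variable (hE : IsRPSExtension σ τ kind t) (hs : IsSimpleExtension F τ kind t)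
include hE

theorem IsRPSExtension.exists_period
    (hper : ∀ i ∈ rootSet kind, ∃ p > 0, τ^[p] (t i) = t i) :
    ∃ p > 0, ∀ m ∈ groupExps kind (rootSet kind), (τ ^ p) (mon kind t m) = mon kind t m := by
  have hb := hE.isMonomialBase
  have h1 : ∀ i, ∃ p : ℕ, 0 < p ∧ (i ∈ rootSet kind → τ^[p] (t i) = t i) := by
    intro i
    by_cases hi : i ∈ rootSet kind
    · obtain ⟨p, hp, h⟩ := hper i hi
      exact ⟨p, hp, fun _ => h⟩
    · exact ⟨1, one_pos, fun h => absurd h hi⟩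
  choose p hp hp' using h1
  refine ⟨∏ i, p i, Finset.prod_pos fun i _ => hp i, fun m hm => ?_⟩
  rw [mon, map_prod]
  refine Finset.prod_congr rfl fun i _ => ?_
  by_cases hi : i ∈ rootSet kind
  · have hk : kind i ≠ MonomialKind.sigma := by
      obtain ⟨l, hl⟩ := hi
      simp [hl]
    have ht : (τ ^ ∏ i, p i) (t i) = t i := by
      obtain ⟨c, hc⟩ := Finset.dvd_prod_of_mem p (Finset.mem_univ i)
      rw [pow_apply_iterate, hc]
      exact (Function.IsPeriodicPt.mul_const (hp' i hi) c)
    simpa using map_genPow_of_unit (τ := τ ^ ∏ i, p i) ((hb i).isUnit hk) hk (h := 1)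
      (by rw [ht, Units.val_one, one_mul]) (m i)
  · rw [hm.2 i hi, genPow_zero, map_one]

include hs in
/-- There is a power of the automorphism that fixes the R-monomials and for which the norms of the
members of the product group over the R-monomials lie in the ground field. -/
theorem IsRPSExtension.exists_good_power
    (hper : ∀ i ∈ rootSet kind, ∃ p > 0, τ^[p] (t i) = t i) :
    ∃ k > 0, (∀ m ∈ groupExps kind (rootSet kind), (τ ^ k) (mon kind t m) = mon kind t m) ∧
      ∀ u ∈ prodGroup F hE.isMonomialBase (rootSet kind),
        ∃ a : F, a ≠ 0 ∧ iterProd τ (u : E) k = algebraMap F E a := by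
  have hb := hE.isMonomialBase
  obtain ⟨p, hp, hfix⟩ := hE.exists_period hper
  obtain ⟨l, hl, hpow⟩ := exists_mon_pow_eq_one hb
  have hfix' : ∀ n, ∀ m ∈ groupExps kind (rootSet kind),
      (τ ^ (p * n)) (mon kind t m) = mon kind t m := by
    intro n m hm
    rw [pow_apply_iterate]
    have := hfix m hm
    rw [pow_apply_iterate] at this
    exact Function.IsPeriodicPt.mul_const this n
  -- Here `p` is a common period of the R-monomials and `l` a common exponent of their products.
  refine ⟨p * l, Nat.mul_pos hp hl, hfix' l, fun u hu => ?_⟩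
  have hcl : IsClosedUnder F τ hb (rootSet kind) := level_zero (kind := kind) ▸
    hs.isClosedUnder_level hE 0
  have hmem : ∀ n, ∃ v ∈ prodGroup F hb (rootSet kind), (v : E) = iterProd τ (u : E) n := by
    intro n
    induction n with
    | zero => exact ⟨1, one_mem _, by simp [iterProd]⟩
    | succ n ih =>
      obtain ⟨v, hv, hv'⟩ := ih
      refine ⟨u * Units.map (τ : E →* E) v, mul_mem hu (hcl.map_prodGroup hE.extends_aut hv), ?_⟩
      rw [iterProd_succ, ← hv']
      rfl
  obtain ⟨v, ⟨a, ha, m, hm, hv⟩, hv'⟩ := hmem p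
  -- The norm of length `p` is a scalar times a product of R-monomials. As `τ ^ p` fixes this
  -- product, the norm of length `p * n` is a scalar times its `n`-th power, which is `1` for `n =
  -- l`.
  have key : ∀ n, ∃ c : F, c ≠ 0 ∧ iterProd τ (u : E) (p * n) = c • mon kind t m ^ n := by
    intro n
    induction n with
    | zero => exact ⟨1, one_ne_zero, by simp [iterProd]⟩
    | succ n ih =>
      obtain ⟨c, hc, h⟩ := ih
      refine ⟨c * (σ ^ (p * n)) a, mul_ne_zero hc ((RingEquiv.map_ne_zero_iff _).2 ha), ?_⟩
      rw [Nat.mul_succ, iterProd_add, ← hv', hv, h, pow_smul_map hE.extends_aut, hfix' n m hm,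
        smul_mul_smul_comm, pow_succ]
  obtain ⟨c, hc, h⟩ := key l
  exact ⟨c, hc, by rw [h, hpow m hm, Algebra.algebraMap_eq_smul_one]⟩

end Iterates

/-! ### Semi-constants -/

section SemiConstants

variable {F E : Type*} [Field F] [CommRing E] [Algebra F E] {σ : RingAut F} {τ : RingAut E} {e : ℕ}
variable {kind : Fin e → MonomialKind} {t : Fin e → E} (hE : IsRPSExtension σ τ kind t)

include hE in
theorem IsRPSExtension.insert_induction {S : Set (Fin e)} {i : Fin e} {p : E → Prop} (h0 : p 0)
    (hadd : ∀ x y, p x → p y → p (x + y))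
    (hterm : ∀ a ∈ monAlg F kind t S, ∀ j, IsNormalExp (kind i) j →
      p (a * genPow (t i) j (kind i))) {x : E} (hx : x ∈ monAlg F kind t (insert i S)) : p x := by
  obtain ⟨D, hD⟩ := hE.exists_degLE i x
  rw [(hD D le_rfl).2]
  refine Finset.sum_induction _ p hadd h0 fun j _ => ?_
  by_cases hj : IsNormalExp (kind i) j
  · exact hterm _ (hE.coeffAt_mem hx j) j hj
  · simpa [hE.coeffAt_of_not_normal i hj] using h0

section
variable {S : Set (Fin e)} {i : Fin e} (hi : i ∉ S)
include hi

theorem IsRPSExtension.coeffAt_mul {a x : E} (ha : a ∈ monAlg F kind t S)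
    (hx : x ∈ monAlg F kind t (insert i S)) (j : ℤ) :
    hE.coeffAt i j (a * x) = a * hE.coeffAt i j x := by
  refine hE.insert_induction (i := i) (S := S)
    (p := fun x => hE.coeffAt i j (a * x) = a * hE.coeffAt i j x) ?_ ?_ ?_ hx
  · simp
  · intro x y hx hy; rw [mul_add, map_add, map_add, mul_add, hx, hy]
  · intro b hb j' hj'
    rw [← mul_assoc, hE.coeffAt_mul_genPow hi (mul_mem ha hb) j hj',
      hE.coeffAt_mul_genPow hi hb j hj']
    split_ifs <;> simp

theorem IsRPSExtension.coeffAt_mul_genPow_mul {u : E} (hu : u ∈ monAlg F kind t S)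
    (hk : kind i = MonomialKind.pi) (w : ℤ) {x : E} (hx : x ∈ monAlg F kind t (insert i S)) (j : ℤ) :
    hE.coeffAt i j (u * genPow (t i) w (kind i) * x) = u * hE.coeffAt i (j - w) x := by
  refine hE.insert_induction (i := i) (S := S)
    (p := fun x => hE.coeffAt i j (u * genPow (t i) w (kind i) * x) =
      u * hE.coeffAt i (j - w) x) ?_ ?_ ?_ hx
  · simp
  · intro x y hx hy; rw [mul_add, map_add, map_add, mul_add, hx, hy]
  · intro b hb j' hj'
    have h1 : u * genPow (t i) w (kind i) * (b * genPow (t i) j' (kind i)) =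
        (u * b) * genPow (t i) (w + j') (kind i) := by
      rw [(hE.isMonomialBase i).genPow_add (by simp [hk]) (by simp [hk])]
      ring
    have hn : ∀ j, IsNormalExp (kind i) j := fun j => by rw [hk]; trivial
    rw [h1, hE.coeffAt_mul_genPow hi (mul_mem hu hb) j (hn _), hE.coeffAt_mul_genPow hi hb _ (hn _)]
    by_cases h : w + j' = j
    · rw [if_pos h, if_pos (by omega)]
    · rw [if_neg h, if_neg (by omega), mul_zero]

/-- The image of a power of a Π-monomial is the same power times a unit from below, so `τ` does not
mix the exponents. -/
theorem IsRPSExtension.coeffAt_map_pi (hS : IsClosedUnder F τ hE.isMonomialBase S)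
    (hk : kind i = MonomialKind.pi) {h : Eˣ} (hh : h ∈ prodGroup F hE.isMonomialBase S)
    (hτ : τ (t i) = h * t i) {x : E} (hx : x ∈ monAlg F kind t (insert i S)) (j : ℤ) :
    hE.coeffAt i j (τ x) = τ (hE.coeffAt i j x) * ((h ^ j : Eˣ) : E) := by
  refine hE.insert_induction (i := i) (S := S)
    (p := fun x => hE.coeffAt i j (τ x) = τ (hE.coeffAt i j x) * ((h ^ j : Eˣ) : E)) ?_ ?_ ?_ hx
  · simp
  · intro x y hx hy; rw [map_add, map_add, map_add, map_add, hx, hy, add_mul]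
  · intro b hb j' hj'
    have h1 : τ (genPow (t i) j' (kind i)) = ((h ^ j' : Eˣ) : E) * genPow (t i) j' (kind i) :=
      map_genPow_of_unit ((hE.isMonomialBase i).isUnit (by simp [hk])) (by simp [hk]) hτ j'
    rw [map_mul, h1, ← mul_assoc, hE.coeffAt_mul_genPow hi _ j hj',
      hE.coeffAt_mul_genPow hi hb j hj']
    · split_ifs with h2
      · rw [h2]
      · simp
    · exact mul_mem (hS.map_monAlg hE.extends_aut hb)
        (prodGroup_mem_monAlg hE.isMonomialBase (zpow_mem hh j'))

/-- Binomial expansion of `(t i + β) ^ j` with `β = τ (t i) - t i`. For `k > j` the truncated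
difference `j - k` is harmless because the binomial coefficient vanishes. -/
theorem IsRPSExtension.coeffAt_map_sigma_term (hS : IsClosedUnder F τ hE.isMonomialBase S)
    (hk : kind i = MonomialKind.sigma) (hβ : τ (t i) - t i ∈ monAlg F kind t S) {a : E}
    (ha : a ∈ monAlg F kind t S) (j k : ℕ) :
    hE.coeffAt i k (τ (a * genPow (t i) j (kind i))) =
      τ a * ((τ (t i) - t i) ^ (j - k) * (j.choose k : E)) := by
  set β := τ (t i) - t i with hβ'
  have h1 : τ (t i) = t i + β := by rw [hβ']; ring
  have hn : ∀ n : ℕ, IsNormalExp (kind i) (n : ℤ) := fun n => by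
    rw [hk]; exact Int.natCast_nonneg n
  rw [genPow_natCast, map_mul, map_pow, h1, add_pow, Finset.mul_sum, map_sum]
  have h2 : ∀ m : ℕ, hE.coeffAt i k (τ a * (t i ^ m * β ^ (j - m) * (j.choose m : E))) =
      if m = k then τ a * (β ^ (j - m) * (j.choose m : E)) else 0 := by
    intro m
    have h3 : τ a * (t i ^ m * β ^ (j - m) * (j.choose m : E)) =
        (τ a * (β ^ (j - m) * (j.choose m : E))) * genPow (t i) (m : ℤ) (kind i) := by
      rw [genPow_natCast]; ring
    rw [h3, hE.coeffAt_mul_genPow hi _ _ (hn m)]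
    · simp only [Nat.cast_inj]
    · exact mul_mem (hS.map_monAlg hE.extends_aut ha)
        (mul_mem (pow_mem hβ _) (natCast_mem _ _))
  simp only [h2]
  rw [Finset.sum_ite_eq']
  split_ifs with h4
  · rfl
  · rw [Finset.mem_range, not_lt] at h4
    rw [Nat.choose_eq_zero_of_lt (by omega)]
    simp

theorem IsRPSExtension.coeffAt_map_sigma (hS : IsClosedUnder F τ hE.isMonomialBase S)
    (hk : kind i = MonomialKind.sigma) (hβ : τ (t i) - t i ∈ monAlg F kind t S) {x : E}
    (hx : x ∈ monAlg F kind t (insert i S)) {D : ℕ} (hD : ∀ j : ℤ, D < j → hE.coeffAt i j x = 0)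
    (k : ℕ) : hE.coeffAt i k (τ x) = ∑ j ∈ Finset.range (D + 1),
      τ (hE.coeffAt i j x) * ((τ (t i) - t i) ^ (j - k) * (j.choose k : E)) := by
  have h1 : x = ∑ j ∈ Finset.range (D + 1), hE.coeffAt i j x * genPow (t i) (j : ℤ) (kind i) := by
    refine hE.ext_coeffAt i fun j => ?_
    rw [map_sum]
    have hn : ∀ n : ℕ, IsNormalExp (kind i) (n : ℤ) := fun n => by
      rw [hk]; exact Int.natCast_nonneg n
    simp only [hE.coeffAt_mul_genPow hi (hE.coeffAt_mem hx _) j (hn _)]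
    by_cases hj : 0 ≤ j
    · obtain ⟨n, rfl⟩ := Int.eq_ofNat_of_zero_le hj
      simp only [Nat.cast_inj, Finset.sum_ite_eq']
      split_ifs with h
      · rfl
      · rw [Finset.mem_range, not_lt] at h
        exact hD _ (by omega)
    · rw [hE.coeffAt_of_not_normal i (by rw [hk]; exact hj)]
      symm
      exact Finset.sum_eq_zero fun m _ => if_neg (by omega)
  conv_lhs => rw [h1]
  rw [map_sum, map_sum]
  exact Finset.sum_congr rfl fun j _ =>
    hE.coeffAt_map_sigma_term hi hS hk hβ (hE.coeffAt_mem hx _) j k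

theorem IsRPSExtension.coeffAt_map_sigma_top (hS : IsClosedUnder F τ hE.isMonomialBase S)
    (hk : kind i = MonomialKind.sigma) (hβ : τ (t i) - t i ∈ monAlg F kind t S) {x : E}
    (hx : x ∈ monAlg F kind t (insert i S)) {D : ℕ} (hD : ∀ j : ℤ, D < j → hE.coeffAt i j x = 0) :
    hE.coeffAt i D (τ x) = τ (hE.coeffAt i D x) := by
  rw [hE.coeffAt_map_sigma hi hS hk hβ hx hD, Finset.sum_range_succ, Finset.sum_eq_zero]
  · simp
  · intro j hj
    rw [Nat.choose_eq_zero_of_lt (Finset.mem_range.1 hj)]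
    simp

end

include hE in
-- The quotient of two semi-constants with the same factor is a constant.
theorem IsRPSExtension.eq_smul_of_semiconst {x y u : E} (hy : IsUnit y) (hu : IsUnit u)
    (h1 : τ x = u * x) (h2 : τ y = u * y) : ∃ a : F, σ a = a ∧ x = a • y := by
  obtain ⟨w, rfl⟩ := hy
  have h3 : x = x * ((w⁻¹ : Eˣ) : E) * w := by rw [mul_assoc, Units.inv_mul, mul_one]
  have h4 : τ (x * ((w⁻¹ : Eˣ) : E)) = x * ((w⁻¹ : Eˣ) : E) := by
    apply (hu.mul w.isUnit).mul_right_cancel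
    rw [← h2, ← map_mul, ← h3, h2, h1]
    conv_lhs => rw [h3]
    ring
  obtain ⟨a, ha, h5⟩ := hE.const_mem h4
  exact ⟨a, ha, by rw [h3, h5, Algebra.smul_def]⟩

theorem IsRPSExtension.split_unit {S : Set (Fin e)} {i : Fin e}
    (hb : ∀ i, IsMonomialBase (t i) (kind i)) {u : Eˣ} (hu : u ∈ prodGroup F hb (insert i S)) :
    ∃ u' ∈ prodGroup F hb S, ∃ w : ℤ, (kind i = MonomialKind.sigma → w = 0) ∧
      (u : E) = u' * genPow (t i) w (kind i) := by
  obtain ⟨a, ha, m, hm, hu⟩ := hu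
  have h1 : Function.update m i 0 ∈ groupExps kind S := by
    refine ⟨fun j hj => ?_, fun j hj => ?_⟩
    · by_cases h : j = i
      · simp [h]
      · simpa [h] using hm.1 j hj
    · by_cases h : j = i
      · simp [h]
      · simpa [h] using hm.2 j (by simp [h, hj])
  obtain ⟨u', hu', h2⟩ := exists_prodGroup hb ha h1
  refine ⟨u', hu', m i, hm.1 i, ?_⟩
  rw [hu, h2, smul_mul_assoc, ← mon_single, ← mon_add hb (fun j hj => (h1.1 j hj).ge)]
  · congr 2
    funext j
    by_cases h : j = i
    · subst h; simp
    · simp [h]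
  · intro j hj
    by_cases h : j = i
    · subst h; simpa using (hm.1 j hj).ge
    · simp [h]

variable [CharZero F] (hs : IsSimpleExtension F τ kind t)

include hE hs in
/-- The semi-constants over the product group are units, products of a combination of R-monomials
and of a product of powers of Π-monomials. -/
theorem IsRPSExtension.semiconst {k : ℕ} (hk : k ≤ e) {x : E}
    (hx : x ∈ monAlg F kind t (level kind k)) (hx0 : x ≠ 0) {u : Eˣ}
    (hu : u ∈ prodGroup F hE.isMonomialBase (level kind k)) (h : τ x = u * x) :
    ∃ γ ∈ monAlg F kind t (rootSet kind), ∃ m : Fin e → ℤ,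
      (∀ i, kind i ≠ MonomialKind.pi → m i = 0) ∧ (∀ i ∉ level kind k, m i = 0) ∧
      x = γ * mon kind t m ∧ IsUnit x := by
  induction k generalizing x u with
  | zero =>
    rw [level_zero] at hx
    exact ⟨x, hx, 0, fun _ _ => rfl, fun _ _ => rfl, by simp, hE.isUnit_of_root hx hx0 u.isUnit h⟩
  | succ k ih =>
    have hk' : k < e := hk
    let i : Fin e := ⟨k, hk'⟩
    have hlev : level kind (k + 1) = insert i (level kind k) := level_succ i
    rw [hlev] at hx hu
    -- An R-monomial belongs to every level already, so nothing changes.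
    by_cases hr : i ∈ rootSet kind
    · have h1 : insert i (level kind k) = level kind k :=
        Set.insert_eq_of_mem (rootSet_subset_level k hr)
      rw [h1] at hx hu
      rw [hlev, h1]
      exact ih hk'.le hx hx0 hu h
    have hi : i ∉ level kind k := not_mem_level i hr
    have hS := hs.isClosedUnder_level hE k
    have hb := hE.isMonomialBase
    obtain ⟨u', hu', w, hw, huw⟩ := IsRPSExtension.split_unit hb hu
    have hex : ∃ j, hE.coeffAt i j x ≠ 0 := by
      by_contra hcon
      push Not at hcon
      exact hx0 (hE.ext_coeffAt i fun j => by rw [hcon, map_zero])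
    obtain ⟨D, hD⟩ := hE.exists_degLE i x
    have hDx := (hD D le_rfl).1
    rcases hki : kind i with l | _ | _
    · exact absurd ⟨l, hki⟩ hr
    · obtain ⟨α, hα, hτ⟩ := hs.exists_factor_pi hE hki
      have hα' : α ∈ prodGroup F hb (level kind k) :=
        prodGroup_mono hb (fun j hj => Or.inr hj) hα
      have hrec : ∀ j, τ (hE.coeffAt i j x) * ((α ^ j : Eˣ) : E) =
          u' * hE.coeffAt i (j - w) x := by
        intro j
        rw [← hE.coeffAt_map_pi hi hS hki hα' hτ hx, h, huw,
          hE.coeffAt_mul_genPow_mul hi (prodGroup_mem_monAlg hb hu') hki w hx]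
      -- If `w ≠ 0`, the recursion `hrec` carries a nonzero coefficient at `j` on to all exponents
      -- `j + n * w`, although only finitely many coefficients are nonzero.
      have hw0 : w = 0 := by
        by_contra hw0
        obtain ⟨j, hj⟩ := hex
        have h1 : ∀ n : ℕ, hE.coeffAt i (j + n * w) x ≠ 0 := by
          intro n
          induction n with
          | zero => simpa using hj
          | succ n ihn =>
            intro h0
            have h2 := hrec (j + (n + 1 : ℕ) * w)
            rw [h0, map_zero, zero_mul] at h2
            have h3 : j + (n + 1 : ℕ) * w - w = j + n * w := by push_cast; ring
            rw [h3] at h2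
            exact ihn ((Units.mul_right_eq_zero u').1 h2.symm)
        refine h1 (D + j.natAbs + 1) (hDx _ ?_)
        have h4 : ((D + j.natAbs + 1 : ℕ) : ℤ) * w = (j + ((D + j.natAbs + 1 : ℕ) : ℤ) * w) - j := by
          ring
        have h5 : (((D + j.natAbs + 1 : ℕ) : ℤ) * w).natAbs ≥ D + j.natAbs + 1 := by
          rw [Int.natAbs_mul, Int.natAbs_natCast]
          exact Nat.le_mul_of_pos_right _ (Int.natAbs_pos.2 hw0)
        omega
      obtain ⟨j, hj⟩ := hex
      subst hw0
      -- Each nonzero coefficient is a semi-constant one level below, hence a unit of the required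
      -- form. The corresponding term of `x` then has the same factor `u` as `x`, so the two differ
      -- by a constant.
      have h1 : τ (hE.coeffAt i j x) = ((u' * (α ^ j)⁻¹ : Eˣ) : E) * hE.coeffAt i j x := by
        have h2 := hrec j
        rw [sub_zero] at h2
        apply (α ^ j).isUnit.mul_right_cancel
        rw [h2, Units.val_mul]
        calc (u' : E) * hE.coeffAt i j x
            = u' * hE.coeffAt i j x * (((α ^ j)⁻¹ : Eˣ) * ((α ^ j : Eˣ) : E)) := by
              rw [Units.inv_mul, mul_one]
          _ = _ := by ring
      obtain ⟨γ, hγ, m, hm1, hm2, hm3, hm4⟩ := ih hk'.le (hE.coeffAt_mem hx j) hj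
        (mul_mem hu' (inv_mem (zpow_mem hα' j))) h1
      have hj' : IsUnit (genPow (t i) j (kind i)) := by
        obtain ⟨v, hv⟩ := (hb i).isUnit (by simp [hki])
        rw [← hv, genPow_unit v j (by simp [hki])]
        exact Units.isUnit _
      have h5 : τ (genPow (t i) j (kind i)) = ((α ^ j : Eˣ) : E) * genPow (t i) j (kind i) :=
        map_genPow_of_unit ((hb i).isUnit (by simp [hki])) (by simp [hki]) hτ j
      obtain ⟨a, -, ha⟩ := hE.eq_smul_of_semiconst (y := hE.coeffAt i j x * genPow (t i) j (kind i))
        (hm4.mul hj') u.isUnit h (by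
          rw [map_mul, h1, h5, huw, genPow_zero, mul_one, Units.val_mul]
          calc _ = (u' : E) * (hE.coeffAt i j x * genPow (t i) j (kind i)) *
              (((α ^ j)⁻¹ : Eˣ) * ((α ^ j : Eˣ) : E)) := by ring
            _ = _ := by rw [Units.inv_mul, mul_one])
      have ha0 : a ≠ 0 := by
        rintro rfl
        exact hx0 (by rw [ha, zero_smul])
      refine ⟨a • γ, Subalgebra.smul_mem _ hγ _, m + Pi.single i j, ?_, ?_, ?_, ?_⟩
      · intro l hl
        have : l ≠ i := by rintro rfl; exact hl hki
        simp [hm1 l hl, this]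
      · intro l hl
        rw [hlev, Set.mem_insert_iff, not_or] at hl
        simp [hm2 l hl.2, hl.1]
      · rw [ha, hm3, mon_add hb, mon_single, smul_mul_assoc, mul_assoc]
        · intro l hl; rw [hm1 l (by simp [hl])]
        · intro l hl
          have : l ≠ i := by rintro rfl; simp [hki] at hl
          simp [this]
      · rw [ha, Algebra.smul_def]
        exact (ha0.isUnit.map (algebraMap F E)).mul (hm4.mul hj')
    · have hβ : τ (t i) - t i ∈ monAlg F kind t (level kind k) := by
        have hmon := hE.monomial i
        rw [hki] at hmon
        exact monAlg_mono (fun j hj => Or.inr hj) hmon.2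
      classical
      obtain ⟨j₀, hj₀⟩ := hex
      have hne : ((Finset.Icc (-D : ℤ) D).filter fun j => hE.coeffAt i j x ≠ 0).Nonempty := by
        refine ⟨j₀, Finset.mem_filter.2 ⟨?_, hj₀⟩⟩
        by_contra h'
        refine hj₀ (hDx _ ?_)
        rw [Finset.mem_Icc] at h'
        omega
      obtain ⟨d, hd, hmax⟩ := Finset.exists_max_image _ id hne
      rw [Finset.mem_filter] at hd
      have hd0 : 0 ≤ d := by
        by_contra h'
        exact hd.2 (hE.coeffAt_of_not_normal i (by rw [hki]; exact h') x)
      obtain ⟨n, rfl⟩ := Int.eq_ofNat_of_zero_le hd0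
      have htop : ∀ j : ℤ, n < j → hE.coeffAt i j x = 0 := by
        intro j hj
        by_contra h'
        have : j ∈ Finset.Icc (-D : ℤ) D := by
          by_contra h''
          refine h' (hDx _ ?_)
          rw [Finset.mem_Icc] at h''
          omega
        have := hmax j (Finset.mem_filter.2 ⟨this, h'⟩)
        simp only [id] at this
        omega
      have hw0 := hw hki
      subst hw0
      rw [genPow_zero, mul_one] at huw
      -- The leading coefficient has the same factor as `x` and is a unit by induction; hence `x` is
      -- a constant multiple of it.
      have h1 : τ (hE.coeffAt i n x) = u' * hE.coeffAt i n x := by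
        rw [← hE.coeffAt_map_sigma_top hi hS hki hβ hx htop, h, huw,
          hE.coeffAt_mul hi (prodGroup_mem_monAlg hb hu') hx]
      obtain ⟨γ, hγ, m, hm1, hm2, hm3, hm4⟩ := ih hk'.le (hE.coeffAt_mem hx n) hd.2 hu' h1
      obtain ⟨a, -, ha⟩ := hE.eq_smul_of_semiconst hm4 u.isUnit h (by rw [h1, huw])
      have ha0 : a ≠ 0 := by
        rintro rfl
        exact hx0 (by rw [ha, zero_smul])
      refine ⟨a • γ, Subalgebra.smul_mem _ hγ _, m, hm1, ?_, ?_, ?_⟩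
      · intro l hl
        rw [hlev, Set.mem_insert_iff, not_or] at hl
        exact hm2 l hl.2
      · conv_lhs => rw [ha, hm3]
        rw [smul_mul_assoc]
      · rw [ha, Algebra.smul_def]
        exact (ha0.isUnit.map (algebraMap F E)).mul hm4

end SemiConstants

/-! ### Computing in an RΠΣ-extension -/

section TermLists

variable {F E : Type*} [Field F] [CommRing E] [Algebra F E] {σ : RingAut F} {τ : RingAut E} {e : ℕ}
variable {kind : Fin e → MonomialKind} {t : Fin e → E}

theorem evalTerms_nil : evalTerms (F := F) kind t [] = 0 := rfl

theorem evalTerms_cons (p : (Fin e → ℤ) × F) (w : List ((Fin e → ℤ) × F)) :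
    evalTerms kind t (p :: w) = p.2 • mon kind t p.1 + evalTerms kind t w := by
  simp [evalTerms, mon, Algebra.smul_def]

theorem evalTerms_append (v w : List ((Fin e → ℤ) × F)) :
    evalTerms kind t (v ++ w) = evalTerms kind t v + evalTerms kind t w := by
  simp [evalTerms]

theorem evalTerms_neg (w : List ((Fin e → ℤ) × F)) :
    evalTerms kind t (w.map fun p => (p.1, -p.2)) = -evalTerms kind t w := by
  induction w with
  | nil => simp [evalTerms_nil]
  | cons p w ih => rw [List.map_cons, evalTerms_cons, evalTerms_cons, ih]; simp; abel

/-- Exponents are reduced before they are added: a negative exponent of a Σ-monomial stands for `0`,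
and plain addition would not respect this. -/
theorem evalTerms_mul (hb : ∀ i, IsMonomialBase (t i) (kind i)) (p : (Fin e → ℤ) × F)
    (w : List ((Fin e → ℤ) × F)) :
    evalTerms kind t (w.map fun q => (normalizeExp kind p.1 + normalizeExp kind q.1, p.2 * q.2)) =
      p.2 • mon kind t p.1 * evalTerms kind t w := by
  induction w with
  | nil => simp [evalTerms_nil]
  | cons q w ih =>
    rw [List.map_cons, evalTerms_cons, evalTerms_cons, ih, mul_add, smul_mul_smul_comm]
    congr 2
    conv_rhs => rw [← mon_normalizeExp hb p.1, ← mon_normalizeExp hb q.1]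
    exact mon_add hb (m := normalizeExp kind p.1) (m' := normalizeExp kind q.1)
      (fun i hi => ((hb i).isNormalExp (p.1 i)).nonneg hi)
      (fun i hi => ((hb i).isNormalExp (q.1 i)).nonneg hi)

/-- The coefficient of a monomial in a list of terms. -/
def coeffTerms [DecidableEq (Fin e → ℤ)] (kind : Fin e → MonomialKind) (m : Fin e → ℤ)
    (w : List ((Fin e → ℤ) × F)) : F :=
  ((w.filter fun p => decide (normalizeExp kind p.1 = m)).map Prod.snd).sum

variable (hE : IsRPSExtension σ τ kind t)

theorem IsRPSExtension.coeff_evalTerms [DecidableEq (Fin e → ℤ)] (m : Fin e → ℤ)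
    (w : List ((Fin e → ℤ) × F)) :
    hE.coeff m (evalTerms kind t w) = coeffTerms kind m w := by
  induction w with
  | nil => simp [evalTerms_nil, coeffTerms]
  | cons p w ih =>
    rw [evalTerms_cons, map_add, map_smul, ih, ← mon_normalizeExp hE.isMonomialBase,
      hE.coeff_mon (normalizeExp_mem hE.isMonomialBase (by simp))]
    by_cases h : normalizeExp kind p.1 = m
    · simp [coeffTerms, h]
    · simp [coeffTerms, h, Ne.symm h]

include hE in
-- Only the monomials that occur in the list have to be tested, which makes this a finite zero test.
theorem IsRPSExtension.evalTerms_eq_zero_iff [DecidableEq (Fin e → ℤ)]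
    (w : List ((Fin e → ℤ) × F)) : evalTerms kind t w = 0 ↔
      ∀ p ∈ w, coeffTerms kind (normalizeExp kind p.1) w = 0 := by
  constructor
  · intro h p _
    rw [← hE.coeff_evalTerms, h, map_zero]
  · intro h
    refine hE.ext fun m _ => ?_
    rw [map_zero, hE.coeff_evalTerms]
    by_cases hm : ∃ p ∈ w, normalizeExp kind p.1 = m
    · obtain ⟨p, hp, rfl⟩ := hm
      exact h p hp
    · push Not at hm
      rw [coeffTerms, List.filter_eq_nil_iff.2]
      · rfl
      · intro p hp
        simpa using hm p hp

/-- The terms with exponent `j` at `i`, divided by the power of the monomial. -/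
def coeffAtTerms (kind : Fin e → MonomialKind) (i : Fin e) (j : ℤ)
    (w : List ((Fin e → ℤ) × F)) : List ((Fin e → ℤ) × F) :=
  (w.filter fun p => decide (normalizeExp kind p.1 i = j)).map fun p =>
    (Function.update (normalizeExp kind p.1) i 0, p.2)

theorem IsRPSExtension.coeffAt_evalTerms (i : Fin e) (j : ℤ) (w : List ((Fin e → ℤ) × F)) :
    hE.coeffAt i j (evalTerms kind t w) = evalTerms kind t (coeffAtTerms kind i j w) := by
  induction w with
  | nil => simp [evalTerms_nil, coeffAtTerms]
  | cons p w ih =>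
    rw [evalTerms_cons, map_add, map_smul, ih, ← mon_normalizeExp hE.isMonomialBase,
      hE.coeffAt_mon i j (normalizeExp_mem hE.isMonomialBase (by simp))]
    by_cases h : normalizeExp kind p.1 i = j
    · simp [coeffAtTerms, h, evalTerms_cons]
    · simp [coeffAtTerms, h]

theorem IsRPSExtension.degLE_evalTerms (i : Fin e) (w : List ((Fin e → ℤ) × F)) :
    hE.DegLE i (w.map fun p => (normalizeExp kind p.1 i).natAbs).sum (evalTerms kind t w) := by
  intro j hj
  rw [hE.coeffAt_evalTerms, coeffAtTerms, List.filter_eq_nil_iff.2]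
  · rfl
  · intro p hp
    have : (normalizeExp kind p.1 i).natAbs ≤
        (w.map fun p => (normalizeExp kind p.1 i).natAbs).sum :=
      List.single_le_sum (by simp) _ (List.mem_map_of_mem hp)
    simp only [decide_eq_true_eq]
    rintro rfl
    omega

include hE in
theorem IsRPSExtension.map_evalTerms (w : List ((Fin e → ℤ) × F)) :
    τ (evalTerms kind t w) = (w.map fun p => algebraMap F E (σ p.2) *
      ∏ i, τ (genPow (t i) (p.1 i) (kind i))).sum := by
  induction w with
  | nil => simp [evalTerms_nil]
  | cons p w ih =>
    rw [evalTerms_cons, map_add, ih, Algebra.smul_def, map_mul, hE.extends_aut, mon, map_prod]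
    simp

include hE in
theorem IsRPSExtension.evalTerms_surjective :
    Function.Surjective (evalTerms (F := F) kind t) := by
  intro x
  obtain ⟨s, -, hx⟩ := hE.sum_coeff x
  refine ⟨s.toList.map fun m => (m, hE.coeff m x), ?_⟩
  rw [evalTerms, List.map_map]
  conv_rhs => rw [hx]
  rw [← Finset.sum_map_toList]
  congr 1
  refine List.map_congr_left fun m _ => ?_
  simp [mon, Algebra.smul_def]

end TermLists

/-! ### Effective operations in the extension -/

section Effective

variable {F E : Type*} [Field F] [CommRing E] [Algebra F E] {σ : RingAut F} {τ : RingAut E} {e : ℕ}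
variable {kind : Fin e → MonomialKind} {t : Fin e → E}
variable [Primcodable F]

theorem computable_normalExp (k : MonomialKind) : Computable (normalExp k) := by
  cases k with
  | root l => exact Computable.int_emod_nat l
  | pi => exact Computable.id
  | sigma => exact Computable.int_ofNat.comp Computable.int_toNat

theorem computable_normalizeExp : Computable (normalizeExp kind) :=
  Computable.fin_pi fun i => (computable_normalExp (kind i)).comp (Computable.fin_apply i)

theorem computable_exp_add : Computable₂ fun m m' : Fin e → ℤ => m + m' :=
  Computable.fin_pi fun i => Computable.int_add.comp
    ((Computable.fin_apply i).comp Computable.fst) ((Computable.fin_apply i).comp Computable.snd)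

theorem computable_coeffTerms [DecidableEq (Fin e → ℤ)] (hF : IsComputableDifferenceField σ) :
    Computable₂ (coeffTerms (F := F) kind) := by
  have h1 : Computable₂ fun (a : (Fin e → ℤ) × List ((Fin e → ℤ) × F)) (p : (Fin e → ℤ) × F) =>
      decide (normalizeExp kind p.1 = a.1) :=
    Computable.decide_eq (computable_normalizeExp.comp (Computable.fst.comp Computable.snd))
      (Computable.fst.comp Computable.fst)
  have h2 : Computable₂ fun (_ : (Fin e → ℤ) × List ((Fin e → ℤ) × F)) (p : (Fin e → ℤ) × F) =>
      p.2 := Computable.snd.comp Computable.snd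
  exact Computable.list_sum hF.add (Computable.list_map
    (Computable.list_filter Computable.snd h1) h2)

theorem IsRPSExtension.exists_eq_test (hE : IsRPSExtension σ τ kind t)
    (hF : IsComputableDifferenceField σ) :
    ∃ T : List ((Fin e → ℤ) × F) → List ((Fin e → ℤ) × F) → Bool, Computable₂ T ∧
      ∀ v w, T v w = true ↔ evalTerms kind t v = evalTerms kind t w := by
  classical
  let z : List ((Fin e → ℤ) × F) → Bool := fun w =>
    w.all fun p => decide (coeffTerms kind (normalizeExp kind p.1) w = 0)
  have hz : Computable z := by
    refine Computable.list_all Computable.id ?_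
    exact Computable.decide_eq ((computable_coeffTerms hF).comp
      (computable_normalizeExp.comp (Computable.fst.comp Computable.snd)) Computable.fst)
      (Computable.const 0)
  refine ⟨fun v w => z (v ++ w.map fun p => (p.1, -p.2)), ?_, ?_⟩
  · have h2 : Computable₂ fun (_ : List ((Fin e → ℤ) × F) × List ((Fin e → ℤ) × F))
        (p : (Fin e → ℤ) × F) => (p.1, -p.2) :=
      (Computable.fst.comp Computable.snd).pair (hF.neg.comp (Computable.snd.comp Computable.snd))
    exact hz.comp (Computable.list_append.comp Computable.fst
      (Computable.list_map Computable.snd h2))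
  · intro v w
    have : z (v ++ w.map fun p => (p.1, -p.2)) = true ↔
        evalTerms kind t (v ++ w.map fun p => (p.1, -p.2)) = 0 := by
      rw [hE.evalTerms_eq_zero_iff]
      simp only [z, List.all_eq_true, decide_eq_true_eq]
    rw [this, evalTerms_append, evalTerms_neg, add_neg_eq_zero]

theorem Computable.pow_const {A : Type*} [CommRing A] [Primcodable A]
    (hmul : Computable₂ fun x y : A => x * y) (a : A) : Computable fun n : ℕ => a ^ n := by
  refine (Computable.nat_rec (g := fun _ => (1 : A)) (h := fun (_ : ℕ) p => p.2 * a)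
    Computable.id (Computable.const 1)
    (hmul.comp (Computable.snd.comp Computable.snd) (Computable.const a))).of_eq fun n => ?_
  induction n with
  | zero => simp
  | succ n ih => rw [pow_succ, ← ih]; rfl

/-- The elements of the extension have unique codes for which the operations are computable. -/
structure IsEffective [Primcodable E] (hE : IsRPSExtension σ τ kind t) : Prop where
  eval : Computable (evalTerms (F := F) kind t)
  name : ∃ s : E → List ((Fin e → ℤ) × F), Computable s ∧ ∀ x, evalTerms kind t (s x) = x
  add : Computable₂ fun x y : E => x + y
  mul : Computable₂ fun x y : E => x * y
  aut : Computable fun x : E => τ x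
  base : Computable (algebraMap F E)
  coeff : Computable₂ fun (m : Fin e → ℤ) x => hE.coeff m x
  coeffAt : ∀ i, Computable₂ fun (j : ℤ) x => hE.coeffAt i j x
  pow : ∀ i, Computable fun j => genPow (t i) j (kind i)
  degree : ∀ i, ∃ d : E → ℕ, Computable d ∧ ∀ x, hE.DegLE i (d x) x

/-- Equality of term lists is decidable, so elements of `E` get unique codes, and each operation is
computed on term lists. -/
theorem IsRPSExtension.exists_isEffective [CharZero F] (hE : IsRPSExtension σ τ kind t)
    (hF : IsComputableDifferenceField σ) : ∃ _ : Primcodable E, IsEffective hE := by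
  classical
  obtain ⟨T, hT, hT'⟩ := hE.exists_eq_test hF
  -- Characteristic zero makes `F`, and hence `E`, infinite, as required for unique codes that
  -- exhaust `ℕ`.
  have : Infinite E := Infinite.of_injective _ hE.injective
  obtain ⟨inst, heval, s, hs, hs'⟩ := exists_primcodable_of_names (evalTerms (F := F) kind t)
    hE.evalTerms_surjective hT hT'
  have hb := hE.isMonomialBase
  have hadd : Computable₂ fun x y : E => x + y :=
    (heval.comp (Computable.list_append.comp (hs.comp Computable.fst)
      (hs.comp Computable.snd))).of_eq fun p => by rw [evalTerms_append, hs', hs']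
  have hmul : Computable₂ fun x y : E => x * y := by
    have h1 : Computable₂ fun (a : (E × E) × ((Fin e → ℤ) × F)) (q : (Fin e → ℤ) × F) =>
        (normalizeExp kind a.2.1 + normalizeExp kind q.1, a.2.2 * q.2) :=
      (computable_exp_add.comp
        (computable_normalizeExp.comp (Computable.fst.comp (Computable.snd.comp Computable.fst)))
        (computable_normalizeExp.comp (Computable.fst.comp Computable.snd))).pair
      (hF.mul.comp (Computable.snd.comp (Computable.snd.comp Computable.fst))
        (Computable.snd.comp Computable.snd))
    have h2 : Computable₂ fun (a : E × E) (p : (Fin e → ℤ) × F) =>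
        evalTerms kind t ((s a.2).map fun q =>
          (normalizeExp kind p.1 + normalizeExp kind q.1, p.2 * q.2)) :=
      heval.comp (Computable.list_map (hs.comp (Computable.snd.comp Computable.fst)) h1)
    refine (Computable.list_sum hadd
      (Computable.list_map (hs.comp Computable.fst) h2)).of_eq fun a => ?_
    simp only [evalTerms_mul hb, hs']
    rw [List.sum_map_mul_right]
    conv_rhs => rw [← hs' a.1]
    simp [evalTerms, mon, Algebra.smul_def]
  have halg : Computable (algebraMap F E) := by
    have h1 : Computable fun a : F => [((0 : Fin e → ℤ), a)] :=
      Computable.list_cons.comp ((Computable.const 0).pair Computable.id) (Computable.const [])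
    refine (heval.comp h1).of_eq fun a => ?_
    simp [evalTerms_cons, evalTerms_nil, Algebra.smul_def]
  have hgen : ∀ i, Computable fun j => genPow (t i) j (kind i) := fun i => by
    have h0 : Computable fun j : ℤ => (Pi.single i j : Fin e → ℤ) := by
      refine Computable.fin_pi fun k => ?_
      by_cases hk : k = i
      · subst hk; exact Computable.id.of_eq fun j => by simp
      · simpa [hk] using Computable.const (0 : ℤ)
    have h1 : Computable fun j : ℤ => [((Pi.single i j : Fin e → ℤ), (1 : F))] :=
      Computable.list_cons.comp (h0.pair (Computable.const 1)) (Computable.const [])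
    refine (heval.comp h1).of_eq fun j => ?_
    simp [evalTerms_cons, evalTerms_nil, mon_single]
  have haut : Computable fun x : E => τ x := by
    -- The finitely many elements `τ (t i)` and `τ (Ring.inverse (t i))` are constants of the
    -- algorithm.
    have h0 : ∀ i, Computable fun j : ℤ => τ (genPow (t i) j (kind i)) := by
      intro i
      have hp : ∀ a : E, Computable fun n : ℕ => a ^ n := Computable.pow_const hmul
      by_cases hk : kind i = MonomialKind.sigma
      · refine ((hp (τ (t i))).comp Computable.int_toNat).of_eq fun j => ?_
        rw [hk]; exact (map_pow τ (t i) j.toNat).symm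
      · refine (Computable.int_cases (g := fun _ n => τ (t i) ^ n)
          (h := fun _ n => τ (Ring.inverse (t i)) ^ (n + 1)) Computable.id
          ((hp _).comp Computable.snd)
          ((hp _).comp (Computable.succ.comp Computable.snd))).of_eq fun j => ?_
        have : genPow (t i) j (kind i) = zpowInv (t i) j := by
          rcases hk' : kind i with l | _ | _
          · rfl
          · rfl
          · exact absurd hk' hk
        rw [this]
        cases j with
        | ofNat n => exact (map_pow τ _ _).symm
        | negSucc n => exact (map_pow τ _ _).symm
    have h1 : Computable₂ fun (_ : E) (p : (Fin e → ℤ) × F) => algebraMap F E (σ p.2) *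
        ∏ i, τ (genPow (t i) (p.1 i) (kind i)) := by
      refine hmul.comp (halg.comp (hF.aut.comp (Computable.snd.comp Computable.snd))) ?_
      exact Computable.finset_prod hmul Finset.univ fun i =>
        (h0 i).comp ((Computable.fin_apply i).comp (Computable.fst.comp Computable.snd))
    refine (Computable.list_sum hadd (Computable.list_map hs h1)).of_eq fun x => ?_
    rw [← hE.map_evalTerms, hs']
  refine ⟨inst, heval, ⟨s, hs, hs'⟩, hadd, hmul, haut, halg, ?_, fun i => ?_, hgen, fun i => ?_⟩
  · refine ((computable_coeffTerms (kind := kind) hF).comp Computable.fst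
      (hs.comp Computable.snd)).of_eq fun p => ?_
    rw [← hE.coeff_evalTerms, hs']
  · have h1 : Computable₂ fun (a : ℤ × E) (p : (Fin e → ℤ) × F) =>
        decide (normalizeExp kind p.1 i = a.1) :=
      Computable.decide_eq ((Computable.fin_apply i).comp
        (computable_normalizeExp.comp (Computable.fst.comp Computable.snd)))
        (Computable.fst.comp Computable.fst)
    have h2 : Computable fun m : Fin e → ℤ => Function.update m i 0 := by
      refine Computable.fin_pi fun k => ?_
      by_cases hk : k = i
      · subst hk; simpa using Computable.const (0 : ℤ)
      · simpa [hk] using Computable.fin_apply k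
    have h3 : Computable₂ fun (_ : ℤ × E) (p : (Fin e → ℤ) × F) =>
        (Function.update (normalizeExp kind p.1) i 0, p.2) :=
      (h2.comp (computable_normalizeExp.comp (Computable.fst.comp Computable.snd))).pair
        (Computable.snd.comp Computable.snd)
    refine (heval.comp (Computable.list_map
      (Computable.list_filter (hs.comp Computable.snd) h1) h3)).of_eq fun a => ?_
    change _ = hE.coeffAt i a.1 a.2
    conv_rhs => rw [← hs' a.2, hE.coeffAt_evalTerms]
    rfl
  · refine ⟨fun x => ((s x).map fun p => (normalizeExp kind p.1 i).natAbs).sum, ?_, fun x => ?_⟩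
    · refine Computable.list_sum (Primrec.nat_add.to_comp) (Computable.list_map hs ?_)
      exact Computable.int_natAbs.comp ((Computable.fin_apply i).comp
        (computable_normalizeExp.comp (Computable.fst.comp Computable.snd)))
    · have := hE.degLE_evalTerms i (s x)
      rwa [hs'] at this

end Effective

/-! ### Linear relations over the constants -/

section Relations

theorem Computable.list_foldr {α β γ : Type*} [Primcodable α] [Primcodable β] [Primcodable γ]
    {f : α → List β} {h : β → γ → γ} (g : γ) (hf : Computable f) (hh : Computable₂ h) :
    Computable fun a => (f a).foldr h g := by
  refine (Computable.list_foldl (h := fun _ p => h p.2 p.1) (Computable.list_reverse.comp hf)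
    (Computable.const g)
    (hh.comp (Computable.snd.comp Computable.snd) (Computable.fst.comp Computable.snd))).of_eq
      fun a => ?_
  rw [List.foldl_reverse]

theorem Computable.nat_iterate {α : Type*} [Primcodable α] {f : α → α} (hf : Computable f) :
    Computable₂ fun (n : ℕ) a => f^[n] a := by
  refine (Computable.nat_rec (f := fun p : ℕ × α => p.1) (g := fun p => p.2)
    (h := fun _ q => f q.2) Computable.fst Computable.snd
    (hf.comp (Computable.snd.comp Computable.snd))).of_eq fun p => ?_
  dsimp only
  induction p.1 with
  | zero => rfl
  | succ n ih => rw [Function.iterate_succ_apply', ← ih]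

variable {E : Type*} [CommRing E] {K : Subring E}

/-- Passage from the relations between the reduced tail of a list to the relations between the
members of the list. -/
noncomputable def liftRelations (Q : E → E →ₗ[K] E) (l : List E) (B : List (List E × E)) :
    List (List E × E) :=
  open Classical in
  bif decide (l.getD 0 0 = 0) then (1 :: l.tail.map fun _ => 0, 0) :: B.map fun b => (0 :: b.1, b.2)
  else B.map fun b => (-1 * listDot b.1 (l.tail.map (Q (l.getD 0 0))) :: b.1, b.2)

/-- For the problem `⊥` the solution itself is `0`, and what remains are the linear relations
between the right-hand sides. A zero at the head has a free coefficient: it adds one basis vector,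
and the other relations are extended by `0`. -/
theorem isBasisList_bot_cons_zero {n : ℕ} {Y : Fin n → E} {B : List (List E × E)}
    (h : IsBasisList K B (linSol K (⊥ : Submodule K (E × E)) Y)) :
    IsBasisList K ((1 :: (List.ofFn Y).map fun _ => 0, 0) :: B.map fun b => (0 :: b.1, b.2))
      (linSol K (⊥ : Submodule K (E × E)) (Fin.cons 0 Y : Fin (n + 1) → E)) := by
  obtain ⟨r, v, rfl, hv, hvs⟩ := h
  let Λ : ((Fin n → E) × E) →ₗ[K] (Fin (n + 1) → E) × E :=
    { toFun := fun y => (Fin.cons 0 y.1, y.2)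
      map_add' := fun y z => by
        ext i
        · refine Fin.cases ?_ (fun i => ?_) i <;> simp
        · rfl
      map_smul' := fun a y => by
        ext i
        · refine Fin.cases ?_ (fun i => ?_) i <;> simp
        · rfl }
  let w₀ : (Fin (n + 1) → E) × E := (Fin.cons 1 0, 0)
  refine ⟨r + 1, Fin.cons w₀ fun j => Λ (v j), ?_, ?_, ?_⟩
  · simp [List.ofFn_succ, w₀, Λ, List.map_ofFn, Function.comp_def]
  · rw [linearIndependent_iff'] at hv
    rw [Fintype.linearIndependent_iff]
    intro κ hκ
    rw [Fin.sum_univ_succ] at hκ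
    simp only [Fin.cons_zero, Fin.cons_succ] at hκ
    have h1 : ∑ j : Fin r, κ j.succ • Λ (v j) = Λ (∑ j : Fin r, κ j.succ • v j) := by simp
    rw [h1] at hκ
    have key : ∀ y, κ 0 • w₀ + Λ y = 0 → κ 0 = 0 ∧ y = 0 := by
      intro y hy
      obtain ⟨h3, h4⟩ := Prod.ext_iff.1 hy
      refine ⟨?_, Prod.ext (funext fun i => ?_) ?_⟩
      · simpa [w₀, Λ, Subring.smul_def] using congrFun h3 0
      · simpa [w₀, Λ, Subring.smul_def] using congrFun h3 i.succ
      · simpa [w₀, Λ] using h4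
    obtain ⟨h0, h2⟩ := key _ hκ
    intro i
    refine Fin.cases h0 (fun i => ?_) i
    exact hv Finset.univ (fun j => κ j.succ) h2 i (Finset.mem_univ _)
  · ext ⟨c, x⟩
    rw [SetLike.mem_coe, Submodule.mem_span_range_iff_exists_fun]
    have hsum : ∀ κ : Fin (r + 1) → K,
        ∑ i, κ i • (Fin.cons w₀ fun j => Λ (v j) : Fin (r + 1) → (Fin (n + 1) → E) × E) i =
          κ 0 • w₀ + Λ (∑ j : Fin r, κ j.succ • v j) := by
      intro κ
      simp [Fin.sum_univ_succ]
    constructor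
    · rintro ⟨κ, hκ⟩
      rw [hsum] at hκ
      have := mem_linSol_of_mem_span hvs fun j => κ j.succ
      obtain ⟨h1, h2⟩ := this
      set y := ∑ j : Fin r, κ j.succ • v j
      rw [Submodule.mem_bot, Prod.mk_eq_zero] at h2
      rw [← hκ]
      refine ⟨fun i => ?_, ?_⟩
      · refine Fin.cases ?_ (fun i => ?_) i
        · simp [w₀, Λ, Subring.smul_def]
        · simpa [w₀, Λ, Subring.smul_def] using h1 i
      · rw [Submodule.mem_bot, Prod.mk_eq_zero]
        refine ⟨by simp [w₀, Λ, h2.1], ?_⟩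
        rw [Fin.sum_univ_succ]
        simpa [w₀, Λ, Subring.smul_def] using h2.2
    · rintro ⟨h1, h2⟩
      rw [Submodule.mem_bot, Prod.mk_eq_zero, Fin.sum_univ_succ] at h2
      dsimp only at h1 h2
      have : ((fun i : Fin n => c i.succ), x) ∈ Submodule.span K (Set.range v) := by
        rw [← SetLike.mem_coe, hvs]
        refine ⟨fun i => h1 _, ?_⟩
        rw [Submodule.mem_bot, Prod.mk_eq_zero]
        exact ⟨h2.1, by simpa using h2.2⟩
      rw [Submodule.mem_span_range_iff_exists_fun] at this
      obtain ⟨κ, hκ⟩ := this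
      refine ⟨Fin.cons ⟨c 0, h1 0⟩ κ, ?_⟩
      rw [hsum]
      simp only [Fin.cons_zero, Fin.cons_succ, hκ]
      ext i
      · refine Fin.cases ?_ (fun i => ?_) i <;> simp [w₀, Λ, Subring.smul_def]
      · simp [w₀, Λ]

/-- In a relation, the combination of the tail is a constant multiple of the head `f`. The map `R`
vanishes exactly on these multiples, so the tail has to be a relation between the `R (Y i)`, and `Q`
recovers the coefficient of `f`. -/
theorem isBasisList_bot_cons {n : ℕ} {f : E} {Y : Fin n → E} {Q R : E →ₗ[K] E}
    (hR : ∀ y, R y = 0 ↔ ∃ c ∈ K, c * f + y = 0)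
    (hQ : ∀ y, ∀ c ∈ K, c * f + y = 0 → c = -Q y) {B : List (List E × E)}
    (h : IsBasisList K B (linSol K (⊥ : Submodule K (E × E)) fun i => R (Y i))) :
    IsBasisList K (B.map fun b => (-1 * listDot b.1 ((List.ofFn Y).map Q) :: b.1, b.2))
      (linSol K (⊥ : Submodule K (E × E)) (Fin.cons f Y : Fin (n + 1) → E)) := by
  obtain ⟨r, v, rfl, hv, hvs⟩ := h
  have hlin : ∀ (T : E →ₗ[K] E) (c : Fin n → E), (∀ i, c i ∈ K) →
      ∑ i, c i * T (Y i) = T (∑ i, c i * Y i) := by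
    intro T c hc
    rw [map_sum]
    exact Finset.sum_congr rfl fun i _ => (T.map_smul ⟨c i, hc i⟩ (Y i)).symm
  let Λ : ((Fin n → E) × E) →ₗ[K] (Fin (n + 1) → E) × E :=
    { toFun := fun y => (Fin.cons (-1 * ∑ i, y.1 i * Q (Y i)) y.1, y.2)
      map_add' := fun y z => by
        ext i
        · refine Fin.cases ?_ (fun i => ?_) i
          · simp [add_mul, Finset.sum_add_distrib, add_comm]
          · simp
        · rfl
      map_smul' := fun a y => by
        ext i
        · refine Fin.cases ?_ (fun i => ?_) i
          · simp [Subring.smul_def, mul_assoc, Finset.mul_sum]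
          · simp
        · rfl }
  have hΛ : Function.Injective Λ := by
    intro y z h
    refine Prod.ext (funext fun i => ?_) ((Prod.ext_iff.1 h).2)
    simpa [Λ] using congrFun (Prod.ext_iff.1 h).1 i.succ
  refine ⟨r, fun j => Λ (v j), ?_, hv.map' Λ (LinearMap.ker_eq_bot.2 hΛ), ?_⟩
  · simp [Λ, List.map_ofFn, Function.comp_def, listDot_ofFn]
  · ext ⟨c, x⟩
    have hr : Set.range (fun j => Λ (v j)) = Λ '' Set.range v := by
      rw [← Set.range_comp]; rfl
    rw [SetLike.mem_coe, hr, Submodule.span_image, Submodule.mem_map]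
    simp only [← SetLike.mem_coe, hvs]
    constructor
    · rintro ⟨⟨c', x'⟩, ⟨h1, h2⟩, h3⟩
      dsimp only at h1 h2
      simp only [Submodule.mem_bot, Prod.mk_eq_zero] at h2
      rw [hlin R c' h1, hR] at h2
      obtain ⟨h2, c₀, hc₀, h4⟩ := h2
      have h5 := hQ _ c₀ hc₀ h4
      rw [← hlin Q c' h1, neg_eq_neg_one_mul] at h5
      rw [Prod.ext_iff] at h3
      obtain ⟨h3, h6⟩ := h3
      dsimp only [Λ, LinearMap.coe_mk, AddHom.coe_mk] at h3 h6
      rw [← h5] at h3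
      subst h3 h6
      refine ⟨fun i => Fin.cases hc₀ h1 i, ?_⟩
      · rw [Submodule.mem_bot, Prod.mk_eq_zero, Fin.sum_univ_succ]
        exact ⟨h2, by simpa using h4⟩
    · rintro ⟨h1, h2⟩
      rw [Submodule.mem_bot, Prod.mk_eq_zero, Fin.sum_univ_succ] at h2
      dsimp only at h1 h2
      have h3 : c 0 * f + ∑ i : Fin n, c i.succ * Y i = 0 := by simpa using h2.2
      refine ⟨(fun i => c i.succ, x), ⟨fun i => h1 _, ?_⟩, ?_⟩
      · simp only [Submodule.mem_bot, Prod.mk_eq_zero]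
        refine ⟨h2.1, ?_⟩
        rw [hlin R (fun i => c i.succ) fun i => h1 _, hR]
        exact ⟨c 0, h1 0, h3⟩
      · have h5 := hQ _ (c 0) (h1 0) h3
        rw [← hlin Q (fun i => c i.succ) (fun i => h1 _), neg_eq_neg_one_mul] at h5
        refine Prod.ext (funext fun i => ?_) rfl
        refine Fin.cases h5.symm (fun i => ?_) i
        simp [Λ]

variable [Primcodable E] {P : Type*} [Primcodable P]

/-- The linear relations over the constants can be computed by elimination. -/
theorem solvable_bot (hadd : Computable₂ fun x y : E => x + y)
    (hmul : Computable₂ fun x y : E => x * y) {Q R : E → E →ₗ[K] E}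
    (hQc : Computable₂ fun f x => Q f x) (hRc : Computable₂ fun f x => R f x)
    (hR₀ : ∀ y, R 0 y = y) (hR : ∀ f, f ≠ 0 → ∀ y, R f y = 0 ↔ ∃ c ∈ K, c * f + y = 0)
    (hQ : ∀ f, f ≠ 0 → ∀ y, ∀ c ∈ K, c * f + y = 0 → c = -Q f y) :
    Solvable K (fun _ : P => (⊥ : Submodule K (E × E))) (fun _ => True) (fun _ => ⊤) := by
  classical
  -- One elimination step drops the head and applies `R` to the tail.
  let red : List E → List E := fun l => l.tail.map (R (l.getD 0 0))
  have hhead : Computable fun l : List E => l.getD 0 0 :=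
    (Computable.list_getD 0).comp Computable.id (Computable.const 0)
  have htail : Computable fun l : List E => l.tail := Primrec.list_tail.to_comp
  have hred : Computable red := Computable.list_map htail
    (hRc.comp (hhead.comp Computable.fst) Computable.snd)
  have hlift : Computable₂ (liftRelations Q) := by
    have h1 : Computable fun p : List E × List (List E × E) => p.1.tail.map fun _ => (0 : E) :=
      Computable.list_map (htail.comp Computable.fst) (Computable.const _)
    have h2 : Computable₂ fun (_ : List E × List (List E × E)) (b : List E × E) =>
        ((0 : E) :: b.1, b.2) :=
      Computable.pair (Computable.list_cons.comp (Computable.const _)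
        (Computable.fst.comp Computable.snd)) (Computable.snd.comp Computable.snd)
    have h3 : Computable fun p : List E × List (List E × E) =>
        p.1.tail.map (Q (p.1.getD 0 0)) := by
      have : Computable₂ fun (p : List E × List (List E × E)) (x : E) => Q (p.1.getD 0 0) x :=
        hQc.comp (hhead.comp (Computable.fst.comp Computable.fst)) Computable.snd
      exact Computable.list_map (htail.comp Computable.fst) this
    have h4 : Computable₂ fun (p : List E × List (List E × E)) (b : List E × E) =>
        (-1 * listDot b.1 (p.1.tail.map (Q (p.1.getD 0 0))) :: b.1, b.2) :=
      Computable.pair (Computable.list_cons.comp (hmul.comp (Computable.const _)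
        ((computable_listDot hadd hmul).comp (Computable.fst.comp Computable.snd)
          (h3.comp Computable.fst))) (Computable.fst.comp Computable.snd))
        (Computable.snd.comp Computable.snd)
    exact Computable.cond (Computable.decide_eq (hhead.comp Computable.fst) (Computable.const 0))
      (Computable.list_cons.comp (Computable.pair (Computable.list_cons.comp (Computable.const _)
        h1) (Computable.const _)) (Computable.list_map Computable.snd h2))
      (Computable.list_map Computable.snd h4)
  -- The successive reduced lists are computed first; the relations are then lifted back from the
  -- empty list, which has none.
  let alg : List E → List (List E × E) := fun l =>
    ((List.range l.length).map fun j => red^[j] l).foldr (liftRelations Q) []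
  have halg : Computable alg := by
    have h1 : Computable₂ fun (l : List E) (j : ℕ) => red^[j] l :=
      (Computable.nat_iterate hred).comp Computable.snd Computable.fst
    exact Computable.list_foldr [] (Computable.list_map
      (Primrec.list_range.to_comp.comp Computable.list_length) h1) hlift
  refine ⟨fun a => Part.some (alg a.2), Computable.partrec (halg.comp Computable.snd), ?_⟩
  rintro p - n Y -
  refine ⟨_, Part.mem_some _, ?_⟩
  dsimp only
  induction n with
  | zero =>
    refine ⟨0, Fin.elim0, by simp [alg], linearIndependent_empty_type, ?_⟩
    ext ⟨c, x⟩
    have : c = 0 := Subsingleton.elim _ _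
    subst this
    simp [linSol]
  | succ n ih =>
    obtain ⟨f, Y, rfl⟩ : ∃ f Y', Y = (Fin.cons f Y' : Fin (n + 1) → E) :=
      ⟨Y 0, fun i => Y i.succ, (Fin.cons_self_tail Y).symm⟩
    have h1 : alg (List.ofFn (Fin.cons f Y : Fin (n + 1) → E)) =
        liftRelations Q (f :: List.ofFn Y) (alg (List.ofFn fun i => R f (Y i))) := by
      have h2 : red (f :: List.ofFn Y) = List.ofFn fun i => R f (Y i) := by
        simp [red, List.map_ofFn, Function.comp_def]
      simp only [alg, List.ofFn_cons, List.length_cons, List.length_ofFn, List.range_succ_eq_map,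
        List.map_cons, List.foldr_cons, List.map_map, Function.comp_def,
        Function.iterate_succ_apply, h2, Function.iterate_zero, id_eq]
    rw [h1]
    have := ih fun i => R f (Y i)
    by_cases hf : f = 0
    · subst hf
      simp only [hR₀] at this ⊢
      simpa [liftRelations] using isBasisList_bot_cons_zero this
    · simpa [liftRelations, hf] using isBasisList_bot_cons (hR f hf) (hQ f hf) this

end Relations

/-! ### Parametrized equations over the subring generated by the R-monomials -/

section ConstantLinear

variable {F E : Type*} [Field F] [CommRing E] [Algebra F E] {σ : RingAut F} {τ : RingAut E} {e : ℕ}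
variable {kind : Fin e → MonomialKind} {t : Fin e → E} (hE : IsRPSExtension σ τ kind t)

/-- The automorphism is linear over the constants. -/
def autLin {E : Type*} [CommRing E] (τ : RingAut E) : E →ₗ[constRing τ] E where
  toFun := τ
  map_add' := map_add τ
  map_smul' c x := by
    have : τ (c : E) = c := c.2
    simp [Subring.smul_def, this]

@[simp] theorem autLin_apply {E : Type*} [CommRing E] (τ : RingAut E) (x : E) :
    autLin τ x = τ x := rfl

include hE in
theorem IsRPSExtension.exists_const_smul (c : constRing τ) :
    ∃ a : F, σ a = a ∧ (c : E) = algebraMap F E a ∧ ∀ x : E, c • x = a • x := by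
  obtain ⟨a, h1, h2⟩ := hE.const_mem c.2
  exact ⟨a, h1, h2, fun x => by rw [Subring.smul_def, h2, algebraMap_smul]⟩

include hE in
theorem IsRPSExtension.algebraMap_mem_constRing {a : F} (h : σ a = a) :
    algebraMap F E a ∈ constRing τ := by
  change τ _ = _
  rw [hE.extends_aut, h]
  rfl

/-- A linear map over `F` is linear over the constants. -/
def IsRPSExtension.constLin (f : E →ₗ[F] E) : E →ₗ[constRing τ] E where
  toFun := f
  map_add' := map_add f
  map_smul' c x := by
    obtain ⟨a, -, -, h⟩ := hE.exists_const_smul c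
    rw [h, map_smul, RingHom.id_apply, h]

@[simp] theorem IsRPSExtension.constLin_apply (f : E →ₗ[F] E) (x : E) :
    hE.constLin f x = f x := rfl

/-- A subalgebra over `F` is a submodule over the constants. -/
def IsRPSExtension.constSub (A : Subalgebra F E) : Submodule (constRing τ) E where
  carrier := A
  add_mem' := A.add_mem
  zero_mem' := A.zero_mem
  smul_mem' c x hx := by
    obtain ⟨a, -, -, h⟩ := hE.exists_const_smul c
    rw [h]
    exact A.smul_mem hx a

@[simp] theorem IsRPSExtension.mem_constSub {A : Subalgebra F E} {x : E} :
    x ∈ hE.constSub A ↔ x ∈ A := Iff.rfl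

/-- The coefficients of the monomials as elements of the extension. -/
noncomputable def IsRPSExtension.coeffE (m : Fin e → ℤ) : E →ₗ[F] E :=
  (Algebra.linearMap F E).comp (hE.coeff m)

@[simp] theorem IsRPSExtension.coeffE_apply (m : Fin e → ℤ) (x : E) :
    hE.coeffE m x = algebraMap F E (hE.coeff m x) := rfl

variable [Primcodable F] [Primcodable E]

theorem IsEffective.neg {hE : IsRPSExtension σ τ kind t} (hI : IsEffective hE) :
    Computable fun x : E => -x :=
  (hI.mul.comp (Computable.const (-1)) Computable.id).of_eq fun x => by simp

theorem IsEffective.sub {hE : IsRPSExtension σ τ kind t} (hI : IsEffective hE) :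
    Computable₂ fun x y : E => x - y :=
  (hI.add.comp Computable.fst (hI.neg.comp Computable.snd)).of_eq fun _ => (sub_eq_add_neg _ _).symm

theorem IsEffective.monomial {hE : IsRPSExtension σ τ kind t} (hI : IsEffective hE) :
    Computable fun m => mon kind t m :=
  Computable.finset_prod hI.mul Finset.univ fun i => (hI.pow i).comp (Computable.fin_apply i)

theorem IsEffective.exists_lead {hE : IsRPSExtension σ τ kind t} (hI : IsEffective hE) :
    ∃ lead : E → Fin e → ℤ, Computable lead ∧ ∀ x, x ≠ 0 → hE.coeff (lead x) x ≠ 0 := by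
  classical
  have h1 : Computable₂ fun (x : E) (m : Fin e → ℤ) =>
      (bif decide (x = 0) then true else !decide (hE.coeff m x = 0)) :=
    Computable.cond (Computable.decide_eq Computable.fst (Computable.const 0))
      (Computable.const true) (Primrec.not.to_comp.comp (Computable.decide_eq
        (hI.coeff.comp Computable.snd Computable.fst) (Computable.const 0)))
  obtain ⟨f, hf, hf'⟩ := Computable.exists_choice h1 fun x => by
    by_cases hx : x = 0
    · exact ⟨0, by simp [hx]⟩
    · by_contra! h
      refine hx (hE.ext fun m _ => ?_)
      simpa [hx] using h m
  refine ⟨f, hf, fun x hx => ?_⟩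
  simpa [hx] using hf' x

/-- Linear relations over the constants can be computed. -/
theorem IsEffective.solvable_bot {hE : IsRPSExtension σ τ kind t} (hI : IsEffective hE)
    (hF : IsComputableDifferenceField σ) (P : Type*) [Primcodable P] :
    Solvable (constRing τ) (fun _ : P => (⊥ : Submodule (constRing τ) (E × E))) (fun _ => True)
      (fun _ => ⊤) := by
  classical
  obtain ⟨lead, hlead, hl⟩ := hI.exists_lead
  let q : E → E →ₗ[F] E := fun f => (hE.coeff (lead f) f)⁻¹ • hE.coeffE (lead f)
  let Q : E → E →ₗ[constRing τ] E := fun f => hE.constLin (q f)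
  -- Let `b` be the quotient of the coefficients of `y` and `f` at `lead f`. The difference `y - b
  -- f` has no coefficient there, so this place is used to record `σ b - b`. Hence `R f y = 0` means
  -- both that `b` is constant and that `y = b f`.
  let R : E → E →ₗ[constRing τ] E := fun f => LinearMap.id -
    (LinearMap.mulRight (constRing τ) f).comp (Q f) +
    (LinearMap.mulRight (constRing τ) (mon kind t (lead f))).comp ((autLin τ).comp (Q f) - Q f)
  have hQ' : ∀ f y, Q f y = algebraMap F E ((hE.coeff (lead f) f)⁻¹ * hE.coeff (lead f) y) := by
    intro f y
    simp [Q, q, Algebra.smul_def]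
  have hR' : ∀ f y, R f y = y - Q f y * f + (τ (Q f y) - Q f y) * mon kind t (lead f) :=
    fun f y => rfl
  have hQc : Computable₂ fun f y => Q f y := by
    have h1 : Computable fun p : E × E => hE.coeff (lead p.1) p.1 :=
      hI.coeff.comp (hlead.comp Computable.fst) Computable.fst
    have h2 : Computable fun p : E × E => hE.coeff (lead p.1) p.2 :=
      hI.coeff.comp (hlead.comp Computable.fst) Computable.snd
    have h3 : Computable fun p : E × E =>
        algebraMap F E ((hE.coeff (lead p.1) p.1)⁻¹ * hE.coeff (lead p.1) p.2) :=
      hI.base.comp (hF.mul.comp (hF.inv.comp h1) h2)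
    exact h3.of_eq fun p => (hQ' _ _).symm
  have hRc : Computable₂ fun f y => R f y := by
    have h3 : Computable fun p : E × E =>
        p.2 - Q p.1 p.2 * p.1 + (τ (Q p.1 p.2) - Q p.1 p.2) * mon kind t (lead p.1) :=
      hI.add.comp (hI.sub.comp Computable.snd (hI.mul.comp hQc Computable.fst))
        (hI.mul.comp (hI.sub.comp (hI.aut.comp hQc) hQc)
          (hI.monomial.comp (hlead.comp Computable.fst)))
    exact h3.of_eq fun p => (hR' _ _).symm
  have hQ : ∀ f, f ≠ 0 → ∀ y, ∀ c ∈ constRing τ, c * f + y = 0 → c = -Q f y := by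
    intro f hf y c hc h
    obtain ⟨a, -, rfl⟩ := hE.const_mem hc
    have h2 := congrArg (hE.coeff (lead f)) h
    rw [map_add, ← Algebra.smul_def, map_smul, map_zero, smul_eq_mul] at h2
    rw [hQ', ← map_neg]
    congr 1
    have := hl f hf
    field_simp
    linear_combination h2
  refine _root_.solvable_bot hI.add hI.mul hQc hRc ?_ ?_ hQ
  -- For `f = 0` the coefficient of `f` is `0` with inverse `0`, so `Q 0 = 0` and `R 0` is the
  -- identity.
  · intro y
    simp [hR', hQ']
  · intro f hf y
    constructor
    · intro h
      have hnorm : lead f ∈ normalExps kind (Set.univ : Set (Fin e)) := by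
        by_contra h'
        exact hl f hf (hE.coeff_of_not_mem h' f)
      have h0 := hl f hf
      have h2 := congrArg (hE.coeff (lead f)) h
      rw [hR', hQ', hE.extends_aut, ← map_sub, ← Algebra.smul_def, ← Algebra.smul_def, map_add,
        map_sub, map_smul, map_smul, hE.coeff_mon hnorm, if_pos rfl, map_zero, smul_eq_mul,
        smul_eq_mul] at h2
      set b := (hE.coeff (lead f) f)⁻¹ * hE.coeff (lead f) y with hb
      have h3 : b * hE.coeff (lead f) f = hE.coeff (lead f) y := by rw [hb]; field_simp
      have h4 : σ b = b := by linear_combination h2 + h3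
      refine ⟨-Q f y, ?_, ?_⟩
      · rw [hQ']
        exact neg_mem (hE.algebraMap_mem_constRing h4)
      · rw [hR', hQ', ← hb, hE.extends_aut, h4] at h
        rw [hQ', ← hb]
        linear_combination h
    · rintro ⟨c, hc, h⟩
      have h2 := hQ f hf y c hc h
      have h3 : Q f y = -c := by rw [h2, neg_neg]
      have h4 : τ c = c := hc
      rw [hR', h3, map_neg, h4]
      linear_combination h

/-- Restriction of a linear problem by a linear condition. -/
theorem IsEffective.solvable_restrict {hE : IsRPSExtension σ τ kind t} (hI : IsEffective hE)
    (hF : IsComputableDifferenceField σ) {P : Type*} [Primcodable P]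
    {S S₁ : P → Submodule (constRing τ) (E × E)} {valid : P → Prop}
    {dom dom₁ : P → Submodule (constRing τ) E} (h₁ : Solvable (constRing τ) S₁ valid dom₁)
    {ρ : P → E →ₗ[constRing τ] E} (hρ : Computable₂ fun p x => ρ p x)
    {δ : P → E × E →ₗ[constRing τ] E} (hδ : Computable₂ fun p x => δ p x)
    (hdom : ∀ p, valid p → ∀ z ∈ dom p, ρ p z ∈ dom₁ p)
    (hS : ∀ p, valid p → ∀ z ∈ dom p, ∀ x, (x, z) ∈ S p ↔ (x, ρ p z) ∈ S₁ p ∧ δ p (x, z) = 0) :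
    Solvable (constRing τ) S valid dom := by
  -- The condition is imposed by composition with the problem `⊥`: the second solution is `0`, and
  -- its right-hand side `δ` is forced to vanish.
  refine Solvable.compose hI.add hI.mul h₁ (hI.solvable_bot hF P) (q := id) Computable.id hρ
    (μ := fun _ => 0) (Computable.const 0) hδ (fun p hp => hp) (fun _ _ => trivial) hdom
    (fun _ _ _ _ _ _ => trivial) ?_ ?_
  · intro p hp z hz x
    rw [hS p hp z hz]
    simp only [LinearMap.zero_apply, add_zero, Submodule.mem_bot, Prod.mk_eq_zero]
    constructor
    · rintro ⟨h1, h2⟩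
      exact ⟨x, 0, rfl, h1, rfl, h2⟩
    · rintro ⟨x₁, x₂, rfl, h1, -, h2⟩
      exact ⟨h1, h2⟩
  · intro p hp x₁ x₂ _ h2 h
    rw [Submodule.mem_bot, Prod.mk_eq_zero] at h2
    exact ⟨by simpa using h, h2.1⟩

end ConstantLinear

/-! ### Equations in the ground field, coefficient by coefficient -/

section RootLevel

variable {F E : Type*} [Field F] [CommRing E] [Algebra F E] {σ : RingAut F} {τ : RingAut E} {e : ℕ}
variable {kind : Fin e → MonomialKind} {t : Fin e → E} (hE : IsRPSExtension σ τ kind t)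

/-- The equation `ρ x - u x = z` in `F`, as a linear problem in the extension. -/
noncomputable def IsRPSExtension.baseSol (ρ : RingAut F) (hρ : ∀ a, σ a = a → ρ a = a) (u : F) :
    Submodule (constRing τ) (E × E) where
  carrier := {y | ∃ x z : F, y = (algebraMap F E x, algebraMap F E z) ∧ ρ x - u * x = z}
  add_mem' := by
    rintro _ _ ⟨x, z, rfl, h⟩ ⟨x', z', rfl, h'⟩
    refine ⟨x + x', z + z', by simp, ?_⟩
    rw [map_add]
    linear_combination h + h'
  zero_mem' := ⟨0, 0, by simp; rfl, by simp⟩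
  smul_mem' := by
    rintro c _ ⟨x, z, rfl, h⟩
    obtain ⟨a, ha, -, hs⟩ := hE.exists_const_smul c
    refine ⟨a * x, a * z, ?_, ?_⟩
    · rw [Prod.smul_mk, hs, hs, Algebra.smul_def, Algebra.smul_def, map_mul, map_mul]
    · rw [map_mul, hρ a ha]
      linear_combination a * h

/-- The elements of `F` as a submodule over the constants. -/
noncomputable def IsRPSExtension.baseDom : Submodule (constRing τ) E :=
  hE.constSub (⊥ : Subalgebra F E)

theorem exists_ofFn_basis {F : Type*} [Field F] [Primcodable F] {ρ : RingAut F} {u : F}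
    {f : List F} {alg : F × List F →. List (List F × F)}
    (h : ∃ B ∈ alg (u, f), ∃ v : Fin B.length → (Fin f.length → F) × F,
        (∀ j, (B.get j).1.map id = List.ofFn (v j).1 ∧ id (B.get j).2 = (v j).2) ∧
        LinearIndependent (constRing ρ) v ∧
        (Submodule.span (constRing ρ) (Set.range v) : Set ((Fin f.length → F) × F)) =
          solutionSet ρ u (fun i => f.get i)) {n : ℕ} {y : Fin n → F} (hy : f = List.ofFn y) :
    ∃ (r : ℕ) (v : Fin r → (Fin n → F) × F),
      (List.ofFn fun j => (List.ofFn (v j).1, (v j).2)) ∈ alg (u, List.ofFn y) ∧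
      LinearIndependent (constRing ρ) v ∧
      (Submodule.span (constRing ρ) (Set.range v) : Set ((Fin n → F) × F)) = solutionSet ρ u y := by
  obtain rfl : f.length = n := by simp [hy]
  obtain rfl : y = f.get := by
    apply List.ofFn_injective
    rw [List.ofFn_get, ← hy]
  rw [← hy]
  obtain ⟨B, hB, v, h1, h2, h3⟩ := h
  refine ⟨B.length, v, ?_, h2, h3⟩
  convert hB using 1
  refine Eq.trans (congrArg List.ofFn (funext fun j => ?_)) (List.ofFn_get B)
  exact Prod.ext ((h1 j).1.symm.trans (List.map_id _)) (h1 j).2.symm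

variable [Primcodable F] [Primcodable E]

/-- A solver in `F` yields one in the extension. -/
theorem IsEffective.solvable_base {hE : IsRPSExtension σ τ kind t} (hI : IsEffective hE)
    {ρ : RingAut F} (hρ : ∀ a, σ a = a → ρ a = a) (hc : constRing ρ = constRing σ)
    (h : PFLDESolvable (id : F → F) ρ (unitSet F)) :
    Solvable (constRing τ) (hE.baseSol ρ hρ) (fun u => u ≠ 0) (fun _ => hE.baseDom) := by
  obtain ⟨-, -, alg, halg, h⟩ := h
  have h0 : Computable fun x : E => hE.coeff 0 x := hI.coeff.comp (Computable.const 0) Computable.id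
  have h0' : ∀ a : F, hE.coeff 0 (algebraMap F E a) = a := by
    classical
    intro a
    have h1 : (0 : Fin e → ℤ) ∈ normalExps kind (Set.univ : Set (Fin e)) :=
      ⟨fun i => isNormalExp_zero (hE.isMonomialBase i), fun _ _ => rfl⟩
    rw [Algebra.algebraMap_eq_smul_one, map_smul, ← mon_zero (kind := kind) (t := t),
      hE.coeff_mon h1]
    simp
  have hout : Computable fun B : List (List F × F) =>
      B.map fun b => (b.1.map (algebraMap F E), algebraMap F E b.2) := by
    have h1 : Computable₂ fun (_ : List (List F × F) × (List F × F)) (b : F) => algebraMap F E b :=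
      hI.base.comp Computable.snd
    have h2 : Computable₂ fun (_ : List (List F × F)) (b : List F × F) =>
        (b.1.map (algebraMap F E), algebraMap F E b.2) :=
      Computable.pair (Computable.list_map (Computable.fst.comp Computable.snd) h1)
        (hI.base.comp (Computable.snd.comp Computable.snd))
    exact Computable.list_map Computable.id h2
  have hin : Computable fun a : F × List E => (a.1, a.2.map fun x => hE.coeff 0 x) := by
    have h1 : Computable₂ fun (_ : F × List E) (x : E) => hE.coeff 0 x := h0.comp Computable.snd
    exact Computable.fst.pair (Computable.list_map Computable.snd h1)
  refine ⟨fun a => (alg (a.1, a.2.map fun x => hE.coeff 0 x)).map fun B =>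
    B.map fun b => (b.1.map (algebraMap F E), algebraMap F E b.2), ?_, ?_⟩
  · exact Partrec.map (halg.comp hin) (hout.comp Computable.snd)
  · intro u hu n Y hY
    have hY' : ∀ i, ∃ a, algebraMap F E a = Y i := fun i => Algebra.mem_bot.1 (hY i)
    choose y hy using hY'
    have hY0 : (List.ofFn Y).map (fun x => hE.coeff 0 x) = List.ofFn y := by
      rw [List.map_ofFn]
      congr 1
      ext i
      rw [Function.comp_apply, ← hy, h0']
    obtain ⟨r, v, hB, hv, hvs⟩ := exists_ofFn_basis (h u (List.ofFn y) (isUnit_iff_ne_zero.2 hu))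
      rfl
    -- The constants for `ρ` are those for `σ`, and their images in `E` are all constants of `E`. So
    -- the vectors found in `F` remain a basis in the extension.
    rw [hc] at hv hvs
    have hc' : ∀ x ∈ constRing ρ, σ x = x := fun x hx => by rw [hc] at hx; exact hx
    let Λ : (Fin n → F) × F → (Fin n → E) × E := fun p =>
      (fun i => algebraMap F E (p.1 i), algebraMap F E p.2)
    have hΛ : ∀ (κ : Fin r → constRing τ) (a : Fin r → constRing σ),
        (∀ j, (κ j : E) = algebraMap F E (a j)) → ∑ j, κ j • Λ (v j) = Λ (∑ j, a j • v j) := by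
      intro κ a h
      ext
      · simp only [Λ, Prod.fst_sum, Prod.smul_fst, Subring.smul_def, h, Finset.sum_apply, Pi.smul_apply,
          smul_eq_mul, map_sum, map_mul]
      · simp [Λ, Prod.snd_sum, Subring.smul_def, h]
    refine ⟨_, Part.mem_map _ (by simpa only [hY0] using hB), r, fun j => Λ (v j), ?_, ?_, ?_⟩
    · simp [List.map_ofFn, Function.comp_def, Λ]
    · rw [Fintype.linearIndependent_iff] at hv ⊢
      intro κ hκ
      choose a ha1 ha2 _ using fun j => hE.exists_const_smul (κ j)
      rw [hΛ κ (fun j => ⟨a j, ha1 j⟩) ha2] at hκ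
      have : ∑ j, (⟨a j, ha1 j⟩ : constRing σ) • v j = 0 := by
        refine Prod.ext (funext fun i => ?_) ?_
        · exact hE.injective ((congrFun (Prod.ext_iff.1 hκ).1 i).trans (map_zero _).symm)
        · exact hE.injective ((Prod.ext_iff.1 hκ).2.trans (map_zero _).symm)
      intro j
      have h3 : a j = 0 := congrArg Subtype.val (hv _ this j)
      apply Subtype.ext
      rw [ha2, h3, map_zero]
      rfl
    · ext ⟨c, x⟩
      rw [SetLike.mem_coe, Submodule.mem_span_range_iff_exists_fun]
      constructor
      · rintro ⟨κ, hκ⟩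
        choose a ha1 ha2 _ using fun j => hE.exists_const_smul (κ j)
        rw [hΛ κ (fun j => ⟨a j, ha1 j⟩) ha2] at hκ
        have hmem : ∑ j, (⟨a j, ha1 j⟩ : constRing σ) • v j ∈
            Submodule.span (constRing σ) (Set.range v) :=
          Submodule.sum_mem _ fun j _ => Submodule.smul_mem _ _ (Submodule.subset_span ⟨j, rfl⟩)
        rw [← SetLike.mem_coe, hvs] at hmem
        obtain ⟨h1, h2⟩ := hmem
        rw [← hκ]
        refine ⟨fun i => hE.algebraMap_mem_constRing (hc' _ (h1 i)), _, _,
          Prod.ext rfl ?_, h2⟩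
        simp [Λ, ← hy]
      · rintro ⟨h1, x₀, z₀, h2, h3⟩
        rw [Prod.mk.injEq] at h2
        choose a ha1 ha2 using fun i => hE.const_mem (h1 i)
        have hmem : (a, x₀) ∈ Submodule.span (constRing σ) (Set.range v) := by
          rw [← SetLike.mem_coe, hvs]
          refine ⟨fun i => ?_, ?_⟩
          · rw [hc]; exact ha1 i
          · rw [h3]
            apply hE.injective
            rw [← h2.2]
            simp [← hy, ← ha2]
        rw [Submodule.mem_span_range_iff_exists_fun] at hmem
        obtain ⟨κ, hκ⟩ := hmem
        refine ⟨fun j => ⟨_, hE.algebraMap_mem_constRing (κ j).2⟩, ?_⟩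
        rw [hΛ _ κ fun _ => rfl, hκ]
        exact Prod.ext (funext fun i => (ha2 i).symm) h2.1.symm

variable (S : Finset (Fin e → ℤ))

/-- The equations for the coefficients of the monomials in `S`. -/
noncomputable def IsRPSExtension.coordSol (ρ : RingAut F) (hρ : ∀ a, σ a = a → ρ a = a)
    (S : Finset (Fin e → ℤ)) (u : F) : Submodule (constRing τ) (E × E) where
  carrier := {y | (∀ m ∉ S, hE.coeff m y.1 = 0) ∧
    ∀ m ∈ S, ρ (hE.coeff m y.1) - u * hE.coeff m y.1 = hE.coeff m y.2}
  add_mem' := by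
    rintro x y ⟨h1, h2⟩ ⟨h3, h4⟩
    refine ⟨fun m hm => ?_, fun m hm => ?_⟩
    · rw [Prod.fst_add, map_add, h1 m hm, h3 m hm, add_zero]
    · rw [Prod.fst_add, Prod.snd_add, map_add, map_add, map_add]
      linear_combination h2 m hm + h4 m hm
  zero_mem' := by simp
  smul_mem' := by
    rintro c x ⟨h1, h2⟩
    obtain ⟨a, ha, -, hs⟩ := hE.exists_const_smul c
    refine ⟨fun m hm => ?_, fun m hm => ?_⟩
    · rw [Prod.smul_fst, hs, map_smul, h1 m hm, smul_zero]
    · rw [Prod.smul_fst, Prod.smul_snd, hs, hs, (hE.coeff m).map_smul, (hE.coeff m).map_smul,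
        smul_eq_mul, smul_eq_mul, map_mul, hρ a ha]
      linear_combination a * h2 m hm

/-- The equations for different monomials are tied together only by the constants `cᵢ`, so they are
solved one after the other by composition, each with the solver of the ground field. -/
theorem IsEffective.solvable_coord {hE : IsRPSExtension σ τ kind t} (hI : IsEffective hE)
    {ρ : RingAut F} (hρ : ∀ a, σ a = a → ρ a = a)
    (h : Solvable (constRing τ) (hE.baseSol ρ hρ) (fun u => u ≠ 0) (fun _ => hE.baseDom))
    (S : Finset (Fin e → ℤ)) (hS : ∀ m ∈ S, m ∈ normalExps kind (Set.univ : Set (Fin e))) :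
    Solvable (constRing τ) (hE.coordSol ρ hρ S) (fun u => u ≠ 0) (fun _ => ⊤) := by
  classical
  induction S using Finset.induction_on with
  | empty =>
    refine Solvable.of_graph (R := fun _ => 0)
      (show Computable₂ fun (_ : F) (_ : E) => (0 : E) from Computable.const 0) fun u _ z _ x => ?_
    rw [LinearMap.zero_apply]
    constructor
    · rintro ⟨h, -⟩
      exact hE.ext fun m _ => (h m (by simp)).trans (map_zero _).symm
    · rintro rfl
      exact ⟨by simp, by simp⟩
  | insert ν S hν ih =>
    have hn := hS ν (Finset.mem_insert_self _ _)
    have hcoeff : ∀ (x₂ : F) m, hE.coeff m (algebraMap F E x₂ * mon kind t ν) =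
        if m = ν then x₂ else 0 := by
      intro x₂ m
      rw [← Algebra.smul_def, map_smul, hE.coeff_mon hn]
      split_ifs <;> simp
    refine Solvable.compose hI.add hI.mul (ih fun m hm => hS m (Finset.mem_insert_of_mem hm)) h
      (q := id) Computable.id (ρ := fun _ => LinearMap.id) Computable.snd
      (μ := fun _ => LinearMap.mulRight (constRing τ) (mon kind t ν))
      (hI.mul.comp Computable.snd (Computable.const _))
      (δ := fun _ => (hE.constLin (hE.coeffE ν)).comp (LinearMap.snd _ _ _))
      (hI.base.comp (hI.coeff.comp (Computable.const ν) (Computable.snd.comp Computable.snd)))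
      (fun _ h => h) (fun _ h => h) (fun _ _ _ _ => trivial)
      (fun _ _ _ _ _ _ => Algebra.mem_bot.2 ⟨_, rfl⟩) ?_ ?_
    · intro u hu z _ x
      constructor
      · rintro ⟨h1, h2⟩
        dsimp only at h1 h2
        refine ⟨x - algebraMap F E (hE.coeff ν x) * mon kind t ν, algebraMap F E (hE.coeff ν x),
          by simp, ⟨fun m hm => ?_, fun m hm => ?_⟩, ?_⟩
        · rw [map_sub, hcoeff]
          by_cases hmν : m = ν
          · subst hmν; simp
          · rw [if_neg hmν, sub_zero]
            exact h1 m (by simp [hmν, hm])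
        · have hmν : m ≠ ν := by rintro rfl; exact hν hm
          rw [map_sub, hcoeff, if_neg hmν, sub_zero]
          exact h2 m (Finset.mem_insert_of_mem hm)
        · exact ⟨_, _, rfl, h2 ν (Finset.mem_insert_self _ _)⟩
      · rintro ⟨x₁, x₂, rfl, ⟨h1, h2⟩, x₀, z₀, h3, h4⟩
        rw [Prod.mk.injEq] at h3
        obtain ⟨rfl, h3⟩ := h3
        have h3 := hE.injective h3
        dsimp only [LinearMap.snd_apply, LinearMap.mulRight_apply, LinearMap.id_apply] at h1 h2 h3 ⊢
        refine ⟨fun m hm => ?_, fun m hm => ?_⟩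
        · rw [Finset.mem_insert, not_or] at hm
          simp only [map_add, hcoeff, if_neg hm.1, h1 m hm.2, add_zero]
        · rw [Finset.mem_insert] at hm
          by_cases hmν : m = ν
          · subst hmν
            simp only [map_add, hcoeff, if_true, h1 m hν, zero_add]
            exact h4.trans h3.symm
          · simp only [map_add, hcoeff, if_neg hmν, add_zero]
            exact h2 m (hm.resolve_left hmν)
    · rintro u hu x₁ x₂ ⟨h1, h2⟩ ⟨x₀, z₀, h3, h4⟩ h5
      rw [Prod.mk.injEq] at h3
      obtain ⟨rfl, h3⟩ := h3
      have h6 := congrArg (hE.coeff ν) h5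
      simp only [LinearMap.mulRight_apply, map_add, hcoeff, if_true, map_zero, h1 ν hν,
        zero_add] at h6
      subst h6
      refine ⟨?_, map_zero _⟩
      simpa using h5

/-- The equation `τ x - u x = z` with a solution `x` in the subring generated by the monomials in
`S`. -/
def IsRPSExtension.pfldeSol (hE : IsRPSExtension σ τ kind t) (S : Set (Fin e)) (u : E) :
    Submodule (constRing τ) (E × E) where
  carrier := {y | y.1 ∈ monAlg F kind t S ∧ τ y.1 - u * y.1 = y.2}
  add_mem' := by
    rintro x y ⟨h1, h2⟩ ⟨h3, h4⟩
    refine ⟨add_mem h1 h3, ?_⟩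
    rw [Prod.fst_add, Prod.snd_add, map_add]
    linear_combination h2 + h4
  zero_mem' := ⟨zero_mem _, by simp⟩
  smul_mem' := by
    rintro c x ⟨h1, h2⟩
    refine ⟨(hE.constSub (monAlg F kind t S)).smul_mem c h1, ?_⟩
    have : τ (c : E) = c := c.2
    rw [Prod.smul_fst, Prod.smul_snd, Subring.smul_def, Subring.smul_def, smul_eq_mul, smul_eq_mul,
      map_mul, this]
    linear_combination (c : E) * h2

end RootLevel

/-! ### Passage to a power of the automorphism -/

section PowerEquation

variable {E : Type*} [CommRing E]

/-- The right-hand side of the equation for the `k`-th power of the automorphism. -/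
def iterRhs (τ : RingAut E) (u : E) : ℕ → E →ₗ[constRing τ] E
  | 0 => 0
  | k + 1 => LinearMap.mulLeft _ (τ (iterProd τ u k)) + (autLin τ).comp (iterRhs τ u k)

/-- The operator `τ ^ k - N`, with `N` the norm of `u` of length `k`, factors through `τ - u`. So a
solution of the given equation also solves an equation for `τ ^ k`. -/
theorem pow_sub_iterProd (τ : RingAut E) (u : E) (k : ℕ) (x : E) :
    (τ ^ k) x - iterProd τ u k * x = iterRhs τ u k (τ x - u * x) := by
  induction k with
  | zero => simp [iterRhs, iterProd]
  | succ k ih =>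
    have : (τ ^ (k + 1)) x = τ ((τ ^ k) x) := by rw [pow_succ']; rfl
    rw [iterProd_succ, this, iterRhs, LinearMap.add_apply, LinearMap.comp_apply, ← ih]
    simp only [autLin_apply, map_sub, map_mul, LinearMap.mulLeft_apply]
    ring

end PowerEquation

/-! ### The solver for the R-monomials -/

section RootLevel

variable {F E : Type*} [Field F] [CommRing E] [Algebra F E] {σ : RingAut F} {τ : RingAut E} {e : ℕ}
variable {kind : Fin e → MonomialKind} {t : Fin e → E} [Primcodable F] [Primcodable E]

omit [Primcodable F] [Primcodable E] in
theorem IsRPSExtension.coeff_pow_of_root (hE : IsRPSExtension σ τ kind t) {k : ℕ}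
    (hk : ∀ m ∈ groupExps kind (rootSet kind), (τ ^ k) (mon kind t m) = mon kind t m) {x : E}
    (hx : x ∈ monAlg F kind t (rootSet kind)) (m : Fin e → ℤ) :
    hE.coeff m ((τ ^ k) x) = (σ ^ k) (hE.coeff m x) := by
  classical
  refine hE.monAlg_induction (p := fun x => hE.coeff m ((τ ^ k) x) = (σ ^ k) (hE.coeff m x))
    ?_ ?_ ?_ ?_ hx
  · intro m' hm'
    rw [hk m' (groupExps_rootSet.2 hm'.2), hE.coeff_mon (normalExps_mono (Set.subset_univ _) hm')]
    split_ifs <;> simp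
  · simp
  · intro x y h1 h2
    simp only [map_add, h1, h2]
  · intro a x h
    rw [pow_smul_map hE.extends_aut, map_smul, h, map_smul, smul_eq_mul, smul_eq_mul, map_mul]

/-- The problem is solvable for the monomials in `S` and their product group. -/
def IsRPSExtension.SolvableAt (hE : IsRPSExtension σ τ kind t) (S : Set (Fin e)) : Prop :=
  Solvable (constRing τ) (hE.pfldeSol S)
    (fun u => ∃ w ∈ prodGroup F hE.isMonomialBase S, u = (w : E))
    (fun _ => hE.constSub (monAlg F kind t S))

theorem IsEffective.computable_iterProd {hE : IsRPSExtension σ τ kind t} (hI : IsEffective hE)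
    (k : ℕ) : Computable fun u => iterProd τ u k := by
  induction k with
  | zero => simpa [iterProd] using Computable.const (1 : E)
  | succ k ih =>
    simp only [iterProd_succ]
    exact hI.mul.comp Computable.id (hI.aut.comp ih)

theorem IsEffective.computable_iterRhs {hE : IsRPSExtension σ τ kind t} (hI : IsEffective hE)
    (k : ℕ) : Computable₂ fun u z => iterRhs τ u k z := by
  induction k with
  | zero => exact Computable.const (0 : E)
  | succ k ih =>
    have h : Computable fun p : E × E => τ (iterProd τ p.1 k) * p.2 + τ (iterRhs τ p.1 k p.2) :=
      hI.add.comp (hI.mul.comp (hI.aut.comp ((hI.computable_iterProd k).comp Computable.fst))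
        Computable.snd) (hI.aut.comp ih)
    exact h

/-- For a suitable power `τ ^ k`, the consequence `τ ^ k x - N x = iterRhs τ u k z` has `N ∈ F` and
fixed R-monomials, so it decouples into equations in `(F, σ ^ k)` for the coefficients. It is only
necessary; the solutions of the original equation are selected among its solutions by a condition
that is linear over the constants. -/
theorem IsEffective.solvableAt_rootSet {hE : IsRPSExtension σ τ kind t} (hI : IsEffective hE)
    (hF : IsComputableDifferenceField σ) (hstable : IsConstantStable σ)
    (hs : IsSimpleExtension F τ kind t)
    (hper : ∀ i ∈ rootSet kind, ∃ p > 0, τ^[p] (t i) = t i)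
    (hPFLDE : ∀ k : ℕ, 0 < k → PFLDESolvable (id : F → F) (σ ^ k) (unitSet F)) :
    hE.SolvableAt (rootSet kind) := by
  classical
  obtain ⟨k, hk, hk1, hk2⟩ := hE.exists_good_power hs hper
  have hρ : ∀ a, σ a = a → (σ ^ k) a = a := by
    intro a ha
    have : a ∈ constRing (σ ^ k) := by rw [hstable k hk]; exact ha
    exact this
  have hroot : ∀ {m}, m ∈ normalExps kind (rootSet kind) →
      m ∈ normalExps kind (Set.univ : Set (Fin e)) := fun hm => normalExps_mono (Set.subset_univ _) hm
  have hcl : ∀ x ∈ monAlg F kind t (rootSet kind), τ x ∈ monAlg F kind t (rootSet kind) := by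
    intro x hx
    have := IsSimpleExtension.isClosedUnder_level hE hs 0
    rw [level_zero] at this
    exact this.map_monAlg hE.extends_aut hx
  have hclk : ∀ (l : ℕ), ∀ x ∈ monAlg F kind t (rootSet kind),
      (τ ^ l) x ∈ monAlg F kind t (rootSet kind) := by
    intro l
    induction l with
    | zero => exact fun x hx => hx
    | succ l ih => exact fun x hx => by rw [pow_succ']; exact hcl _ (ih x hx)
  have hcoeff := fun x hx => hE.coeff_pow_of_root hk1 (x := x) hx
  have hu : ∀ u, (∃ w ∈ prodGroup F hE.isMonomialBase (rootSet kind), u = (w : E)) →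
      u ∈ monAlg F kind t (rootSet kind) ∧ hE.coeff 0 (iterProd τ u k) ≠ 0 ∧
      iterProd τ u k = algebraMap F E (hE.coeff 0 (iterProd τ u k)) := by
    rintro _ ⟨w, hw, rfl⟩
    obtain ⟨a, ha, h⟩ := hk2 w hw
    refine ⟨prodGroup_mem_monAlg _ hw, ?_⟩
    have h1 : (0 : Fin e → ℤ) ∈ normalExps kind (Set.univ : Set (Fin e)) :=
      ⟨fun i => isNormalExp_zero (hE.isMonomialBase i), fun _ _ => rfl⟩
    have h2 : hE.coeff 0 (algebraMap F E a) = a := by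
      rw [Algebra.algebraMap_eq_smul_one, map_smul, ← mon_zero (kind := kind) (t := t),
        hE.coeff_mon h1]
      simp
    rw [h, h2]
    exact ⟨ha, rfl⟩
  have hfin : (normalExps kind (rootSet kind)).Finite := finite_normalExps_rootSet
  have hbase := hI.solvable_coord hρ (hI.solvable_base hρ (hstable k hk) (hPFLDE k hk)) hfin.toFinset
    fun m hm => hroot (hfin.mem_toFinset.1 hm)
  -- The equations for all coefficients together amount to the single equation for `τ ^ k`, since `τ
  -- ^ k` acts on the coefficients as `σ ^ k`.
  have hcoord : ∀ (a : F) (x z : E), z ∈ monAlg F kind t (rootSet kind) →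
      ((x, z) ∈ hE.coordSol (σ ^ k) hρ hfin.toFinset a ↔
        x ∈ monAlg F kind t (rootSet kind) ∧ (τ ^ k) x - algebraMap F E a * x = z) := by
    intro a x z hz
    constructor
    · rintro ⟨h1, h2⟩
      have hx : x ∈ monAlg F kind t (rootSet kind) :=
        hE.mem_monAlg_iff.2 fun m hm => h1 m fun h => hm (hfin.mem_toFinset.1 h)
      refine ⟨hx, hE.ext fun m _ => ?_⟩
      rw [map_sub, hcoeff x hx, ← Algebra.smul_def, map_smul, smul_eq_mul]
      by_cases hm : m ∈ normalExps kind (rootSet kind)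
      · exact h2 m (hfin.mem_toFinset.2 hm)
      · rw [hE.coeff_eq_zero_of_mem hx hm, hE.coeff_eq_zero_of_mem hz hm]
        simp
    · rintro ⟨hx, h⟩
      refine ⟨fun m hm => hE.coeff_eq_zero_of_mem hx fun h => hm (hfin.mem_toFinset.2 h),
        fun m _ => ?_⟩
      dsimp only
      rw [← h, map_sub, hcoeff x hx, ← Algebra.smul_def, map_smul, smul_eq_mul]
  have hpow : Solvable (constRing τ) (fun u => hE.coordSol (σ ^ k) hρ hfin.toFinset
      (hE.coeff 0 (iterProd τ u k)))
      (fun u => ∃ w ∈ prodGroup F hE.isMonomialBase (rootSet kind), u = (w : E)) (fun _ => ⊤) := by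
    refine hbase.comap (q := fun a => Part.some (hE.coeff 0 (iterProd τ a.1 k))) ?_ ?_
    · exact Computable.partrec (hI.coeff.comp (Computable.const 0)
        ((hI.computable_iterProd k).comp Computable.fst))
    · intro u hu' n Y _
      exact ⟨_, Part.mem_some _, (hu u hu').2.1, fun _ => trivial, fun _ _ _ => Iff.rfl⟩
  -- The linear condition imposed here is the original equation `z - (τ x - u x) = 0`.
  refine hI.solvable_restrict hF hpow (ρ := fun u => iterRhs τ u k) (hI.computable_iterRhs k)
    (δ := fun u => LinearMap.snd _ _ _ - ((autLin τ - LinearMap.mulLeft _ u).comp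
      (LinearMap.fst _ _ _))) ?_ (fun _ _ _ _ => trivial) ?_
  · have h : Computable fun p : E × E × E => p.2.2 - (τ p.2.1 - p.1 * p.2.1) :=
      hI.sub.comp (Computable.snd.comp Computable.snd) (hI.sub.comp
        (hI.aut.comp (Computable.fst.comp Computable.snd))
        (hI.mul.comp Computable.fst (Computable.fst.comp Computable.snd)))
    exact h
  · intro u hu' z hz x
    obtain ⟨hu1, -, hu2⟩ := hu u hu'
    have hiter : ∀ (j : ℕ), ∀ z ∈ monAlg F kind t (rootSet kind), iterProd τ u j ∈
        monAlg F kind t (rootSet kind) ∧ iterRhs τ u j z ∈ monAlg F kind t (rootSet kind) := by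
      intro j z hz
      induction j with
      | zero => exact ⟨by simp [iterProd, one_mem], zero_mem _⟩
      | succ j ih =>
        refine ⟨?_, ?_⟩
        · rw [iterProd_succ]
          exact mul_mem hu1 (hcl _ ih.1)
        · exact add_mem (mul_mem (hcl _ ih.1) hz) (hcl _ ih.2)
    rw [hcoord _ _ _ (hiter k z hz).2, ← hu2, pow_sub_iterProd]
    simp only [LinearMap.sub_apply, LinearMap.comp_apply, LinearMap.fst_apply, LinearMap.snd_apply,
      autLin_apply, LinearMap.mulLeft_apply]
    constructor
    · rintro ⟨h1, h2⟩
      dsimp only at h1 h2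
      rw [h2]
      exact ⟨⟨h1, rfl⟩, sub_self _⟩
    · rintro ⟨⟨h1, -⟩, h2⟩
      exact ⟨h1, (sub_eq_zero.1 h2).symm⟩

end RootLevel

/-! ### Comparison of coefficients -/

section Comparison

variable {F E : Type*} [Field F] [CommRing E] [Algebra F E] {σ : RingAut F} {τ : RingAut E} {e : ℕ}
variable {kind : Fin e → MonomialKind} {t : Fin e → E}

/-- The problem of finding the coefficients of a solution with exponents in `(D - n, D]` such that
the coefficients of both sides of the equation agree for exponents above `D - n`. -/
noncomputable def IsRPSExtension.topSol (hE : IsRPSExtension σ τ kind t) (S : Set (Fin e))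
    (i : Fin e) (u : E) (D n : ℕ) : Submodule (constRing τ) (E × E) where
  carrier := {y | y.1 ∈ monAlg F kind t (insert i S) ∧
    (∀ j : ℤ, ¬ ((D : ℤ) - n < j ∧ j ≤ D) → hE.coeffAt i j y.1 = 0) ∧
    ∀ j : ℤ, (D : ℤ) - n < j → hE.coeffAt i j (τ y.1 - u * y.1 - y.2) = 0}
  add_mem' := by
    rintro x y ⟨h1, h2, h3⟩ ⟨h4, h5, h6⟩
    refine ⟨add_mem h1 h4, fun j hj => ?_, fun j hj => ?_⟩
    · rw [Prod.fst_add, map_add, h2 j hj, h5 j hj, add_zero]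
    · have : τ (x + y).1 - u * (x + y).1 - (x + y).2 =
          (τ x.1 - u * x.1 - x.2) + (τ y.1 - u * y.1 - y.2) := by
        rw [Prod.fst_add, Prod.snd_add, map_add]
        ring
      rw [this, map_add, h3 j hj, h6 j hj, add_zero]
  zero_mem' := ⟨zero_mem _, by simp, by simp⟩
  smul_mem' := by
    rintro c x ⟨h1, h2, h3⟩
    refine ⟨(hE.constSub (monAlg F kind t (insert i S))).smul_mem c h1, fun j hj => ?_, fun j hj => ?_⟩
    · rw [Prod.smul_fst, ← hE.constLin_apply, map_smul, hE.constLin_apply, h2 j hj, smul_zero]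
    · have : τ (c • x).1 - u * (c • x).1 - (c • x).2 = c • (τ x.1 - u * x.1 - x.2) := by
        have : τ (c : E) = c := c.2
        simp only [Prod.smul_fst, Prod.smul_snd, Subring.smul_def, smul_eq_mul, map_mul, this]
        ring
      rw [this, ← hE.constLin_apply, map_smul, hE.constLin_apply, h3 j hj, smul_zero]

/-- The elements in which the exponents of a monomial are at most `D`. -/
noncomputable def IsRPSExtension.topDom (hE : IsRPSExtension σ τ kind t) (S : Set (Fin e))
    (i : Fin e) (D : ℕ) : Submodule (constRing τ) E where
  carrier := {z | z ∈ monAlg F kind t (insert i S) ∧ ∀ j : ℤ, D < j → hE.coeffAt i j z = 0}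
  add_mem' := by
    rintro x y ⟨h1, h2⟩ ⟨h3, h4⟩
    exact ⟨add_mem h1 h3, fun j hj => by rw [map_add, h2 j hj, h4 j hj, add_zero]⟩
  zero_mem' := ⟨zero_mem _, by simp⟩
  smul_mem' := by
    rintro c x ⟨h1, h2⟩
    refine ⟨(hE.constSub (monAlg F kind t (insert i S))).smul_mem c h1, fun j hj => ?_⟩
    rw [← hE.constLin_apply, map_smul, hE.constLin_apply, h2 j hj, smul_zero]

theorem Computable.unit_zpow {A : Type*} [CommRing A] [Primcodable A]
    (hmul : Computable₂ fun x y : A => x * y) (w : Aˣ) :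
    Computable fun j : ℤ => ((w ^ j : Aˣ) : A) := by
  refine (Computable.int_cases (g := fun _ n => (w : A) ^ n)
    (h := fun _ n => ((w⁻¹ : Aˣ) : A) ^ (n + 1)) Computable.id
    ((Computable.pow_const hmul _).comp Computable.snd)
    ((Computable.pow_const hmul _).comp (Computable.succ.comp Computable.snd))).of_eq fun j => ?_
  cases j with
  | ofNat n => rfl
  | negSucc n => rfl

variable [Primcodable F] [Primcodable E] {hE : IsRPSExtension σ τ kind t}

/-- Comparison of coefficients, from the top down. -/
theorem IsEffective.solvable_top (hI : IsEffective hE) {S : Set (Fin e)} {i : Fin e} (hi : i ∉ S)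
    {α : Eˣ} (hα : α ∈ prodGroup F hE.isMonomialBase S)
    (hτ : ∀ x ∈ monAlg F kind t S, ∀ j, IsNormalExp (kind i) j → ∀ j' ≥ j,
      hE.coeffAt i j' (τ (x * genPow (t i) j (kind i))) =
        if j = j' then τ x * ((α ^ j : Eˣ) : E) else 0)
    (hcl : ∀ x ∈ monAlg F kind t (insert i S), τ x ∈ monAlg F kind t (insert i S))
    (hsolv : hE.SolvableAt S) :
    Solvable (constRing τ) (fun p : (E × ℕ) × ℕ => hE.topSol S i p.1.1 p.1.2 p.2)
      (fun p => (∃ w ∈ prodGroup F hE.isMonomialBase S, p.1.1 = (w : E)) ∧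
        ∀ n < p.2, IsNormalExp (kind i) ((p.1.2 : ℤ) - n))
      (fun p => hE.topDom S i p.1.2) := by
  have hzpow := Computable.unit_zpow hI.mul α
  have hexp : Computable fun p : (E × ℕ) × ℕ => (p.1.2 : ℤ) - p.2 :=
    Computable.int_sub_nat.comp (Computable.snd.comp Computable.fst) Computable.snd
  have hneg : Computable fun p : (E × ℕ) × ℕ => ((α ^ (-((p.1.2 : ℤ) - p.2)) : Eˣ) : E) :=
    hzpow.comp (Computable.int_neg.comp hexp)
  have hαmem : ∀ j : ℤ, ((α ^ j : Eˣ) : E) ∈ monAlg F kind t S := fun j =>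
    prodGroup_mem_monAlg _ (zpow_mem hα j)
  -- The coefficient `g` at the exponent `D - n` satisfies `τ g * α ^ (D - n) - u * g = ⋯`. Division
  -- by the power of `α` gives an equation one level below, with the factor `u * α ^ (-(D - n))`.
  let q : (E × ℕ) × ℕ → E := fun p => p.1.1 * ((α ^ (-((p.1.2 : ℤ) - p.2)) : Eˣ) : E)
  let μ : (E × ℕ) × ℕ → E →ₗ[constRing τ] E := fun p =>
    LinearMap.mulRight _ (genPow (t i) ((p.1.2 : ℤ) - p.2) (kind i))
  let δ : (E × ℕ) × ℕ → E × E →ₗ[constRing τ] E := fun p =>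
    (LinearMap.mulLeft _ ((α ^ (-((p.1.2 : ℤ) - p.2)) : Eˣ) : E)).comp
      ((hE.constLin (hE.coeffAt i ((p.1.2 : ℤ) - p.2))).comp (LinearMap.snd _ _ _ -
        (autLin τ - LinearMap.mulLeft _ p.1.1).comp (LinearMap.fst _ _ _)))
  have hδ' : ∀ p y, δ p y = ((α ^ (-((p.1.2 : ℤ) - p.2)) : Eˣ) : E) *
      hE.coeffAt i ((p.1.2 : ℤ) - p.2) (y.2 - (τ y.1 - p.1.1 * y.1)) := fun p y => rfl
  have hq : Computable q := hI.mul.comp (Computable.fst.comp Computable.fst) hneg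
  have hμ : Computable₂ fun p x => μ p x := by
    have : Computable fun a : ((E × ℕ) × ℕ) × E =>
        a.2 * genPow (t i) ((a.1.1.2 : ℤ) - a.1.2) (kind i) :=
      hI.mul.comp Computable.snd ((hI.pow i).comp (hexp.comp Computable.fst))
    exact this
  have hδ : Computable₂ fun p x => δ p x := by
    have h1 : Computable fun a : ((E × ℕ) × ℕ) × E × E =>
        a.2.2 - (τ a.2.1 - a.1.1.1 * a.2.1) :=
      hI.sub.comp (Computable.snd.comp Computable.snd) (hI.sub.comp
        (hI.aut.comp (Computable.fst.comp Computable.snd))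
        (hI.mul.comp (Computable.fst.comp (Computable.fst.comp Computable.fst))
          (Computable.fst.comp Computable.snd)))
    have h2 : Computable fun a : ((E × ℕ) × ℕ) × E × E =>
        ((α ^ (-((a.1.1.2 : ℤ) - a.1.2)) : Eˣ) : E) *
          hE.coeffAt i ((a.1.1.2 : ℤ) - a.1.2) (a.2.2 - (τ a.2.1 - a.1.1.1 * a.2.1)) :=
      hI.mul.comp (hneg.comp Computable.fst) ((hI.coeffAt i).comp (hexp.comp Computable.fst) h1)
    exact h2
  have hcoeff : ∀ x₂ ∈ monAlg F kind t S, ∀ j, IsNormalExp (kind i) j → ∀ j',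
      hE.coeffAt i j' (x₂ * genPow (t i) j (kind i)) = if j = j' then x₂ else 0 :=
    fun x₂ hx₂ j hj j' => hE.coeffAt_mul_genPow hi hx₂ j' hj
  -- A term with exponent `j` influences the comparison at exponents `j' ≥ j` only at `j' = j`, so
  -- the comparisons made earlier remain valid.
  have hmain : ∀ (u : E), u ∈ monAlg F kind t S → ∀ x₁ z, ∀ x₂ ∈ monAlg F kind t S,
      ∀ j, IsNormalExp (kind i) j → ∀ j' ≥ j,
      hE.coeffAt i j' (τ (x₁ + x₂ * genPow (t i) j (kind i)) -
        u * (x₁ + x₂ * genPow (t i) j (kind i)) - z) = hE.coeffAt i j' (τ x₁ - u * x₁ - z) +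
        if j = j' then τ x₂ * ((α ^ j : Eˣ) : E) - u * x₂ else 0 := by
    intro u hu x₁ z x₂ hx₂ j hj j' hj'
    have : τ (x₁ + x₂ * genPow (t i) j (kind i)) -
        u * (x₁ + x₂ * genPow (t i) j (kind i)) - z = (τ x₁ - u * x₁ - z) +
        (τ (x₂ * genPow (t i) j (kind i)) - u * x₂ * genPow (t i) j (kind i)) := by
      rw [map_add]; ring
    rw [this, map_add, map_sub (hE.coeffAt i j') (τ _), hτ x₂ hx₂ j hj j' hj',
      hcoeff _ (mul_mem hu hx₂) j hj]
    split_ifs <;> simp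
  refine Solvable.iterate hI.add hI.mul (S := fun p n => hE.topSol S i p.1 p.2 n)
    (valid := fun p => ∃ w ∈ prodGroup F hE.isMonomialBase S, p.1 = (w : E))
    (vstep := fun p n => IsNormalExp (kind i) ((p.2 : ℤ) - n))
    (dom := fun p => hE.topDom S i p.2) ?_ hsolv hq hμ hδ ?_ ?_ ?_ ?_
  -- For `n = 0` the window of exponents is empty: only `x = 0` is allowed, and it is a solution
  -- because the right-hand side has no exponents above `D`.
  · refine Solvable.of_graph (R := fun _ => 0)
      (show Computable₂ fun (_ : E × ℕ) (_ : E) => (0 : E) from Computable.const 0) ?_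
    rintro p - z hz x
    rw [LinearMap.zero_apply]
    constructor
    · rintro ⟨-, h, -⟩
      exact hE.ext_coeffAt i fun j => (h j (by push_cast; omega)).trans (map_zero _).symm
    · rintro rfl
      refine ⟨zero_mem _, by simp, fun j hj => ?_⟩
      simpa using hz.2 j (by simpa using hj)
  · rintro ⟨u, D⟩ ⟨w, hw, rfl⟩ n -
    exact ⟨w * α ^ (-((D : ℤ) - n)), mul_mem hw (zpow_mem hα _), rfl⟩
  · rintro ⟨u, D⟩ ⟨w, hw, rfl⟩ n hn z hz x₁ ⟨h1, -⟩
    have hw' := monAlg_mono (F := F) (t := t) (Set.subset_insert i S) (prodGroup_mem_monAlg _ hw)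
    change _ ∈ monAlg F kind t S
    exact mul_mem (hαmem _) (hE.coeffAt_mem (sub_mem hz.1 (sub_mem (hcl _ h1)
      (mul_mem hw' h1))) _)
  · rintro ⟨u, D⟩ ⟨w, hw, rfl⟩ n hn z hz x
    dsimp only at hn hz ⊢
    have hu := prodGroup_mem_monAlg _ hw
    have hmem : ∀ x₂ ∈ monAlg F kind t S, x₂ * genPow (t i) ((D : ℤ) - n) (kind i) ∈
        monAlg F kind t (insert i S) := fun x₂ hx₂ => mul_mem
      (monAlg_mono (Set.subset_insert i S) hx₂) (by
        rw [← mon_single]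
        exact mon_mem_monAlg hE.isMonomialBase fun k hk => Pi.single_eq_of_ne (fun h => hk (by
          rw [h]; exact Set.mem_insert i S)) _)
    have hα1 : ((α ^ (-((D : ℤ) - n)) : Eˣ) : E) * ((α ^ ((D : ℤ) - n) : Eˣ) : E) = 1 := by
      rw [← Units.val_mul, ← zpow_add, neg_add_cancel, zpow_zero, Units.val_one]
    -- Enlarging the window by the exponent `D - n` amounts to adding a coefficient `x₂` that solves
    -- the equation below.
    have key : ∀ x₁, ∀ x₂ ∈ monAlg F kind t S, x = x₁ + x₂ * genPow (t i) ((D : ℤ) - n) (kind i) →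
        ((x, z) ∈ hE.topSol S i w D (n + 1) ∧ x₂ = hE.coeffAt i ((D : ℤ) - n) x ↔
          (x₁, z) ∈ hE.topSol S i w D n ∧
            (x₂, δ ((w, D), n) (x₁, z)) ∈ hE.pfldeSol S (q ((w, D), n))) := by
      rintro x₁ x₂ hx₂ rfl
      have h1 := hmain w hu x₁ z x₂ hx₂ _ hn
      have h2 := hcoeff x₂ hx₂ _ hn
      have h3 : (x₂, δ ((w, D), n) (x₁, z)) ∈ hE.pfldeSol S (q ((w, D), n)) ↔
          hE.coeffAt i ((D : ℤ) - n) (τ x₁ - w * x₁ - z) +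
            (τ x₂ * ((α ^ ((D : ℤ) - n) : Eˣ) : E) - w * x₂) = 0 := by
        have h4 : z - (τ x₁ - w * x₁) = -(τ x₁ - w * x₁ - z) := by ring
        have h5 : (x₂, δ ((w, D), n) (x₁, z)) ∈ hE.pfldeSol S (q ((w, D), n)) ↔
            τ x₂ - q ((w, D), n) * x₂ = δ ((w, D), n) (x₁, z) :=
          ⟨fun h => h.2, fun h => ⟨hx₂, h⟩⟩
        rw [h5, hδ']
        dsimp only [q]
        rw [h4, map_neg]
        constructor
        · intro h
          linear_combination ((α ^ ((D : ℤ) - n) : Eˣ) : E) * h + (w * x₂ - hE.coeffAt i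
            ((D : ℤ) - n) (τ x₁ - w * x₁ - z)) * hα1
        · intro h
          linear_combination ((α ^ (-((D : ℤ) - n)) : Eˣ) : E) * h - τ x₂ * hα1
      rw [h3]
      constructor
      · rintro ⟨⟨g1, g2, g3⟩, g4⟩
        dsimp only at g1 g2 g3
        refine ⟨⟨?_, fun j hj => ?_, fun j hj => ?_⟩, ?_⟩
        · have := sub_mem g1 (hmem x₂ hx₂)
          rwa [add_sub_cancel_right] at this
        · dsimp only
          rw [map_add, h2] at g4
          by_cases hj' : (D : ℤ) - n = j
          · rw [if_pos rfl] at g4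
            subst hj'
            linear_combination -g4
          · have := g2 j (by push_cast; omega)
            rwa [map_add, h2, if_neg hj', add_zero] at this
        · have := g3 j (by push_cast; omega)
          rwa [h1 j hj.le, if_neg hj.ne, add_zero] at this
        · have := g3 ((D : ℤ) - n) (by push_cast; omega)
          rwa [h1 _ le_rfl, if_pos rfl] at this
      · rintro ⟨⟨g1, g2, g3⟩, g4⟩
        dsimp only at g1 g2 g3
        refine ⟨⟨add_mem g1 (hmem x₂ hx₂), fun j hj => ?_, fun j hj => ?_⟩, ?_⟩
        · dsimp only
          rw [map_add, h2, g2 j (by push_cast at hj; omega), if_neg (by push_cast at hj; omega),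
            add_zero]
        · dsimp only
          rw [h1 j (by push_cast at hj; omega)]
          by_cases hj' : (D : ℤ) - n = j
          · subst hj'
            rw [if_pos rfl, g4]
          · rw [if_neg hj', add_zero]
            exact g3 j (by push_cast at hj; omega)
        · rw [map_add, h2, g2 _ (by omega), if_pos rfl, zero_add]
    constructor
    · intro h
      refine ⟨x - hE.coeffAt i ((D : ℤ) - n) x * genPow (t i) ((D : ℤ) - n) (kind i),
        hE.coeffAt i ((D : ℤ) - n) x, by simp [μ], ?_⟩
      exact (key _ _ (hE.coeffAt_mem h.1 _) (by ring)).1 ⟨h, rfl⟩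
    · rintro ⟨x₁, x₂, hx, h1, h2⟩
      exact ((key x₁ x₂ h2.1 hx).2 ⟨h1, h2⟩).1
  · rintro ⟨u, D⟩ ⟨w, hw, rfl⟩ n hn x₁ x₂ ⟨h1, h2, -⟩ ⟨h3, -⟩ h
    have h4 := congrArg (hE.coeffAt i ((D : ℤ) - n)) h
    dsimp only [μ] at h h2 h3 h4
    rw [map_add, LinearMap.mulRight_apply, hcoeff x₂ h3 _ hn, h2 _ (by omega), map_zero, if_pos rfl,
      zero_add] at h4
    subst h4
    exact ⟨by simpa using h, rfl⟩

end Comparison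

/-! ### Degree bounds and the solver for a Σ-monomial -/

section Bounds

variable {F E : Type*} [Field F] [CommRing E] [Algebra F E] {σ : RingAut F} {τ : RingAut E} {e : ℕ}
variable {kind : Fin e → MonomialKind} {t : Fin e → E}

theorem IsRPSExtension.degLE_sum (hE : IsRPSExtension σ τ kind t) {i : Fin e} {d : E → ℕ}
    (hd : ∀ x, hE.DegLE i (d x) x) {n : ℕ} (Y c : Fin n → E) (hc : ∀ l, c l ∈ constRing τ) :
    hE.DegLE i ((List.ofFn Y).map d).sum (∑ l, c l * Y l) := by
  intro j hj
  rw [← hE.constLin_apply, map_sum]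
  refine Finset.sum_eq_zero fun l _ => ?_
  have h1 := (hE.constLin (hE.coeffAt i j)).map_smul ⟨c l, hc l⟩ (Y l)
  have h2 : d (Y l) ≤ ((List.ofFn Y).map d).sum :=
    List.single_le_sum (by simp) _ (List.mem_map_of_mem (by simp [List.mem_ofFn]))
  refine h1.trans ?_
  rw [hE.constLin_apply, hd (Y l) j (by omega), smul_zero]

theorem IsRPSExtension.exists_eq_unit_of_sigma (hE : IsRPSExtension σ τ kind t) {S : Set (Fin e)}
    {i : Fin e} (hk : kind i = MonomialKind.sigma) {w : Eˣ}
    (hw : w ∈ prodGroup F hE.isMonomialBase (insert i S)) :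
    w ∈ prodGroup F hE.isMonomialBase S := by
  obtain ⟨w', hw', m, hm, h⟩ := IsRPSExtension.split_unit hE.isMonomialBase hw
  rw [hm hk, genPow_zero, mul_one] at h
  rwa [Units.ext h]

variable [Primcodable F] [Primcodable E] {hE : IsRPSExtension σ τ kind t}

/-- A solver from bounds for the exponents of the solutions. -/
theorem IsEffective.solvable_of_bound (hI : IsEffective hE) {S : Set (Fin e)} {i : Fin e}
    (hi : i ∉ S) {α : Eˣ} (hα : α ∈ prodGroup F hE.isMonomialBase S)
    (hτ : ∀ x ∈ monAlg F kind t S, ∀ j, IsNormalExp (kind i) j → ∀ j' ≥ j,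
      hE.coeffAt i j' (τ (x * genPow (t i) j (kind i))) =
        if j = j' then τ x * ((α ^ j : Eˣ) : E) else 0)
    (hcl : ∀ x ∈ monAlg F kind t (insert i S), τ x ∈ monAlg F kind t (insert i S))
    (hsolv : hE.SolvableAt S) {valid : E → Prop} {bd : E × List E →. ℕ × ℕ} (hbd : Partrec bd)
    (H : ∀ u, valid u → ∀ (n : ℕ) (Y : Fin n → E),
      (∀ l, Y l ∈ monAlg F kind t (insert i S)) → ∃ b ∈ bd (u, List.ofFn Y),
        (∃ w ∈ prodGroup F hE.isMonomialBase S, u = (w : E)) ∧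
        (∀ n < b.2, IsNormalExp (kind i) ((b.1 : ℤ) - n)) ∧
        (∀ l, ∀ j : ℤ, b.1 < j → hE.coeffAt i j (Y l) = 0) ∧
        ∀ c : Fin n → E, (∀ l, c l ∈ constRing τ) → ∀ x ∈ monAlg F kind t (insert i S),
          (τ x - u * x = ∑ l, c l * Y l →
            ∀ j : ℤ, ¬ ((b.1 : ℤ) - b.2 < j ∧ j ≤ b.1) → hE.coeffAt i j x = 0) ∧
          ((∀ j : ℤ, ¬ ((b.1 : ℤ) - b.2 < j ∧ j ≤ b.1) → hE.coeffAt i j x = 0) →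
            ∀ j : ℤ, j ≤ (b.1 : ℤ) - b.2 → hE.coeffAt i j (τ x - u * x - ∑ l, c l * Y l) = 0)) :
    Solvable (constRing τ) (hE.pfldeSol (insert i S)) valid
      (fun _ => hE.constSub (monAlg F kind t (insert i S))) := by
  refine (hI.solvable_top hi hα hτ hcl hsolv).comap
    (q := fun a => (bd a).map fun b => ((a.1, b.1), b.2)) ?_ ?_
  · exact hbd.map (((Computable.fst.comp Computable.fst).pair
      (Computable.fst.comp Computable.snd)).pair (Computable.snd.comp Computable.snd))
  · intro u hu n Y hY
    -- The solution lies in the window by the first half of the last condition, and by the second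
    -- half nothing is left to compare at exponents below the window.
    obtain ⟨b, hb, h1, h2, h3, h4⟩ := H u hu n Y hY
    refine ⟨_, Part.mem_map _ hb, ⟨h1, h2⟩, fun l => ⟨hY l, h3 l⟩, fun c hc x => ?_⟩
    constructor
    · rintro ⟨g1, g2⟩
      exact ⟨g1, ((h4 c hc x g1).1 g2), fun j _ => by
        dsimp only at g2 ⊢; rw [g2, sub_self, map_zero]⟩
    · rintro ⟨g1, g2, g3⟩
      refine ⟨g1, sub_eq_zero.1 (hE.ext_coeffAt i fun j => ?_)⟩
      rw [map_zero]
      rcases lt_or_ge ((b.1 : ℤ) - b.2) j with hj | hj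
      · exact g3 j hj
      · exact (h4 c hc x g1).2 g2 j hj

variable [CharZero F]

omit [Primcodable F] [Primcodable E] in
include hE in
/-- The exponents of a Σ-monomial in a solution exceed those of the right-hand side by one at
most. -/
theorem IsRPSExtension.coeffAt_eq_zero_of_sigma (hs : IsSimpleExtension F τ kind t) (i : Fin e)
    (hk : kind i = MonomialKind.sigma) {w : Eˣ}
    (hw : w ∈ prodGroup F hE.isMonomialBase (level kind i)) {x : E}
    (hx : x ∈ monAlg F kind t (insert i (level kind i))) {d : ℕ}
    (hd : ∀ j : ℤ, d < j → hE.coeffAt i j (τ x - w * x) = 0) (j : ℤ) (hj : (d : ℤ) + 1 < j) :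
    hE.coeffAt i j x = 0 := by
  have hi : i ∉ level kind i := not_mem_level i (by rintro ⟨l, h⟩; rw [hk] at h; cases h)
  have hS := IsSimpleExtension.isClosedUnder_level hE hs (i : ℕ)
  have hβ : τ (t i) - t i ∈ monAlg F kind t (level kind i) := by
    have := hE.monomial i
    rw [hk] at this
    exact monAlg_mono (fun j hj => Or.inr hj) this.2
  have hu := prodGroup_mem_monAlg _ hw
  -- The bound `d + 1 + n` is improved to `d + 1` one unit at a time.
  suffices h : ∀ n : ℕ, (∀ j : ℤ, (d : ℤ) + 1 + n < j → hE.coeffAt i j x = 0) →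
      ∀ j : ℤ, (d : ℤ) + 1 < j → hE.coeffAt i j x = 0 by
    obtain ⟨D, hD⟩ := hE.exists_degLE i x
    exact h D (fun j hj => (hD D le_rfl).1 j (by omega)) j hj
  intro n
  induction n with
  | zero => intro h; simpa using h
  | succ n ih =>
    intro h
    refine ih fun j hj => ?_
    by_cases hj' : j = ((d + n + 2 : ℕ) : ℤ)
    swap
    · exact h j (by push_cast at hj' ⊢; omega)
    subst hj'
    by_contra h0
    have htop : ∀ j : ℤ, ((d + n + 2 : ℕ) : ℤ) < j → hE.coeffAt i j x = 0 :=
      fun j hj => h j (by push_cast at hj ⊢; omega)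
    -- If the coefficient `g` at `d + n + 2` is nonzero, the vanishing of the coefficients of `τ x -
    -- w x` at `d + n + 2` and `d + n + 1`, both greater than `d`, says that `g` is a semi-constant,
    -- hence a unit, and relates it to the next coefficient `g'`.
    set g := hE.coeffAt i ((d + n + 2 : ℕ) : ℤ) x with hg
    have hgS : g ∈ monAlg F kind t (level kind i) := hE.coeffAt_mem hx _
    have h1 : τ g = w * g := by
      have := hd ((d + n + 2 : ℕ) : ℤ) (by push_cast; omega)
      rwa [map_sub, hE.coeffAt_map_sigma_top hi hS hk hβ hx htop, hE.coeffAt_mul hi hu hx,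
        sub_eq_zero] at this
    obtain ⟨-, -, -, -, -, -, hunit⟩ := hE.semiconst hs i.2.le hgS h0 hw h1
    set g' := hE.coeffAt i ((d + n + 1 : ℕ) : ℤ) x with hg'
    have hg'S : g' ∈ monAlg F kind t (level kind i) := hE.coeffAt_mem hx _
    have h2 : τ g' + τ g * ((τ (t i) - t i) * ((d + n + 2 : ℕ) : E)) = w * g' := by
      have := hd ((d + n + 1 : ℕ) : ℤ) (by push_cast; omega)
      rw [map_sub, hE.coeffAt_map_sigma hi hS hk hβ hx htop, hE.coeffAt_mul hi hu hx,
        sub_eq_zero, Finset.sum_range_succ, Finset.sum_range_succ, Finset.sum_eq_zero] at this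
      · have h3 : (d + n + 2).choose (d + n + 1) = d + n + 2 := Nat.choose_succ_self_right _
        have h4 : d + n + 2 - (d + n + 1) = 1 := by omega
        rw [← this, h3, h4, Nat.sub_self, pow_zero, pow_one, Nat.choose_self, Nat.cast_one, mul_one,
          mul_one, zero_add]
      · intro l hl
        rw [Nat.choose_eq_zero_of_lt (by simpa using hl)]
        simp
    obtain ⟨v, hv⟩ := hunit
    have hv1 : g * ((v⁻¹ : Eˣ) : E) = 1 := by rw [← hv]; exact v.mul_inv
    -- The element `g' / g + (d + n + 2) * t i` is a constant, hence in `F`. Comparing coefficients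
    -- at `t i` gives `(d + n + 2) g = 0`, impossible in characteristic zero.
    set c := g' * ((v⁻¹ : Eˣ) : E) + ((d + n + 2 : ℕ) : E) * t i with hc
    have hc1 : τ c = c := by
      have h3 : τ g * τ ((v⁻¹ : Eˣ) : E) = 1 := by rw [← map_mul, hv1, map_one]
      have h4 : τ ((v⁻¹ : Eˣ) : E) * w = ((v⁻¹ : Eˣ) : E) := by
        have : w * g * τ ((v⁻¹ : Eˣ) : E) = 1 := by rw [← h1]; exact h3
        linear_combination ((v⁻¹ : Eˣ) : E) * this - (w * τ ((v⁻¹ : Eˣ) : E)) * hv1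
      rw [hc, map_add, map_mul, map_mul, map_natCast]
      linear_combination τ ((v⁻¹ : Eˣ) : E) * h2 + g' * h4 -
        ((τ (t i) - t i) * ((d + n + 2 : ℕ) : E)) * h3
    obtain ⟨a, -, ha⟩ := hE.const_mem hc1
    have h5 : a • g = g' + ((d + n + 2 : ℕ) : E) * g * genPow (t i) 1 (kind i) := by
      rw [Algebra.smul_def, ← ha, hc, genPow_one]
      linear_combination g' * hv1
    have h6 := congrArg (hE.coeffAt i 1) h5
    have hn1 : IsNormalExp (kind i) 1 := by rw [hk]; exact zero_le_one
    rw [map_smul, hE.coeffAt_of_mem hi hgS, map_add, hE.coeffAt_of_mem hi hg'S,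
      hE.coeffAt_mul_genPow hi (mul_mem (natCast_mem _ _) hgS) 1 hn1, if_neg (by simp),
      if_pos rfl, smul_zero, if_neg (by simp), zero_add] at h6
    have h7 : ((d + n + 2 : ℕ) : F) • g = 0 := by
      rw [Algebra.smul_def, map_natCast, ← h6]
    rw [smul_eq_zero] at h7
    rcases h7 with h7 | h7
    · exact absurd h7 (by exact_mod_cast (by omega : d + n + 2 ≠ 0))
    · exact h0 h7

theorem IsEffective.solvableAt_insert_sigma (hI : IsEffective hE)
    (hs : IsSimpleExtension F τ kind t) (i : Fin e) (hk : kind i = MonomialKind.sigma)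
    (hsolv : hE.SolvableAt (level kind i)) : hE.SolvableAt (insert i (level kind i)) := by
  have hi : i ∉ level kind i := not_mem_level i (by rintro ⟨l, h⟩; rw [hk] at h; cases h)
  have hS := IsSimpleExtension.isClosedUnder_level hE hs (i : ℕ)
  have hS' := IsSimpleExtension.isClosedUnder_level hE hs ((i : ℕ) + 1)
  rw [level_succ] at hS'
  have hβ : τ (t i) - t i ∈ monAlg F kind t (level kind i) := by
    have := hE.monomial i
    rw [hk] at this
    exact monAlg_mono (fun j hj => Or.inr hj) this.2
  obtain ⟨d, hd, hd'⟩ := hI.degree i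
  -- If the right-hand sides have degree at most `s`, solutions have degree at most `s + 1`; the
  -- window consists of the `s + 2` exponents from `s + 1` down to `0`. For a Σ-monomial the factor
  -- `α` is `1`.
  refine hI.solvable_of_bound hi (one_mem _) ?_ (fun x hx => hS'.map_monAlg hE.extends_aut hx) hsolv
    (bd := fun a => Part.some ((a.2.map d).sum + 1, (a.2.map d).sum + 2)) ?_ ?_
  · intro x hx j hj j' hj'
    rw [hk] at hj
    obtain ⟨j, rfl⟩ := Int.eq_ofNat_of_zero_le hj
    obtain ⟨j', rfl⟩ := Int.eq_ofNat_of_zero_le (hj.trans hj')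
    rw [hE.coeffAt_map_sigma_term hi hS hk hβ hx]
    rcases eq_or_lt_of_le hj' with h | h
    · obtain rfl : j = j' := by exact_mod_cast h
      simp
    · rw [if_neg h.ne, Nat.choose_eq_zero_of_lt (by exact_mod_cast h)]
      simp
  · have h1 : Computable fun a : E × List E => (a.2.map d).sum :=
      Computable.list_sum Primrec.nat_add.to_comp
        (Computable.list_map Computable.snd (hd.comp Computable.snd))
    have h2 : Computable fun a : E × List E => ((a.2.map d).sum + 1, (a.2.map d).sum + 2) :=
      (Computable.succ.comp h1).pair (Computable.succ.comp (Computable.succ.comp h1))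
    exact h2
  · rintro _ ⟨w, hw, rfl⟩ n Y hY
    have hw' := hE.exists_eq_unit_of_sigma hk hw
    have hdeg := hE.degLE_sum hd' Y
    have hle : ∀ l, d (Y l) ≤ ((List.ofFn Y).map d).sum := fun l =>
      List.single_le_sum (by simp) _ (List.mem_map_of_mem (by simp [List.mem_ofFn]))
    refine ⟨_, Part.mem_some _, ?_⟩
    dsimp only
    generalize ((List.ofFn Y).map d).sum = s at hdeg hle
    refine ⟨⟨w, hw', rfl⟩, fun m hm => ?_, fun l j hj => ?_, fun c hc x hx =>
      ⟨fun h j hj => ?_, fun h j hj => ?_⟩⟩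
    · rw [hk]
      simp only [IsNormalExp]
      omega
    · have h1 := hle l
      exact hd' (Y l) j (by omega)
    · push_cast at hj
      rcases lt_or_ge j 0 with h0 | h0
      · exact hE.coeffAt_of_not_normal i (by rw [hk]; simpa [IsNormalExp] using h0) x
      · refine hE.coeffAt_eq_zero_of_sigma hs i hk hw' hx (d := s) ?_ j
          (by omega)
        intro j hj
        rw [h]
        exact hdeg c hc j (by omega)
    · push_cast at hj
      exact hE.coeffAt_of_not_normal i (by rw [hk]; simp only [IsNormalExp]; omega) _

end Bounds

/-! ### Equations whose coefficient contains the Π-monomial -/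

section PiStep

variable {F E : Type*} [Field F] [CommRing E] [Algebra F E] {σ : RingAut F} {τ : RingAut E} {e : ℕ}
variable {kind : Fin e → MonomialKind} {t : Fin e → E}

/-- Truncation of the exponents of a monomial. -/
noncomputable def IsRPSExtension.trunc (hE : IsRPSExtension σ τ kind t) (i : Fin e) (D : ℕ) :
    E →ₗ[F] E :=
  ∑ l ∈ Finset.range (2 * D + 1),
    (LinearMap.mulRight F (genPow (t i) ((l : ℤ) - D) (kind i))).comp (hE.coeffAt i ((l : ℤ) - D))

theorem IsRPSExtension.trunc_apply (hE : IsRPSExtension σ τ kind t) (i : Fin e) (D : ℕ) (x : E) :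
    hE.trunc i D x = ((List.range (2 * D + 1)).map fun l : ℕ =>
      hE.coeffAt i ((l : ℤ) - D) x * genPow (t i) ((l : ℤ) - D) (kind i)).sum := by
  rw [trunc, LinearMap.sum_apply]
  rfl

theorem IsRPSExtension.coeffAt_trunc (hE : IsRPSExtension σ τ kind t) {S : Set (Fin e)} {i : Fin e}
    (hi : i ∉ S) (hk : kind i = MonomialKind.pi) {x : E} (hx : x ∈ monAlg F kind t (insert i S))
    (D : ℕ) (j : ℤ) :
    hE.coeffAt i j (hE.trunc i D x) = if j.natAbs ≤ D then hE.coeffAt i j x else 0 := by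
  have hn : ∀ j, IsNormalExp (kind i) j := fun j => by rw [hk]; trivial
  rw [trunc, LinearMap.sum_apply, map_sum]
  have h1 : ∀ l ∈ Finset.range (2 * D + 1), hE.coeffAt i j
      ((LinearMap.mulRight F (genPow (t i) ((l : ℤ) - D) (kind i))).comp
        (hE.coeffAt i ((l : ℤ) - D)) x) = if (l : ℤ) - D = j then hE.coeffAt i j x else 0 := by
    intro l _
    rw [LinearMap.comp_apply, LinearMap.mulRight_apply,
      hE.coeffAt_mul_genPow hi (hE.coeffAt_mem hx _) j (hn _)]
    split_ifs with h
    · rw [h]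
    · rfl
  rw [Finset.sum_congr rfl h1]
  split_ifs with hj
  · rw [Finset.sum_eq_single (j + D).toNat]
    · rw [if_pos (by omega)]
    · intro l _ hl
      rw [if_neg (by omega)]
    · intro h
      rw [Finset.mem_range] at h
      omega
  · refine Finset.sum_eq_zero fun l hl => ?_
    rw [Finset.mem_range] at hl
    rw [if_neg (by omega)]

/-- The elements in which the absolute values of the exponents of a monomial are at most `D`. -/
noncomputable def IsRPSExtension.boundDom (hE : IsRPSExtension σ τ kind t) (S : Set (Fin e))
    (i : Fin e) (D : ℕ) : Submodule (constRing τ) E where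
  carrier := {z | z ∈ monAlg F kind t (insert i S) ∧ hE.DegLE i D z}
  add_mem' := by
    rintro x y ⟨h1, h2⟩ ⟨h3, h4⟩
    exact ⟨add_mem h1 h3, fun j hj => by rw [map_add, h2 j hj, h4 j hj, add_zero]⟩
  zero_mem' := ⟨zero_mem _, fun j _ => map_zero _⟩
  smul_mem' := by
    rintro c x ⟨h1, h2⟩
    refine ⟨(hE.constSub (monAlg F kind t (insert i S))).smul_mem c h1, fun j hj => ?_⟩
    rw [← hE.constLin_apply, map_smul, hE.constLin_apply, h2 j hj, smul_zero]

/-- The approximations of the solution of `τ x - u x = z` by iteration of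
`x ↦ u⁻¹ (τ x - z)`. -/
def iterSol {E : Type*} [CommRing E] (τ : RingAut E) (v : E) : ℕ → E →ₗ[constRing τ] E
  | 0 => 0
  | n + 1 => (LinearMap.mulLeft _ v).comp ((autLin τ).comp (iterSol τ v n) - LinearMap.id)

section

variable {hE : IsRPSExtension σ τ kind t} {S : Set (Fin e)} {i : Fin e} (hi : i ∉ S)
  (hk : kind i = MonomialKind.pi) (hS : IsClosedUnder F τ hE.isMonomialBase S)
  (hcl : ∀ x ∈ monAlg F kind t (insert i S), τ x ∈ monAlg F kind t (insert i S))
  {h : Eˣ} (hh : h ∈ prodGroup F hE.isMonomialBase S) (hτ : τ (t i) = h * t i)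
  {w : Eˣ} (hw : w ∈ prodGroup F hE.isMonomialBase S) {m : ℤ} (hm : m ≠ 0)
  {u : Eˣ} (hu : (u : E) = w * genPow (t i) m (kind i))
include hi hk hS hh hτ hw hu

theorem IsRPSExtension.coeffAt_map_sub {x : E} (hx : x ∈ monAlg F kind t (insert i S)) (j : ℤ) :
    hE.coeffAt i j (τ x - u * x) =
      τ (hE.coeffAt i j x) * ((h ^ j : Eˣ) : E) - w * hE.coeffAt i (j - m) x := by
  rw [map_sub, hE.coeffAt_map_pi hi hS hk hh hτ hx, hu,
    hE.coeffAt_mul_genPow_mul hi (prodGroup_mem_monAlg _ hw) hk m hx]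

include hm in
-- For `m ≠ 0` the equation links the coefficients at `j` and `j - m`. At exponents outside `[-d,
-- d]` the right-hand side vanishes, so the zeros at remote exponents propagate inwards from both
-- ends.
theorem IsRPSExtension.degLE_of_pi {x : E} (hx : x ∈ monAlg F kind t (insert i S)) {d : ℕ}
    (hd : hE.DegLE i d (τ x - u * x)) : hE.DegLE i d x := by
  have key := fun j => hE.coeffAt_map_sub hi hk hS hh hτ hw hu hx j
  have hA : ∀ j : ℤ, d < j.natAbs → hE.coeffAt i (j - m) x = 0 → hE.coeffAt i j x = 0 := by
    intro j hj h0
    have := key j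
    rw [hd j hj, h0, mul_zero, sub_zero, eq_comm, Units.mul_left_eq_zero] at this
    exact (map_eq_zero_iff τ τ.injective).1 this
  have hB : ∀ j : ℤ, d < (j + m).natAbs → hE.coeffAt i (j + m) x = 0 → hE.coeffAt i j x = 0 := by
    intro j hj h0
    have := key (j + m)
    rwa [hd _ hj, h0, map_zero, zero_mul, zero_sub, eq_comm, neg_eq_zero, add_sub_cancel_right,
      Units.mul_right_eq_zero] at this
  obtain ⟨D, hD⟩ := hE.exists_degLE i x
  have hup : ∀ n : ℕ, ∀ j : ℤ, d < j → D < j + n → hE.coeffAt i j x = 0 := by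
    intro n
    induction n with
    | zero => exact fun j _ hj => (hD D le_rfl).1 j (by omega)
    | succ n ih =>
      intro j hj hj'
      rcases lt_or_gt_of_ne hm with h0 | h0
      · exact hA j (by omega) (ih _ (by omega) (by omega))
      · exact hB j (by omega) (ih _ (by omega) (by omega))
  have hdown : ∀ n : ℕ, ∀ j : ℤ, j < -d → j - n < -D → hE.coeffAt i j x = 0 := by
    intro n
    induction n with
    | zero => exact fun j _ hj => (hD D le_rfl).1 j (by omega)
    | succ n ih =>
      intro j hj hj'
      rcases lt_or_gt_of_ne hm with h0 | h0
      · exact hB j (by omega) (ih _ (by omega) (by omega))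
      · exact hA j (by omega) (ih _ (by omega) (by omega))
  intro j hj
  rcases le_or_gt 0 j with h0 | h0
  · exact hup (D + 1) j (by omega) (by omega)
  · exact hdown (D + 1) j (by omega) (by omega)

include hm hcl in
-- The error of the iteration satisfies `x - xₙ₊₁ = u⁻¹ τ (x - xₙ)`, so each step shifts its
-- exponents by `-m`. It starts within `[-D, D]`; after `2 D + 1` steps it has left this interval,
-- and truncation returns exactly `x`.
theorem IsRPSExtension.eq_trunc_iterSol {x : E} (hx : x ∈ monAlg F kind t (insert i S)) {D : ℕ}
    (hD : hE.DegLE i D (τ x - u * x)) :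
    x = hE.trunc i D (iterSol τ ((u⁻¹ : Eˣ) : E) (2 * D + 1) (τ x - u * x)) := by
  have hx' := hE.degLE_of_pi hi hk hS hh hτ hw hm hu hx hD
  have hn : ∀ j, IsNormalExp (kind i) j := fun j => by rw [hk]; trivial
  have hksig : kind i ≠ MonomialKind.sigma := by rw [hk]; exact fun h => by cases h
  have huinv : ((u⁻¹ : Eˣ) : E) = ((w⁻¹ : Eˣ) : E) * genPow (t i) (-m) (kind i) := by
    obtain ⟨s, hs⟩ := (hE.isMonomialBase i).isUnit hksig
    rw [← hs, genPow_unit s _ hksig] at hu ⊢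
    have : u = w * s ^ m := Units.ext hu
    rw [this, mul_inv, Units.val_mul, zpow_neg]
  have hwinv := inv_mem hw
  have hgm : ∀ j, genPow (t i) j (kind i) ∈ monAlg F kind t (insert i S) := fun j => by
    rw [← mon_single]
    exact mon_mem_monAlg hE.isMonomialBase fun k hk => Pi.single_eq_of_ne (fun h => hk (by
      rw [h]; exact Set.mem_insert i S)) _
  have hmem : ((u⁻¹ : Eˣ) : E) ∈ monAlg F kind t (insert i S) := by
    rw [huinv]
    exact mul_mem (monAlg_mono (Set.subset_insert i S) (prodGroup_mem_monAlg _ hwinv)) (hgm _)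
  have hrem : ∀ n : ℕ, x - iterSol τ ((u⁻¹ : Eˣ) : E) n (τ x - u * x) ∈
      monAlg F kind t (insert i S) ∧ ∀ j : ℤ, D < (j + m * n).natAbs →
        hE.coeffAt i j (x - iterSol τ ((u⁻¹ : Eˣ) : E) n (τ x - u * x)) = 0 := by
    intro n
    induction n with
    | zero => exact ⟨by simpa [iterSol] using hx, fun j hj => by
        simpa [iterSol] using hx' j (by simpa using hj)⟩
    | succ n ih =>
      obtain ⟨h1, h2⟩ := ih
      set y := x - iterSol τ ((u⁻¹ : Eˣ) : E) n (τ x - u * x) with hy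
      have h3 : x - iterSol τ ((u⁻¹ : Eˣ) : E) (n + 1) (τ x - u * x) =
          ((u⁻¹ : Eˣ) : E) * τ y := by
        have h4 : ((u⁻¹ : Eˣ) : E) * u = 1 := u.inv_mul
        simp only [iterSol, LinearMap.comp_apply, LinearMap.sub_apply, LinearMap.id_apply,
          autLin_apply, LinearMap.mulLeft_apply, hy, map_sub]
        linear_combination -x * h4
      rw [h3]
      refine ⟨mul_mem hmem (hcl _ h1), fun j hj => ?_⟩
      rw [huinv, hE.coeffAt_mul_genPow_mul hi (prodGroup_mem_monAlg _ hwinv) hk _ (hcl _ h1),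
        hE.coeffAt_map_pi hi hS hk hh hτ h1, h2, map_zero, zero_mul, mul_zero]
      convert hj using 2
      push_cast
      ring
  obtain ⟨h1, h2⟩ := hrem (2 * D + 1)
  have hit : iterSol τ ((u⁻¹ : Eˣ) : E) (2 * D + 1) (τ x - u * x) ∈
      monAlg F kind t (insert i S) := by
    have := sub_mem hx h1
    rwa [sub_sub_cancel] at this
  refine hE.ext_coeffAt i fun j => ?_
  rw [hE.coeffAt_trunc hi hk hit]
  split_ifs with hj
  · have h3 := h2 j (by
      rcases lt_or_gt_of_ne hm with h0 | h0
      · have : m * ((2 * D + 1 : ℕ) : ℤ) ≤ -1 * ((2 * D + 1 : ℕ) : ℤ) :=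
          mul_le_mul_of_nonneg_right (by omega) (by positivity)
        omega
      · have : 1 * ((2 * D + 1 : ℕ) : ℤ) ≤ m * ((2 * D + 1 : ℕ) : ℤ) :=
          mul_le_mul_of_nonneg_right (by omega) (by positivity)
        omega)
    rwa [map_sub, sub_eq_zero] at h3
  · exact hx' j (by omega)

end

end PiStep

/-! ### The solver for a Π-monomial -/

section PiSolver

theorem Computable.list_sum_map_nat {α : Type*} [Primcodable α] {d : α → ℕ} (hd : Computable d) :
    Computable fun l : List α => (l.map d).sum :=
  Computable.list_sum Primrec.nat_add.to_comp
    (Computable.list_map Computable.id (hd.comp Computable.snd))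

variable {F E : Type*} [Field F] [CommRing E] [Algebra F E] {σ : RingAut F} {τ : RingAut E} {e : ℕ}
variable {kind : Fin e → MonomialKind} {t : Fin e → E}
variable [Primcodable F] [Primcodable E] {hE : IsRPSExtension σ τ kind t}

theorem IsEffective.computable_iterSol (hI : IsEffective hE) {α : Type*} [Primcodable α]
    {f g : α → E} {n : α → ℕ} (hf : Computable f) (hn : Computable n) (hg : Computable g) :
    Computable fun a => iterSol τ (f a) (n a) (g a) := by
  suffices h : Computable fun a : (E × ℕ) × E => iterSol τ a.1.1 a.1.2 a.2 from
    h.comp ((hf.pair hn).pair hg)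
  have h1 : Computable₂ fun (a : (E × ℕ) × E) (b : ℕ × E) => a.1.1 * (τ b.2 - a.2) :=
    hI.mul.comp (Computable.fst.comp (Computable.fst.comp Computable.fst))
      (hI.sub.comp (hI.aut.comp (Computable.snd.comp Computable.snd))
        (Computable.snd.comp Computable.fst))
  refine (Computable.nat_rec (f := fun a : (E × ℕ) × E => a.1.2) (g := fun _ => (0 : E))
    (h := fun a b => a.1.1 * (τ b.2 - a.2)) (Computable.snd.comp Computable.fst)
    (Computable.const 0) h1).of_eq ?_
  rintro ⟨⟨v, n⟩, z⟩
  dsimp only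
  induction n with
  | zero => rfl
  | succ n ih =>
    dsimp only
    rw [ih]
    rfl

theorem IsEffective.computable_trunc (hI : IsEffective hE) (i : Fin e) :
    Computable₂ fun (D : ℕ) x => hE.trunc i D x := by
  have h0 : Computable₂ fun (a : ℕ × E) (l : ℕ) => (l : ℤ) - a.1 :=
    Computable.int_sub_nat.comp Computable.snd (Computable.fst.comp Computable.fst)
  have h1 : Computable₂ fun (a : ℕ × E) (l : ℕ) =>
      hE.coeffAt i ((l : ℤ) - a.1) a.2 * genPow (t i) ((l : ℤ) - a.1) (kind i) :=
    hI.mul.comp ((hI.coeffAt i).comp h0 (Computable.snd.comp Computable.fst)) ((hI.pow i).comp h0)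
  have h2 : Computable fun a : ℕ × E => 2 * a.1 + 1 :=
    Computable.succ.comp (Primrec.nat_mul.to_comp.comp (Computable.const 2) Computable.fst)
  refine (Computable.list_sum hI.add (Computable.list_map
    (Primrec.list_range.to_comp.comp h2) h1)).of_eq fun a => ?_
  rw [← hE.trunc_apply]

/-- Inverses of units are found by search; nothing is claimed for non-units. -/
theorem IsEffective.exists_inverse (hI : IsEffective hE) :
    ∃ f : E →. E, Partrec f ∧ ∀ u : Eˣ, ((u⁻¹ : Eˣ) : E) ∈ f u := by
  classical
  have h1 : Computable₂ fun u v : E => decide (u * v = 1) :=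
    Computable.decide_eq hI.mul (Computable.const 1)
  obtain ⟨f, hf, h2, h3⟩ := Computable.exists_search h1
  refine ⟨f, hf, fun u => ?_⟩
  have hd := h3 u ⟨((u⁻¹ : Eˣ) : E), by simp⟩
  obtain ⟨v, hv⟩ : ∃ v, v ∈ f u := ⟨_, Part.get_mem hd⟩
  have h4 := h2 u v hv
  rw [decide_eq_true_eq] at h4
  rw [Units.inv_eq_of_mul_eq_one_right h4]
  exact hv

variable {S : Set (Fin e)} {i : Fin e} (hi : i ∉ S)
  (hk : kind i = MonomialKind.pi) (hS : IsClosedUnder F τ hE.isMonomialBase S)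
  (hcl : ∀ x ∈ monAlg F kind t (insert i S), τ x ∈ monAlg F kind t (insert i S))
  {h : Eˣ} (hh : h ∈ prodGroup F hE.isMonomialBase S) (hτ : τ (t i) = h * t i)
include hi hk hS hcl hh hτ

/-- The case in which the Π-monomial occurs in the coefficient of the equation. -/
theorem IsEffective.solvable_pi_of_ne (hI : IsEffective hE) (hF : IsComputableDifferenceField σ) :
    Solvable (constRing τ) (hE.pfldeSol (insert i S))
      (fun u => ∃ w ∈ prodGroup F hE.isMonomialBase S, ∃ m : ℤ, m ≠ 0 ∧
        u = w * genPow (t i) m (kind i))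
      (fun _ => hE.constSub (monAlg F kind t (insert i S))) := by
  have hksig : kind i ≠ MonomialKind.sigma := by rw [hk]; exact fun h => by cases h
  have hgm : ∀ j, genPow (t i) j (kind i) ∈ monAlg F kind t (insert i S) := fun j => by
    rw [← mon_single]
    exact mon_mem_monAlg hE.isMonomialBase fun k hk => Pi.single_eq_of_ne (fun h => hk (by
      rw [h]; exact Set.mem_insert i S)) _
  -- The parameter consists of `u`, its inverse and a degree bound for the right-hand sides. `R`
  -- gives the only candidate for a solution, and the equation itself is imposed afterwards as a
  -- linear restriction.
  let R : (E × E) × ℕ → E →ₗ[constRing τ] E := fun p =>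
    (hE.constLin (hE.trunc i p.2)).comp (iterSol τ p.1.2 (2 * p.2 + 1))
  have hR : Computable₂ fun p x => R p x := by
    have h2 : Computable fun a : ((E × E) × ℕ) × E => 2 * a.1.2 + 1 :=
      Computable.succ.comp (Primrec.nat_mul.to_comp.comp (Computable.const 2)
        (Computable.snd.comp Computable.fst))
    have h5 : Computable fun a : ((E × E) × ℕ) × E =>
        iterSol τ a.1.1.2 (2 * a.1.2 + 1) a.2 := hI.computable_iterSol (f := fun a : ((E × E) × ℕ) × E => a.1.1.2)
        (n := fun a => 2 * a.1.2 + 1) (g := fun a => a.2)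
        (Computable.snd.comp (Computable.fst.comp Computable.fst)) h2 Computable.snd
    have h3 : Computable fun a : ((E × E) × ℕ) × E =>
        hE.trunc i a.1.2 (iterSol τ a.1.1.2 (2 * a.1.2 + 1) a.2) :=
      (hI.computable_trunc i).comp (Computable.snd.comp Computable.fst) h5
    exact h3
  let valid : (E × E) × ℕ → Prop := fun p => ∃ w ∈ prodGroup F hE.isMonomialBase S, ∃ m : ℤ, m ≠ 0 ∧
    ∃ u : Eˣ, (u : E) = w * genPow (t i) m (kind i) ∧ p.1 = ((u : E), ((u⁻¹ : Eˣ) : E))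
  have hgraph : Solvable (constRing τ) (fun p : (E × E) × ℕ =>
      LinearMap.ker (LinearMap.fst _ _ _ - (R p).comp (LinearMap.snd (constRing τ) E E)))
      valid (fun _ => ⊤) := by
    refine Solvable.of_graph hR fun p _ z _ x => ?_
    rw [LinearMap.mem_ker, LinearMap.sub_apply, sub_eq_zero]
    rfl
  have hres : Solvable (constRing τ) (fun p : (E × E) × ℕ => hE.pfldeSol (insert i S) p.1.1)
      valid (fun p => hE.boundDom S i p.2) := by
    refine hI.solvable_restrict hF hgraph (ρ := fun _ => LinearMap.id) Computable.snd
      (δ := fun p => LinearMap.snd _ _ _ - ((autLin τ - LinearMap.mulLeft _ p.1.1).comp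
        (LinearMap.fst _ _ _))) ?_ (fun _ _ _ _ => trivial) ?_
    · have h : Computable fun p : ((E × E) × ℕ) × E × E => p.2.2 - (τ p.2.1 - p.1.1.1 * p.2.1) :=
        hI.sub.comp (Computable.snd.comp Computable.snd) (hI.sub.comp
          (hI.aut.comp (Computable.fst.comp Computable.snd))
          (hI.mul.comp (Computable.fst.comp (Computable.fst.comp Computable.fst))
            (Computable.fst.comp Computable.snd)))
      exact h
    · rintro ⟨⟨_, _⟩, D⟩ ⟨w, hw, m, hm, u, hu, ⟨⟩⟩ z hz x
      rw [LinearMap.mem_ker, LinearMap.sub_apply, sub_eq_zero]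
      simp only [LinearMap.sub_apply, LinearMap.comp_apply, LinearMap.fst_apply,
        LinearMap.snd_apply, LinearMap.id_apply, autLin_apply, LinearMap.mulLeft_apply, R,
        hE.constLin_apply]
      constructor
      · rintro ⟨h1, h2⟩
        dsimp only at h1 h2
        subst h2
        exact ⟨hE.eq_trunc_iterSol hi hk hS hcl hh hτ hw hm hu h1 hz.2, sub_self _⟩
      · rintro ⟨h1, h2⟩
        refine ⟨?_, (sub_eq_zero.1 h2).symm⟩
        dsimp only
        rw [h1, hE.trunc_apply]
        refine list_sum_mem fun y hy => ?_
        obtain ⟨l, -, rfl⟩ := List.mem_map.1 hy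
        refine mul_mem (monAlg_mono (Set.subset_insert i S) (hE.coeffAt_mem ?_ _)) (hgm _)
        have hmem : ((u⁻¹ : Eˣ) : E) ∈ monAlg F kind t (insert i S) := by
          obtain ⟨s, hs⟩ := (hE.isMonomialBase i).isUnit hksig
          have huw : u = w * s ^ m := Units.ext (by rw [hu, ← hs, genPow_unit s _ hksig]; rfl)
          have h3 : ((s ^ (-m) : Eˣ) : E) ∈ monAlg F kind t (insert i S) := by
            rw [← genPow_unit s _ hksig, hs]; exact hgm _
          rw [huw, mul_inv, Units.val_mul, ← zpow_neg]
          exact mul_mem (monAlg_mono (Set.subset_insert i S)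
            (prodGroup_mem_monAlg _ (inv_mem hw))) h3
        generalize 2 * D + 1 = n
        induction n with
        | zero => exact zero_mem _
        | succ n ih => exact mul_mem hmem (sub_mem (hcl _ ih) hz.1)
  obtain ⟨d, hd, hd'⟩ := hI.degree i
  obtain ⟨f, hf, hf'⟩ := hI.exists_inverse
  refine hres.comap (q := fun a => (f a.1).map fun v => ((a.1, v), (a.2.map d).sum)) ?_ ?_
  · exact (hf.comp Computable.fst).map (((Computable.fst.comp Computable.fst).pair
      Computable.snd).pair ((Computable.list_sum_map_nat hd).comp (Computable.snd.comp Computable.fst)))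
  · rintro _ ⟨w, hw, m, hm, rfl⟩ n Y hY
    obtain ⟨s, hs⟩ := (hE.isMonomialBase i).isUnit hksig
    have hu : ((w * s ^ m : Eˣ) : E) = w * genPow (t i) m (kind i) := by
      rw [← hs, genPow_unit s _ hksig]; rfl
    refine ⟨_, Part.mem_map _ (hu ▸ hf' (w * s ^ m)), ⟨w, hw, m, hm, w * s ^ m, hu, ?_⟩,
      fun l => ⟨hY l, ?_⟩, fun c hc x => Iff.rfl⟩
    · simp only [hu]
    · have h1 : d (Y l) ≤ ((List.ofFn Y).map d).sum :=
        List.single_le_sum (by simp) _ (List.mem_map_of_mem (by simp [List.mem_ofFn]))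
      exact IsRPSExtension.DegLE.mono hE (hd' (Y l)) h1

/-- The case in which the Π-monomial does not occur in the coefficient of the equation. -/
theorem IsEffective.solvable_pi_of_eq (hI : IsEffective hE) (hsolv : hE.SolvableAt S)
    {bound : E →. ℕ} (hb : Partrec bound)
    (hbound : ∀ w ∈ prodGroup F hE.isMonomialBase S, ∃ b ∈ bound (w : E), ∀ x, τ x = w * x →
      hE.DegLE i b x) :
    Solvable (constRing τ) (hE.pfldeSol (insert i S))
      (fun u => ∃ w ∈ prodGroup F hE.isMonomialBase S, u = w)
      (fun _ => hE.constSub (monAlg F kind t (insert i S))) := by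
  have hksig : kind i ≠ MonomialKind.sigma := by rw [hk]; exact fun h => by cases h
  have hn : ∀ j, IsNormalExp (kind i) j := fun j => by rw [hk]; trivial
  obtain ⟨d, hd, hd'⟩ := hI.degree i
  -- With degree `s` of the right-hand sides and bound `b` for homogeneous solutions, the window is
  -- `[-(s + b), s + b]`.
  refine hI.solvable_of_bound hi hh ?_ hcl hsolv
    (bd := fun a => (bound a.1).map fun b =>
      ((a.2.map d).sum + b, 2 * ((a.2.map d).sum + b) + 1)) ?_ ?_
  · intro x hx j hj j' _
    have hxj : x * genPow (t i) j (kind i) ∈ monAlg F kind t (insert i S) :=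
      mul_mem (monAlg_mono (Set.subset_insert i S) hx) (by
        rw [← mon_single]
        exact mon_mem_monAlg hE.isMonomialBase fun k hk => Pi.single_eq_of_ne (fun h => hk (by
          rw [h]; exact Set.mem_insert i S)) _)
    rw [hE.coeffAt_map_pi hi hS hk hh hτ hxj, hE.coeffAt_mul_genPow hi hx j' hj]
    split_ifs with h1
    · rw [h1]
    · rw [map_zero, zero_mul]
  · have h1 : Computable₂ fun (a : E × List E) (b : ℕ) => (a.2.map d).sum + b :=
      Primrec.nat_add.to_comp.comp ((Computable.list_sum_map_nat hd).comp
        (Computable.snd.comp Computable.fst)) Computable.snd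
    have h2 : Computable₂ fun (a : E × List E) (b : ℕ) => 2 * ((a.2.map d).sum + b) + 1 :=
      Computable.succ.comp (Primrec.nat_mul.to_comp.comp (Computable.const 2) h1)
    have h3 : Computable₂ fun (a : E × List E) (b : ℕ) =>
        ((a.2.map d).sum + b, 2 * ((a.2.map d).sum + b) + 1) := Computable.pair h1 h2
    exact (hb.comp Computable.fst).map h3
  · rintro _ ⟨w, hw, rfl⟩ n Y hY
    obtain ⟨b, hb, hb'⟩ := hbound w hw
    have hdeg := hE.degLE_sum hd' Y
    have hle : ∀ l, d (Y l) ≤ ((List.ofFn Y).map d).sum := fun l =>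
      List.single_le_sum (by simp) _ (List.mem_map_of_mem (by simp [List.mem_ofFn]))
    refine ⟨_, Part.mem_map _ hb, ?_⟩
    dsimp only
    generalize ((List.ofFn Y).map d).sum = s at hdeg hle
    refine ⟨⟨w, hw, rfl⟩, fun _ _ => hn _, fun l j hj => ?_, fun c hc x hx =>
      ⟨fun h1 j hj => ?_, fun h1 j hj => ?_⟩⟩
    · have h1 := hle l
      exact hd' (Y l) j (by omega)
    -- Outside the window the right-hand side has no coefficient, so the term of `x` with exponent
    -- `j` solves the homogeneous equation by itself, and the bound `b` applies to it.
    · have h2 : τ (hE.coeffAt i j x) * ((h ^ j : Eˣ) : E) = w * hE.coeffAt i j x := by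
        have h3 := congrArg (hE.coeffAt i j) h1
        rwa [hdeg c hc j (by push_cast at hj; omega), map_sub, hE.coeffAt_map_pi hi hS hk hh hτ hx,
          hE.coeffAt_mul hi (prodGroup_mem_monAlg _ hw) hx, sub_eq_zero] at h3
      have h4 := hb' (hE.coeffAt i j x * genPow (t i) j (kind i)) (by
        rw [map_mul, map_genPow_of_unit ((hE.isMonomialBase i).isUnit hksig) hksig hτ]
        linear_combination genPow (t i) j (kind i) * h2) j (by push_cast at hj; omega)
      rwa [hE.coeffAt_mul_genPow hi (hE.coeffAt_mem hx j) j (hn j), if_pos rfl] at h4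
    · have h2 := h1 j (by push_cast at hj ⊢; omega)
      rw [map_sub, map_sub, hE.coeffAt_map_pi hi hS hk hh hτ hx,
        hE.coeffAt_mul hi (prodGroup_mem_monAlg _ hw) hx, h2, hdeg c hc j (by push_cast at hj; omega)]
      simp

theorem IsEffective.solvableAt_insert_pi (hI : IsEffective hE) (hF : IsComputableDifferenceField σ)
    (hsolv : hE.SolvableAt S) {bound : E →. ℕ} (hb : Partrec bound)
    (hbound : ∀ w ∈ prodGroup F hE.isMonomialBase S, ∃ b ∈ bound (w : E), ∀ x, τ x = w * x →
      hE.DegLE i b x) : hE.SolvableAt (insert i S) := by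
  classical
  have hn : ∀ j, IsNormalExp (kind i) j := fun j => by rw [hk]; trivial
  -- For `u = w * t ^ m` the coefficient at the exponent `0` is nonzero exactly when `m = 0`.
  have htest : Computable fun u : E => decide (hE.coeffAt i 0 u = 0) :=
    Computable.decide_eq ((hI.coeffAt i).comp (Computable.const 0) Computable.id)
      (Computable.const 0)
  obtain ⟨a₁, ha₁, h₁⟩ := hI.solvable_pi_of_ne hi hk hS hcl hh hτ hF
  obtain ⟨a₂, ha₂, h₂⟩ := hI.solvable_pi_of_eq hi hk hS hcl hh hτ hsolv hb hbound
  refine Solvable.cond htest ⟨a₁, ha₁, ?_⟩ ⟨a₂, ha₂, ?_⟩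
  · rintro _ ⟨⟨u, hu, rfl⟩, h0⟩
    refine h₁ _ ?_
    obtain ⟨w, hw, m, -, hm⟩ := IsRPSExtension.split_unit hE.isMonomialBase hu
    refine ⟨w, hw, m, ?_, hm⟩
    rintro rfl
    rw [decide_eq_true_eq, hm, hE.coeffAt_mul_genPow hi (prodGroup_mem_monAlg _ hw) _ (hn _),
      if_pos rfl] at h0
    have := hE.injective.nontrivial
    exact w.ne_zero h0
  · rintro _ ⟨⟨u, hu, rfl⟩, h0⟩
    refine h₂ _ ?_
    obtain ⟨w, hw, m, -, hm⟩ := IsRPSExtension.split_unit hE.isMonomialBase hu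
    rw [decide_eq_false_iff_not, hm, hE.coeffAt_mul_genPow hi (prodGroup_mem_monAlg _ hw) _ (hn _),
      ite_eq_right_iff, Classical.not_imp] at h0
    refine ⟨w, hw, ?_⟩
    rw [hm, h0.1, genPow_zero, mul_one]

end PiSolver

/-! ### Exponents of semi-constants -/

section FieldPeriod

/-- The solution is `g = P / Y` with `P = ∏ (σ ^ j) q` and `Y` the product of the norms of `b` of
length `j`, over `j < k`. Telescoping gives `σ P / P = (σ ^ k) q / q`, the norm of `b` of length
`k`, and `σ Y / Y` is this norm divided by `b ^ k`. -/
theorem exists_period_root {F : Type*} [Field F] (σ : RingAut F) {b q : F} (hb : b ≠ 0)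
    (hq : q ≠ 0) {k : ℕ} (h : (σ ^ k) q = iterProd σ b k * q) : ∃ g ≠ 0, σ g = b ^ k * g := by
  have hne : ∀ x : F, x ≠ 0 → ∀ j : ℕ, (σ ^ j) x ≠ 0 := fun x hx j =>
    (map_ne_zero_iff _ (σ ^ j).injective).2 hx
  have hP : ∀ n : ℕ, σ (∏ j ∈ Finset.range n, (σ ^ j) q) * q =
      (∏ j ∈ Finset.range n, (σ ^ j) q) * (σ ^ n) q := by
    intro n
    induction n with
    | zero => simp
    | succ n ih =>
      have h1 : (σ ^ (n + 1)) q = σ ((σ ^ n) q) := by rw [pow_succ']; rfl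
      rw [Finset.prod_range_succ, map_mul, h1]
      linear_combination σ ((σ ^ n) q) * ih
  have hy : ∀ j : ℕ, b * σ (iterProd σ b j) = iterProd σ b j * (σ ^ j) b := fun j => by
    rw [← iterProd_succ, iterProd, Finset.prod_range_succ]; rfl
  have hY : ∀ n : ℕ, b ^ n * σ (∏ j ∈ Finset.range n, iterProd σ b j) =
      (∏ j ∈ Finset.range n, iterProd σ b j) * iterProd σ b n := by
    intro n
    induction n with
    | zero => simp [iterProd]
    | succ n ih =>
      have h1 : iterProd σ b (n + 1) = iterProd σ b n * (σ ^ n) b := by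
        rw [iterProd, Finset.prod_range_succ]; rfl
      rw [Finset.prod_range_succ, map_mul, h1]
      linear_combination (b * σ (iterProd σ b n)) * ih +
        (∏ j ∈ Finset.range n, iterProd σ b j) * iterProd σ b n * hy n
  have hi : ∀ n, iterProd σ b n ≠ 0 := fun n => Finset.prod_ne_zero_iff.2 fun j _ => hne b hb j
  have hP0 : ∏ j ∈ Finset.range k, (σ ^ j) q ≠ 0 := Finset.prod_ne_zero_iff.2 fun j _ => hne q hq j
  have hY0 : ∏ j ∈ Finset.range k, iterProd σ b j ≠ 0 := Finset.prod_ne_zero_iff.2 fun j _ => hi j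
  have h1 := hP k
  have h2 := hY k
  set P := ∏ j ∈ Finset.range k, (σ ^ j) q
  set Y := ∏ j ∈ Finset.range k, iterProd σ b j
  refine ⟨P / Y, div_ne_zero hP0 hY0, ?_⟩
  have h3 : σ Y ≠ 0 := (map_ne_zero_iff _ σ.injective).2 hY0
  have h4 : σ P = P * iterProd σ b k := mul_right_cancel₀ hq (by rw [h1, h]; ring)
  rw [map_div₀, h4]
  field_simp
  linear_combination -h2

theorem zpowInv_eq_zpow {F : Type*} [Field F] {a : F} (ha : a ≠ 0) (m : ℤ) :
    zpowInv a m = a ^ m := by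
  have := zpowInv_units (Units.mk0 a ha) m
  simpa using this

end FieldPeriod

/-! ### Multiplicative relations between the factors of Π-monomials -/

section PiExponents

variable {F E : Type*} [Field F] [CommRing E] [Algebra F E] {σ : RingAut F} {τ : RingAut E} {e : ℕ}
variable {kind : Fin e → MonomialKind} {t : Fin e → E}

/-- The exponents of the Π-monomials. -/
noncomputable def piPart (kind : Fin e → MonomialKind) : (Fin e → ℤ) →ₗ[ℤ] (Fin e → ℤ) :=
  LinearMap.pi fun i => open Classical in
    if kind i = MonomialKind.pi then LinearMap.proj i else 0

theorem piPart_pi {i : Fin e} (hi : kind i = MonomialKind.pi) (m : Fin e → ℤ) :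
    piPart kind m i = m i := by simp [piPart, hi]

theorem piPart_of_ne {i : Fin e} (hi : kind i ≠ MonomialKind.pi) (m : Fin e → ℤ) :
    piPart kind m i = 0 := by simp [piPart, hi]

theorem piPart_eq_self {m : Fin e → ℤ} (hm : ∀ i, kind i ≠ MonomialKind.pi → m i = 0) :
    piPart kind m = m := by
  ext i
  by_cases hi : kind i = MonomialKind.pi
  · rw [piPart_pi hi]
  · rw [piPart_of_ne hi, hm i hi]

theorem mem_groupExps_of_pi {m : Fin e → ℤ} (hm : ∀ i, kind i ≠ MonomialKind.pi → m i = 0) :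
    m ∈ groupExps kind Set.univ :=
  ⟨fun i hi => hm i (by rw [hi]; exact fun h => by cases h), fun i hi => absurd trivial hi⟩

theorem piPart_mem {m : Fin e → ℤ} : piPart kind m ∈ groupExps kind Set.univ :=
  mem_groupExps_of_pi fun _ hi => piPart_of_ne hi m

theorem mem_groupExps_rootSet {m : Fin e → ℤ} (hm : m ∈ groupExps kind Set.univ)
    (h : piPart kind m = 0) : m ∈ groupExps kind (rootSet kind) := by
  refine ⟨hm.1, fun i hi => ?_⟩
  rcases hk : kind i with l | _ | _
  · exact absurd ⟨l, hk⟩ hi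
  · rw [← piPart_pi hk m, h]; rfl
  · exact hm.1 i hk

theorem unit_zpow_eq_smul_mon (hb : ∀ i, IsMonomialBase (t i) (kind i)) {u : Eˣ} {a : F}
    (ha : a ≠ 0) {n : Fin e → ℤ} {S : Set (Fin e)} (hn : n ∈ groupExps kind S)
    (hu : (u : E) = a • mon kind t n) (k : ℤ) :
    ((u ^ k : Eˣ) : E) = a ^ k • mon kind t (k • n) := by
  have hinv : ((u⁻¹ : Eˣ) : E) = a⁻¹ • mon kind t (-n) := by
    refine Units.inv_eq_of_mul_eq_one_right ?_
    rw [hu, smul_mul_smul_comm, mul_inv_cancel₀ ha, mon_mul_neg hb hn, one_smul]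
  induction k using Int.induction_on with
  | zero => simp
  | succ k ih =>
    rw [zpow_add_one, Units.val_mul, ih, hu, smul_mul_smul_comm, ← zpow_add_one₀ ha,
      ← mon_add_group hb (zsmul_mem hn _) hn, add_smul, one_smul]
  | pred k ih =>
    rw [zpow_sub_one, Units.val_mul, ih, hinv, smul_mul_smul_comm, ← zpow_sub_one₀ ha,
      ← mon_add_group hb (zsmul_mem hn _) (neg_mem hn), sub_smul, one_smul,
      sub_eq_add_neg (-(k : ℤ) • n) n]

/-- The factors `τ(tᵢ)/tᵢ` of the Π-monomials, as members of the product group. -/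
structure PiFactors (hE : IsRPSExtension σ τ kind t) where
  a : Fin e → F
  n : Fin e → Fin e → ℤ
  a_ne : ∀ i, a i ≠ 0
  n_mem : ∀ i, n i ∈ groupExps kind Set.univ
  map : ∀ i, kind i = MonomialKind.pi → τ (t i) = (a i • mon kind t (n i)) * t i
  -- The trivial values at other indices let products and sums run over all indices and depend only
  -- on the exponents of the Π-monomials.
  a_of_ne : ∀ i, kind i ≠ MonomialKind.pi → a i = 1
  n_of_ne : ∀ i, kind i ≠ MonomialKind.pi → n i = 0

theorem IsSimpleExtension.nonempty_piFactors (hs : IsSimpleExtension F τ kind t)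
    (hE : IsRPSExtension σ τ kind t) : Nonempty (PiFactors hE) := by
  have h : ∀ i, ∃ (a : F) (n : Fin e → ℤ), a ≠ 0 ∧ n ∈ groupExps kind Set.univ ∧
      (kind i = MonomialKind.pi → τ (t i) = (a • mon kind t n) * t i) ∧
      (kind i ≠ MonomialKind.pi → a = 1) ∧ (kind i ≠ MonomialKind.pi → n = 0) := by
    intro i
    by_cases hi : kind i = MonomialKind.pi
    · obtain ⟨w, ⟨a, ha, n, hn, hw⟩, hτ⟩ := IsSimpleExtension.exists_factor hE hs (i := i)
        (by rw [hi]; exact fun h => by cases h)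
      exact ⟨a, n, ha, hn, fun _ => by rw [hτ, hw], fun h => absurd hi h, fun h => absurd hi h⟩
    · exact ⟨1, 0, one_ne_zero, zero_mem _, fun h => absurd h hi, fun _ => rfl, fun _ => rfl⟩
  choose a n h1 h2 h3 h4 h5 using h
  exact ⟨⟨a, n, h1, h2, h3, h4, h5⟩⟩

section

variable {hE : IsRPSExtension σ τ kind t} (d : PiFactors hE)

/-- The part in `F` of `τ(P)/P` for a product `P` of powers of Π-monomials. -/
noncomputable def PiFactors.base (m : Fin e → ℤ) : F := ∏ i, d.a i ^ m i

/-- The exponents of `τ(P)/P` for a product `P` of powers of Π-monomials. -/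
def PiFactors.exps : (Fin e → ℤ) →ₗ[ℤ] (Fin e → ℤ) :=
  ∑ i, (LinearMap.toSpanSingleton ℤ (Fin e → ℤ) (d.n i)).comp (LinearMap.proj i)

theorem PiFactors.exps_apply (m : Fin e → ℤ) : d.exps m = ∑ i, m i • d.n i := by
  simp [exps, LinearMap.sum_apply]

theorem PiFactors.exps_mem (m : Fin e → ℤ) : d.exps m ∈ groupExps kind Set.univ := by
  rw [exps_apply]
  exact sum_mem fun i _ => zsmul_mem (d.n_mem i) _

theorem PiFactors.base_ne (m : Fin e → ℤ) : d.base m ≠ 0 :=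
  Finset.prod_ne_zero_iff.2 fun i _ => zpow_ne_zero _ (d.a_ne i)

theorem PiFactors.base_piPart (m : Fin e → ℤ) : d.base (piPart kind m) = d.base m := by
  refine Finset.prod_congr rfl fun i _ => ?_
  by_cases hi : kind i = MonomialKind.pi
  · rw [piPart_pi hi]
  · rw [d.a_of_ne i hi, one_zpow, one_zpow]

theorem PiFactors.exps_piPart (m : Fin e → ℤ) : d.exps (piPart kind m) = d.exps m := by
  rw [exps_apply, exps_apply]
  refine Finset.sum_congr rfl fun i _ => ?_
  by_cases hi : kind i = MonomialKind.pi
  · rw [piPart_pi hi]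
  · rw [d.n_of_ne i hi, smul_zero, smul_zero]

theorem PiFactors.map_mon {m : Fin e → ℤ} (hm : ∀ i, kind i ≠ MonomialKind.pi → m i = 0) :
    τ (mon kind t m) = (d.base m • mon kind t (d.exps m)) * mon kind t m := by
  choose u hu hu' using fun i => exists_prodGroup hE.isMonomialBase (d.a_ne i) (d.n_mem i)
  have h1 : ∀ i, τ (genPow (t i) (m i) (kind i)) =
      ((u i ^ m i : Eˣ) : E) * genPow (t i) (m i) (kind i) := by
    intro i
    by_cases hi : kind i = MonomialKind.pi
    · have hk : kind i ≠ MonomialKind.sigma := by rw [hi]; exact fun h => by cases h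
      exact map_genPow_of_unit ((hE.isMonomialBase i).isUnit hk) hk (by rw [d.map i hi, hu']) _
    · simp [hm i hi]
  have h2 : ∀ s : Finset (Fin e), ∏ i ∈ s, ((u i ^ m i : Eˣ) : E) =
      (∏ i ∈ s, d.a i ^ m i) • mon kind t (∑ i ∈ s, m i • d.n i) := by
    classical
    intro s
    induction s using Finset.induction_on with
    | empty => simp
    | insert i s hi ih =>
      rw [Finset.prod_insert hi, Finset.prod_insert hi, Finset.sum_insert hi, ih,
        unit_zpow_eq_smul_mon hE.isMonomialBase (d.a_ne i) (d.n_mem i) (hu' i),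
        smul_mul_smul_comm, mon_add_group hE.isMonomialBase (zsmul_mem (d.n_mem i) _)
          (sum_mem fun i _ => zsmul_mem (d.n_mem i) _)]
  rw [base, exps_apply, ← h2, mon, map_prod, ← Finset.prod_mul_distrib]
  exact Finset.prod_congr rfl fun i _ => h1 i

/-- The multiplicative relations that semi-constants for `a • mon kind t m` lead to. -/
def PiFactors.IsRelation (a : F) (x : ℤ) (z : Fin e → ℤ) : Prop :=
  ∃ g : F, g ≠ 0 ∧ σ g = a ^ x * (d.base z)⁻¹ * g

/-- The element `g P`, with `P` the product of Π-monomials with exponents `z`, is multiplied by `τ`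
with a product of R-monomials. A suitable power of it is therefore a constant, lies in `F`, and
contains no Π-monomial. -/
theorem PiFactors.piPart_eq_zero {z : Fin e → ℤ} {g : F} (hg : g ≠ 0)
    (h : σ g = (d.base z)⁻¹ * g) (h0 : piPart kind (d.exps z) = 0) : piPart kind z = 0 := by
  obtain ⟨l, hl, hpow⟩ := exists_mon_pow_eq_one hE.isMonomialBase
  have h1 := d.map_mon fun i hi => piPart_of_ne hi z
  rw [d.base_piPart, d.exps_piPart] at h1
  have hroot := hpow _ (mem_groupExps_rootSet (d.exps_mem z) h0)
  have h2 : τ ((g • mon kind t (piPart kind z)) ^ l) = (g • mon kind t (piPart kind z)) ^ l := by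
    rw [map_pow, Algebra.smul_def, map_mul, hE.extends_aut, h, h1]
    have h3 : algebraMap F E ((d.base z)⁻¹ * g) * (d.base z • mon kind t (d.exps z) *
        mon kind t (piPart kind z)) = mon kind t (d.exps z) *
          (algebraMap F E g * mon kind t (piPart kind z)) := by
      have h4 : algebraMap F E (d.base z)⁻¹ * algebraMap F E (d.base z) = 1 := by
        rw [← map_mul, inv_mul_cancel₀ (d.base_ne z), map_one]
      rw [map_mul, Algebra.smul_def]
      linear_combination algebraMap F E g * mon kind t (d.exps z) *
        mon kind t (piPart kind z) * h4
    rw [h3, mul_pow, hroot, one_mul]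
  obtain ⟨a, -, ha⟩ := hE.const_mem h2
  have h5 : mon kind t (piPart kind z) ^ l = mon kind t (l • piPart kind z) := by
    clear hpow hroot h2 ha
    induction l with
    | zero => simp
    | succ l ih =>
      rcases Nat.eq_zero_or_pos l with rfl | h0
      · simp
      · rw [pow_succ, ih h0, add_smul, one_smul,
          mon_add_group hE.isMonomialBase (nsmul_mem piPart_mem _) piPart_mem]
  rw [smul_pow, h5, Algebra.algebraMap_eq_smul_one, ← mon_zero (kind := kind) (t := t)] at ha
  have h6 := (hE.smul_mon_eq (pow_ne_zero l hg) ha).1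
  ext i
  by_cases hi : kind i = MonomialKind.pi
  · have h7 := congrFun h6 i
    simp only [normalizeExp, hi, normalExp, Pi.smul_apply, Pi.zero_apply, nsmul_eq_mul,
      mul_eq_zero, Nat.cast_eq_zero] at h7
    exact h7.resolve_left hl.ne'
  · exact piPart_of_ne hi z

end

end PiExponents

/-! ### Exponents of semi-constants from multiplicative relations -/

section ExponentBounds

/-- Over `ℚ`, the functional `X` vanishes on the common kernel of the functionals in `W`, so it is a
combination of them; clearing denominators gives `q` and `p`. This is the alternative that makes the
later search terminate. -/
theorem exists_integer_relation {r s : ℕ} (X : Fin r → ℤ) (W : Fin r → Fin s → ℤ)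
    (h : ∀ κ : Fin r → ℤ, (∀ j, ∑ l, κ l * W l j = 0) → ∑ l, κ l * X l = 0) :
    ∃ q : ℤ, q ≠ 0 ∧ ∃ p : Fin s → ℤ, ∀ l, q * X l = ∑ j, p j * W l j := by
  have hclear : ∀ {n : ℕ} (f : Fin n → ℚ), ∃ D : ℤ, D ≠ 0 ∧ ∃ f' : Fin n → ℤ,
      ∀ l, (D : ℚ) * f l = f' l := by
    intro n f
    obtain ⟨b, hb⟩ := IsLocalization.exist_integer_multiples_of_finite (nonZeroDivisors ℤ) f
    choose f' hf' using hb
    refine ⟨b, nonZeroDivisors.ne_zero b.2, f', fun l => ?_⟩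
    rw [← eq_intCast (algebraMap ℤ ℚ) (f' l), hf' l, Algebra.smul_def]
    simp
  let L : (Fin r → ℤ) → (Fin r → ℚ) →ₗ[ℚ] ℚ := fun w =>
    ∑ l, (w l : ℚ) • LinearMap.proj l
  have hL : ∀ w κ, L w κ = ∑ l, κ l * w l := by
    intro w κ
    simp [L, LinearMap.sum_apply, mul_comm]
  have hker : ⨅ j, LinearMap.ker (L fun l => W l j) ≤ LinearMap.ker (L X) := by
    intro κ hκ
    rw [Submodule.mem_iInf] at hκ
    -- The hypothesis concerns integer vectors only, so the rational vector `κ` is scaled.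
    obtain ⟨D, hD, κ', hκ'⟩ := hclear κ
    have hD' : (D : ℚ) ≠ 0 := by exact_mod_cast hD
    have hmul : ∀ w : Fin r → ℤ, (D : ℚ) * L w κ = ((∑ l, κ' l * w l : ℤ) : ℚ) := by
      intro w
      rw [hL, Finset.mul_sum]
      push_cast
      exact Finset.sum_congr rfl fun l _ => by rw [← hκ', mul_assoc]
    have h1 := h κ' fun j => by
      have h2 := hmul fun l => W l j
      rw [LinearMap.mem_ker.1 (hκ j), mul_zero] at h2
      exact_mod_cast h2.symm
    have h3 := hmul X
    rw [h1, Int.cast_zero, mul_eq_zero] at h3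
    exact h3.resolve_left hD'
  have hmem := mem_span_of_iInf_ker_le_ker hker
  rw [Submodule.mem_span_range_iff_exists_fun] at hmem
  obtain ⟨c, hc⟩ := hmem
  obtain ⟨q, hq, p, hp⟩ := hclear c
  refine ⟨q, hq, p, fun l => ?_⟩
  have h1 := congrArg (fun f => (q : ℚ) * f (Pi.single l 1)) hc
  simp only [LinearMap.sum_apply, LinearMap.smul_apply, hL, smul_eq_mul, Pi.single_apply, ite_mul,
    one_mul, zero_mul, Finset.sum_ite_eq', Finset.mem_univ, if_true, Finset.mul_sum] at h1
  have h2 : ∑ j, (p j : ℚ) * (W l j : ℚ) = (q : ℚ) * (X l : ℚ) := by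
    rw [← h1]
    exact Finset.sum_congr rfl fun j _ => by rw [← hp, mul_assoc]
  exact_mod_cast h2.symm

variable {F E : Type*} [Field F] [CommRing E] [Algebra F E] {σ : RingAut F} {τ : RingAut E} {e : ℕ}
variable {kind : Fin e → MonomialKind} {t : Fin e → E}
variable {hE : IsRPSExtension σ τ kind t}

theorem IsRPSExtension.coeffAt_mul_mon (hE : IsRPSExtension σ τ kind t) {y : E}
    (hy : y ∈ monAlg F kind t (rootSet kind)) {i : Fin e} (hi : kind i = MonomialKind.pi)
    {p : Fin e → ℤ} (hp : ∀ i, kind i ≠ MonomialKind.pi → p i = 0) (j : ℤ) :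
    hE.coeffAt i j (y * mon kind t p) =
      if p i = j then y * mon kind t (Function.update p i 0) else 0 := by
  have hn : ∀ j, IsNormalExp (kind i) j := fun j => by rw [hi]; trivial
  have h1 : mon kind t p =
      mon kind t (Function.update p i 0) * genPow (t i) (p i) (kind i) := by
    rw [hE.mon_update_mul i (fun k hk => ?_) (by simp) (hn _), Function.update_idem,
      Function.update_eq_self]
    by_cases h : k = i
    · subst h; simp
    · rw [Function.update_of_ne h, hp k (by rw [hk]; exact fun h => by cases h)]
  have hroot : rootSet kind ⊆ {k | k ≠ i} := by
    rintro k ⟨l, hl⟩ rfl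
    rw [hi] at hl
    cases hl
  have h2 : mon kind t (Function.update p i 0) ∈ monAlg F kind t {k | k ≠ i} :=
    mon_mem_monAlg hE.isMonomialBase fun k hk => by
      obtain rfl : k = i := not_not.1 hk
      simp
  rw [h1, ← mul_assoc, hE.coeffAt_mul_genPow (S := {k | k ≠ i}) (by simp)
    (mul_mem (monAlg_mono hroot hy) h2) j (hn _)]

/-- A nonzero exponent `p i` would give a nonzero coefficient at `t i ^ p i`, which the subring of
the R-monomials does not have. -/
theorem IsRPSExtension.eq_zero_of_mul_mon_mem (hE : IsRPSExtension σ τ kind t) {y : E}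
    (hy : y ∈ monAlg F kind t (rootSet kind)) (h0 : y ≠ 0) {p : Fin e → ℤ}
    (hp : ∀ i, kind i ≠ MonomialKind.pi → p i = 0)
    (h : y * mon kind t p ∈ monAlg F kind t (rootSet kind)) : p = 0 := by
  ext i
  by_cases hi : kind i = MonomialKind.pi
  · by_contra hpi
    have hpi' : (0 : ℤ) ≠ p i := fun h => hpi h.symm
    have hroot : i ∉ rootSet kind := by
      rintro ⟨l, hl⟩
      rw [hi] at hl
      cases hl
    have h1 := hE.coeffAt_mul_mon hy hi hp (p i)
    rw [hE.coeffAt_of_mem hroot h, if_neg hpi', if_pos rfl] at h1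
    have hp' : Function.update p i 0 ∈ groupExps kind Set.univ :=
      mem_groupExps_of_pi fun k hk => by
        rw [Function.update_apply, hp k hk, ite_self]
    apply h0
    have h2 := mon_mul_neg hE.isMonomialBase hp'
    calc y = y * mon kind t (Function.update p i 0) * mon kind t (-Function.update p i 0) := by
          rw [mul_assoc, h2, mul_one]
      _ = 0 := by rw [← h1, zero_mul]
  · exact hp i hi

variable (d : PiFactors hE)

theorem PiFactors.base_add (m m' : Fin e → ℤ) : d.base (m + m') = d.base m * d.base m' := by
  rw [base, base, base, ← Finset.prod_mul_distrib]
  exact Finset.prod_congr rfl fun i _ => zpow_add₀ (d.a_ne i) _ _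

theorem PiFactors.base_zsmul (k : ℤ) (m : Fin e → ℤ) : d.base (k • m) = d.base m ^ k := by
  rw [base, base, ← Finset.prod_zpow]
  exact Finset.prod_congr rfl fun i _ => by
    rw [Pi.smul_apply, smul_eq_mul, mul_comm, zpow_mul]

theorem PiFactors.IsRelation.add {a : F} (ha : a ≠ 0) {x y : ℤ} {z w : Fin e → ℤ}
    (h : d.IsRelation a x z) (h' : d.IsRelation a y w) : d.IsRelation a (x + y) (z + w) := by
  obtain ⟨g, hg, h⟩ := h
  obtain ⟨g', hg', h'⟩ := h'
  refine ⟨g * g', mul_ne_zero hg hg', ?_⟩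
  rw [map_mul, h, h', d.base_add, zpow_add₀ ha, mul_inv]
  ring

theorem PiFactors.IsRelation.zsmul {a : F} {x : ℤ} {z : Fin e → ℤ}
    (h : d.IsRelation a x z) (k : ℤ) : d.IsRelation a (k * x) (k • z) := by
  obtain ⟨g, hg, h⟩ := h
  refine ⟨g ^ k, zpow_ne_zero _ hg, ?_⟩
  rw [map_zpow₀, h, d.base_zsmul, mul_zpow, mul_zpow, inv_zpow, mul_comm k x, zpow_mul]

variable [CharZero F]

/-- A semi-constant is `γ P` with `γ` from the R-monomials and `P` the product of Π-monomials with
exponents `m`. Comparing Π-monomials in the equation gives equal exponents in `d.exps m` and `μ`,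
and up to R-monomials `τ γ = c γ` with `c = a / d.base m`. The `l`-th power removes the R-monomials.
Since `τ ^ k` acts on coefficients as `σ ^ k`, a nonzero coefficient of `γ ^ l` and
`exists_period_root` show that `c ^ (l * k)` is of the form `σ g / g`. -/
theorem PiFactors.exists_relation (hs : IsSimpleExtension F τ kind t)
    (hper : ∀ i ∈ rootSet kind, ∃ p > 0, τ^[p] (t i) = t i) :
    ∃ N : ℤ, N ≠ 0 ∧ ∀ (a : F) (μ : Fin e → ℤ), a ≠ 0 → μ ∈ groupExps kind Set.univ →
      ∀ x, x ≠ 0 → τ x = (a • mon kind t μ) * x →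
      ∃ m : Fin e → ℤ, piPart kind (d.exps m) = piPart kind μ ∧ d.IsRelation a N (N • m) ∧
        ∀ i, kind i = MonomialKind.pi → ∀ j, m i ≠ j → hE.coeffAt i j x = 0 := by
  obtain ⟨k, hk, hk1, -⟩ := hE.exists_good_power hs hper
  obtain ⟨l, hl, hpow⟩ := exists_mon_pow_eq_one hE.isMonomialBase
  -- The factor `l` kills products of R-monomials; the factor `k` is the price for returning from `σ
  -- ^ k` to `σ`.
  refine ⟨(l * k : ℕ), by positivity, fun a μ ha hμ x hx0 hx => ?_⟩
  obtain ⟨u, hu, hu'⟩ := exists_prodGroup hE.isMonomialBase ha hμ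
  have hlev : level kind e = Set.univ := level_top
  obtain ⟨γ, hγ, m, hm, -, rfl, hunit⟩ := hE.semiconst hs (k := e) le_rfl (x := x)
    (by rw [hlev, hE.monAlg_univ]; trivial) hx0 (by rw [hlev]; exact hu) (by rw [hx, hu'])
  have hcl : τ γ ∈ monAlg F kind t (rootSet kind) := by
    have := IsSimpleExtension.isClosedUnder_level hE hs 0
    rw [level_zero] at this
    exact this.map_monAlg hE.extends_aut hγ
  have hγu : IsUnit γ := isUnit_of_mul_isUnit_left hunit
  have hnt : Nontrivial E := hE.injective.nontrivial
  set c := a * (d.base m)⁻¹ with hc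
  have hc0 : c ≠ 0 := mul_ne_zero ha (inv_ne_zero (d.base_ne m))
  have hdm : d.exps m - μ ∈ groupExps kind Set.univ := sub_mem (d.exps_mem m) hμ
  have hmul : τ γ * mon kind t (d.exps m - μ) = c • γ := by
    rw [map_mul, d.map_mon hm] at hx
    have h1 := mon_mul_neg hE.isMonomialBase (mem_groupExps_of_pi hm)
    have h2 := mon_mul_neg hE.isMonomialBase hμ
    have h3 : algebraMap F E (d.base m)⁻¹ * algebraMap F E (d.base m) = 1 := by
      rw [← map_mul, inv_mul_cancel₀ (d.base_ne m), map_one]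
    rw [Algebra.smul_def, Algebra.smul_def] at hx
    rw [sub_eq_add_neg, mon_add_group hE.isMonomialBase (d.exps_mem m) (neg_mem hμ), hc,
      Algebra.smul_def, map_mul]
    linear_combination
      (mon kind t (-μ) * mon kind t (-m) * algebraMap F E (d.base m)⁻¹) * hx
      - (τ γ * mon kind t (d.exps m) * mon kind t (-μ) * algebraMap F E (d.base m)⁻¹ *
          algebraMap F E (d.base m) - algebraMap F E a * algebraMap F E (d.base m)⁻¹ *
          mon kind t μ * mon kind t (-μ) * γ) * h1
      + algebraMap F E a * algebraMap F E (d.base m)⁻¹ * γ * h2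
      - τ γ * mon kind t (d.exps m) * mon kind t (-μ) * h3
  have hsplit : mon kind t (d.exps m - μ) =
      mon kind t (d.exps m - μ - piPart kind (d.exps m - μ)) *
        mon kind t (piPart kind (d.exps m - μ)) := by
    rw [← mon_add_group hE.isMonomialBase (sub_mem hdm piPart_mem) piPart_mem, sub_add_cancel]
  have hroot : d.exps m - μ - piPart kind (d.exps m - μ) ∈ groupExps kind (rootSet kind) := by
    refine mem_groupExps_rootSet (sub_mem hdm piPart_mem) ?_
    rw [map_sub, piPart_eq_self fun i hi => piPart_of_ne hi _, sub_self]
  -- The product of `τ γ` with the full monomial is `c γ`, which contains no Π-monomials; hence the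
  -- monomial contains none either.
  have hp : piPart kind (d.exps m - μ) = 0 := by
    refine hE.eq_zero_of_mul_mon_mem (y := τ γ *
      mon kind t (d.exps m - μ - piPart kind (d.exps m - μ)))
      (mul_mem hcl (mon_mem_monAlg hE.isMonomialBase hroot.2)) ?_ (fun i hi => piPart_of_ne hi _) ?_
    · have h1 : IsUnit (mon kind t (d.exps m - μ - piPart kind (d.exps m - μ))) := by
        simpa using isUnit_smul_mon hE.isMonomialBase (one_ne_zero (α := F)) hroot
      exact ((hγu.map τ).mul h1).ne_zero
    · rw [mul_assoc, ← hsplit, hmul]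
      exact Subalgebra.smul_mem _ hγ _
  refine ⟨m, ?_, ?_, fun i hi j hj => ?_⟩
  · rwa [map_sub, sub_eq_zero] at hp
  · have h1 : τ (γ ^ l) = c ^ l • γ ^ l := by
      have h2 := congrArg (fun y => y ^ l) hmul
      simp only [mul_pow, hpow _ (mem_groupExps_rootSet hdm hp), mul_one, smul_pow] at h2
      rw [map_pow, h2]
    have h2 : ∀ n : ℕ, (τ ^ n) (γ ^ l) = iterProd σ (c ^ l) n • γ ^ l := by
      intro n
      induction n with
      | zero => simp [iterProd]
      | succ n ih =>
        have h3 : (τ ^ (n + 1)) (γ ^ l) = τ ((τ ^ n) (γ ^ l)) := by rw [pow_succ']; rfl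
        rw [h3, ih, Algebra.smul_def, map_mul, hE.extends_aut, h1, iterProd_succ,
          Algebra.smul_def, Algebra.smul_def, map_mul]
        ring
    obtain ⟨ν, hν⟩ : ∃ ν, hE.coeff ν (γ ^ l) ≠ 0 := by
      by_contra! h3
      exact (hγu.pow l).ne_zero (hE.ext fun ν _ => by rw [h3, map_zero])
    have h3 := hE.coeff_pow_of_root hk1 (pow_mem hγ l) ν
    rw [h2, map_smul, smul_eq_mul] at h3
    obtain ⟨g, hg, h4⟩ := exists_period_root σ (pow_ne_zero l hc0) hν h3.symm
    refine ⟨g, hg, ?_⟩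
    rw [h4, ← pow_mul, d.base_zsmul, zpow_natCast, zpow_natCast, hc, mul_pow, inv_pow]
  · rw [hE.coeffAt_mul_mon hγ hi hm, if_neg hj]

/-- One relation bounds the exponents of all semi-constants. Eliminating `a` between the given
relation and the one attached to a semi-constant with exponents `m` leaves a relation that
`PiFactors.piPart_eq_zero` shows to be trivial. So `z i = x₀ * m i`, and `x₀ ≠ 0` gives `|m i| ≤ |z
i|`. -/
theorem PiFactors.degLE_of_relation (hs : IsSimpleExtension F τ kind t)
    (hper : ∀ i ∈ rootSet kind, ∃ p > 0, τ^[p] (t i) = t i) {a : F} {μ : Fin e → ℤ} (ha : a ≠ 0)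
    (hμ : μ ∈ groupExps kind Set.univ) {x₀ : ℤ} {z : Fin e → ℤ} (hx₀ : x₀ ≠ 0)
    (h : d.IsRelation a x₀ z) (hz : piPart kind (x₀ • μ - d.exps z) = 0) {x : E}
    (hx : τ x = (a • mon kind t μ) * x) {i : Fin e} (hi : kind i = MonomialKind.pi) :
    hE.DegLE i (z i).natAbs x := by
  obtain ⟨N, hN, hrel⟩ := d.exists_relation hs hper
  by_cases hx0 : x = 0
  · subst hx0
    exact fun j _ => map_zero _
  obtain ⟨m, hm, hm', hcoeff⟩ := hrel a μ ha hμ x hx0 hx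
  have h1 := PiFactors.IsRelation.add d ha (PiFactors.IsRelation.zsmul d hm' x₀)
    (PiFactors.IsRelation.zsmul d h (-N))
  have h2 : x₀ * N + -N * x₀ = 0 := by ring
  rw [h2] at h1
  obtain ⟨g, hg, h1⟩ := h1
  rw [zpow_zero, one_mul] at h1
  have h3 := d.piPart_eq_zero hg h1 (by
    rw [map_add, map_smul, map_smul, map_smul, map_add, map_smul, map_smul, map_smul, hm]
    rw [map_sub, map_smul, sub_eq_zero] at hz
    rw [← hz, smul_smul, smul_smul, ← add_smul, h2, zero_smul])
  have h4 := congrFun h3 i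
  rw [piPart_pi hi] at h4
  simp only [Pi.add_apply, Pi.smul_apply, smul_eq_mul, Pi.zero_apply] at h4
  have h5 : z i = x₀ * m i := mul_left_cancel₀ hN (by linear_combination -h4)
  intro j hj
  refine hcoeff i hi j ?_
  rintro rfl
  rw [h5, Int.natAbs_mul] at hj
  have := Nat.le_mul_of_pos_left (m i).natAbs (Int.natAbs_pos.2 hx₀)
  omega

end ExponentBounds

/-! ### Computing the exponent bound with Problem PMT -/

section MultiplicativeRelations

theorem exists_ofFn_relations {F : Type*} [Field F] [Primcodable F] {σ : RingAut F}
    {f : List F} {alg : List F →. List (List ℤ)}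
    (h : ∃ B ∈ alg f, ∃ v : Fin B.length → (Fin f.length → ℤ),
        (∀ j, B.get j = List.ofFn (v j)) ∧ LinearIndependent ℤ v ∧
        (Submodule.span ℤ (Set.range v) : Set (Fin f.length → ℤ)) =
          multSet σ (fun i => id (f.get i))) {n : ℕ} {y : Fin n → F} (hy : f = List.ofFn y) :
    ∃ (r : ℕ) (v : Fin r → Fin n → ℤ), (List.ofFn fun j => List.ofFn (v j)) ∈ alg (List.ofFn y) ∧
      (Submodule.span ℤ (Set.range v) : Set (Fin n → ℤ)) = multSet σ y := by
  obtain rfl : f.length = n := by simp [hy]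
  obtain rfl : y = f.get := by
    apply List.ofFn_injective
    rw [List.ofFn_get, ← hy]
  rw [← hy]
  obtain ⟨B, hB, v, h1, -, h3⟩ := h
  refine ⟨B.length, v, ?_, h3⟩
  convert hB using 1
  exact Eq.trans (congrArg List.ofFn (funext fun j => (h1 j).symm)) (List.ofFn_get B)

theorem listDot_map_getD_ofFn {r n : ℕ} (v : Fin r → Fin n → ℤ) (κ : List ℤ) (i : Fin n) :
    listDot ((List.ofFn fun l => List.ofFn (v l)).map fun c => c.getD i 0) κ =
      (∑ l : Fin r, κ.getD l 0 • v l) i := by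
  simp only [listDot, List.map_ofFn, List.length_ofFn, sum_map_range_eq, getD_ofFn,
    Function.comp_def, Finset.sum_apply, Pi.smul_apply, smul_eq_mul]
  exact Finset.sum_congr rfl fun l _ => mul_comm _ _

variable {F E : Type*} [Field F] [CommRing E] [Algebra F E] {σ : RingAut F} {τ : RingAut E} {e : ℕ}
variable {kind : Fin e → MonomialKind} {t : Fin e → E}
variable {hE : IsRPSExtension σ τ kind t}

theorem IsRPSExtension.eq_coeff_smul_mon (hE : IsRPSExtension σ τ kind t) {u : Eˣ}
    (hu : u ∈ prodGroup F hE.isMonomialBase Set.univ) {m : Fin e → ℤ}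
    (hm : hE.coeff m (u : E) ≠ 0) :
    m ∈ groupExps kind Set.univ ∧ (u : E) = hE.coeff m (u : E) • mon kind t m := by
  classical
  obtain ⟨a, ha, n, hn, hu⟩ := hu
  have h1 : hE.coeff m (u : E) = a * if m = normalizeExp kind n then 1 else 0 := by
    rw [hu, map_smul, ← mon_normalizeExp hE.isMonomialBase n,
      hE.coeff_mon (normalizeExp_mem hE.isMonomialBase (S := Set.univ) (by simp)), smul_eq_mul]
  obtain rfl : m = normalizeExp kind n := by
    by_contra h
    rw [if_neg h, mul_zero] at h1
    exact hm h1
  rw [if_pos rfl, mul_one] at h1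
  refine ⟨⟨fun j hj => ?_, by simp⟩, ?_⟩
  · simp [normalizeExp, hn.1 j hj, normalExp_zero]
  · rw [h1, mon_normalizeExp hE.isMonomialBase, hu]

/-- The exponents of the Π-monomials that remain when a power of the coefficient of the equation is
compared with `τ(P)/P` for a product `P` of powers of Π-monomials. -/
noncomputable def PiFactors.defect (d : PiFactors hE) (μ : Fin e → ℤ) : (Fin (e + 1) → ℤ) →ₗ[ℤ] (Fin e → ℤ) :=
  (piPart kind).comp ((LinearMap.toSpanSingleton ℤ (Fin e → ℤ) μ).comp (LinearMap.proj 0) -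
    d.exps.comp (LinearMap.funLeft ℤ ℤ Fin.succ))

theorem PiFactors.defect_apply (d : PiFactors hE) (μ : Fin e → ℤ) (m : Fin (e + 1) → ℤ) :
    d.defect μ m = piPart kind (m 0 • μ - d.exps fun i => m i.succ) := rfl

theorem PiFactors.computable_defect (d : PiFactors hE) {α : Type*} [Primcodable α]
    {μ : α → Fin e → ℤ} {m : α → Fin (e + 1) → ℤ} (hμ : Computable μ) (hm : Computable m) :
    Computable fun a => d.defect (μ a) (m a) := by
  refine Computable.fin_pi fun j => ?_
  by_cases hj : kind j = MonomialKind.pi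
  · have h1 : Computable fun a => m a 0 * μ a j + ∑ i : Fin e, m a i.succ * -d.n i j :=
      Computable.int_add.comp
        (Computable.int_mul.comp ((Computable.fin_apply 0).comp hm)
          ((Computable.fin_apply j).comp hμ))
        (Computable.finset_sum Computable.int_add _ fun i => Computable.int_mul.comp
          ((Computable.fin_apply i.succ).comp hm) (Computable.const _))
    refine h1.of_eq fun a => ?_
    rw [d.defect_apply, piPart_pi hj, d.exps_apply]
    simp [Finset.sum_apply, sub_eq_add_neg]
  · exact (Computable.const 0).of_eq fun a => by rw [d.defect_apply, piPart_of_ne hj]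

/-- This phrases the relations as an instance of Problem PMT in `F`, for `a` and the inverses of the
factors of the Π-monomials. -/
theorem PiFactors.mem_multSet (d : PiFactors hE) {a : F} (ha : a ≠ 0) (m : Fin (e + 1) → ℤ) :
    m ∈ multSet σ (Fin.cons a fun i => (d.a i)⁻¹ : Fin (e + 1) → F) ↔
      d.IsRelation a (m 0) fun i => m i.succ := by
  have h : ∏ i, zpowInv ((Fin.cons a fun i => (d.a i)⁻¹ : Fin (e + 1) → F) i) (m i) =
      a ^ m 0 * (d.base fun i => m i.succ)⁻¹ := by
    rw [Fin.prod_univ_succ, Fin.cons_zero, zpowInv_eq_zpow ha, base, ← Finset.prod_inv_distrib]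
    congr 1
    exact Finset.prod_congr rfl fun i _ => by
      rw [Fin.cons_succ, zpowInv_eq_zpow (inv_ne_zero (d.a_ne i)), inv_zpow]
  rw [multSet, Set.mem_ofPred_eq, h]
  rfl

/-- The integer vector with the given list of coordinates with respect to the vectors in a list. -/
def combineInt (n : ℕ) (B : List (List ℤ)) (κ : List ℤ) : Fin n → ℤ :=
  fun i => listDot (B.map fun c => c.getD i 0) κ

theorem combineInt_ofFn {r n : ℕ} (v : Fin r → Fin n → ℤ) (κ : List ℤ) :
    combineInt n (List.ofFn fun l => List.ofFn (v l)) κ = ∑ l : Fin r, κ.getD l 0 • v l :=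
  funext fun i => listDot_map_getD_ofFn v κ i

theorem computable_combineInt (n : ℕ) : Computable₂ (combineInt n) := by
  refine Computable.fin_pi fun i => ?_
  exact (computable_listDot Computable.int_add Computable.int_mul).comp
    (Computable.list_map Computable.fst
      ((Computable.list_getD 0).comp Computable.snd (Computable.const _))) Computable.snd

variable [CharZero F]

/-- A nonzero semi-constant would give a relation with a nonzero exponent `N` of `a` and defect
zero. The certificate extends from generators to all relations by linearity and forces `q * N = 0`.
-/
theorem PiFactors.eq_zero_of_certificate (d : PiFactors hE) (hs : IsSimpleExtension F τ kind t)
    (hper : ∀ i ∈ rootSet kind, ∃ p > 0, τ^[p] (t i) = t i) {a : F} {μ : Fin e → ℤ} (ha : a ≠ 0)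
    (hμ : μ ∈ groupExps kind Set.univ) {r : ℕ} {v : Fin r → Fin (e + 1) → ℤ}
    (hv : (Submodule.span ℤ (Set.range v) : Set (Fin (e + 1) → ℤ)) =
      multSet σ (Fin.cons a fun i => (d.a i)⁻¹ : Fin (e + 1) → F))
    {q : ℤ} (hq : q ≠ 0) {p : Fin e → ℤ} (hp : ∀ l, q * v l 0 = ∑ j, p j * d.defect μ (v l) j)
    {x : E} (hx : τ x = (a • mon kind t μ) * x) : x = 0 := by
  by_contra hx0
  obtain ⟨N, hN, hrel⟩ := d.exists_relation hs hper
  obtain ⟨m, hm, hm', -⟩ := hrel a μ ha hμ x hx0 hx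
  have hspan : ∀ w ∈ Submodule.span ℤ (Set.range v), q * w 0 = ∑ j, p j * d.defect μ w j := by
    intro w hw
    induction hw using Submodule.span_induction with
    | mem w hw =>
      obtain ⟨l, rfl⟩ := hw
      exact hp l
    | zero => simp
    | add w w' _ _ h h' =>
      simp only [Pi.add_apply, mul_add, h, h', map_add, Finset.sum_add_distrib]
    | smul c w _ h =>
      simp only [Pi.smul_apply, smul_eq_mul, map_smul]
      rw [mul_left_comm, h, Finset.mul_sum]
      exact Finset.sum_congr rfl fun j _ => mul_left_comm _ _ _
  have hmem : (Fin.cons N (N • m) : Fin (e + 1) → ℤ) ∈ Submodule.span ℤ (Set.range v) := by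
    rw [← SetLike.mem_coe, hv, d.mem_multSet ha]
    exact hm'
  have h1 := hspan _ hmem
  have h2 : d.defect μ (Fin.cons N (N • m)) = 0 := by
    rw [d.defect_apply, map_sub]
    simp only [Fin.cons_zero, Fin.cons_succ]
    have h3 : (fun i => (N • m) i) = N • m := rfl
    rw [h3, map_smul, map_smul, map_smul, hm, sub_self]
  rw [h2] at h1
  simp [hq, hN] at h1

variable [Primcodable F] [Primcodable E]

/-- Problem PMT yields generators of all relations. The algorithm then searches for a relation with
nonzero exponent of `a` and zero defect, which bounds the exponents, or for a certificate that there
is none, in which case only `x = 0` is a semi-constant. By `exists_integer_relation` the search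
succeeds. -/
theorem IsEffective.exists_bound (hI : IsEffective hE)
    (hs : IsSimpleExtension F τ kind t)
    (hper : ∀ i ∈ rootSet kind, ∃ p > 0, τ^[p] (t i) = t i)
    (hPMT : PMTSolvable (id : F → F) σ (unitSet F)) :
    ∃ bound : E →. ℕ, Partrec bound ∧ ∀ w ∈ prodGroup F hE.isMonomialBase Set.univ,
      ∃ b ∈ bound (w : E), ∀ x, τ x = w * x → ∀ i, kind i = MonomialKind.pi → hE.DegLE i b x := by
  classical
  obtain ⟨d⟩ := hs.nonempty_piFactors hE
  obtain ⟨-, -, alg, halg, hspec⟩ := hPMT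
  obtain ⟨lead, hlead, hlead'⟩ := hI.exists_lead
  have hgood : ∀ w ∈ prodGroup F hE.isMonomialBase Set.univ, lead (w : E) ∈ groupExps kind Set.univ ∧
      hE.coeff (lead w) (w : E) ≠ 0 ∧ (w : E) = hE.coeff (lead w) (w : E) • mon kind t (lead w) := by
    intro w hw
    have : Nontrivial E := hE.injective.nontrivial
    have h1 := hlead' w w.ne_zero
    obtain ⟨h2, h3⟩ := hE.eq_coeff_smul_mon hw h1
    exact ⟨h2, h1, h3⟩
  -- A candidate `(κ, q, p)` is accepted if the combination of the generators with coordinates `κ`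
  -- is a relation of the desired kind, or if `(q, p)` is a certificate on the generators.
  let T : (E × List (List ℤ)) → (List ℤ × ℤ × (Fin e → ℤ)) → Bool := fun s c =>
    (!decide (combineInt (e + 1) s.2 c.1 0 = 0) &&
      decide (d.defect (lead s.1) (combineInt (e + 1) s.2 c.1) = 0)) ||
    (!decide (c.2.1 = 0) && decide ((s.2.map fun b => c.2.1 * b.getD 0 0) =
      s.2.map fun b => ∑ j, c.2.2 j * d.defect (lead s.1) (fun i => b.getD i 0) j))
  have hT : Computable₂ T := by
    have hfst : Computable fun s : (E × List (List ℤ)) × List ℤ × ℤ × (Fin e → ℤ) => lead s.1.1 :=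
      hlead.comp (Computable.fst.comp Computable.fst)
    have hcomb : Computable fun s : (E × List (List ℤ)) × List ℤ × ℤ × (Fin e → ℤ) =>
        combineInt (e + 1) s.1.2 s.2.1 :=
      (computable_combineInt (e + 1)).comp (Computable.snd.comp Computable.fst)
        (Computable.fst.comp Computable.snd)
    have hq : Computable fun s : (E × List (List ℤ)) × List ℤ × ℤ × (Fin e → ℤ) => s.2.2.1 :=
      Computable.fst.comp (Computable.snd.comp Computable.snd)
    have hp : Computable fun s : (E × List (List ℤ)) × List ℤ × ℤ × (Fin e → ℤ) => s.2.2.2 :=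
      Computable.snd.comp (Computable.snd.comp Computable.snd)
    have hB : Computable fun s : (E × List (List ℤ)) × List ℤ × ℤ × (Fin e → ℤ) => s.1.2 :=
      Computable.snd.comp Computable.fst
    have hrow : Computable fun s : ((E × List (List ℤ)) × List ℤ × ℤ × (Fin e → ℤ)) × List ℤ =>
        fun i : Fin (e + 1) => s.2.getD i 0 :=
      Computable.fin_pi fun i => (Computable.list_getD 0).comp Computable.snd (Computable.const _)
    have hdef := d.computable_defect (hfst.comp Computable.fst) hrow
    refine Primrec.or.to_comp.comp
      (Computable.and (Primrec.not.to_comp.comp (Computable.decide_eq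
        ((Computable.fin_apply 0).comp hcomb) (Computable.const 0)))
        (Computable.decide_eq (d.computable_defect hfst hcomb) (Computable.const 0)))
      (Computable.and (Primrec.not.to_comp.comp (Computable.decide_eq hq (Computable.const 0)))
        (Computable.decide_eq (Computable.list_map hB ?_) (Computable.list_map hB ?_)))
    · exact Computable.int_mul.comp (hq.comp Computable.fst)
        ((Computable.list_getD 0).comp Computable.snd (Computable.const 0))
    · exact Computable.finset_sum Computable.int_add _ fun j => Computable.int_mul.comp
        ((Computable.fin_apply j).comp (hp.comp Computable.fst)) ((Computable.fin_apply j).comp hdef)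
  obtain ⟨f, hf, hf1, hf2⟩ := Computable.exists_search hT
  -- The sum of absolute values bounds every exponent of the relation found. If a certificate was
  -- found, any number is a valid bound.
  let out : (E × List (List ℤ)) → (List ℤ × ℤ × (Fin e → ℤ)) → ℕ := fun s c =>
    ∑ i : Fin e, (combineInt (e + 1) s.2 c.1 i.succ).natAbs
  have hout : Computable₂ out := by
    refine Computable.finset_sum Primrec.nat_add.to_comp _ fun i => Computable.int_natAbs.comp
      ((Computable.fin_apply i.succ).comp ?_)
    exact (computable_combineInt (e + 1)).comp (Computable.snd.comp Computable.fst)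
      (Computable.fst.comp Computable.snd)
  let inp : E → List F := fun u => hE.coeff (lead u) u :: List.ofFn fun i => (d.a i)⁻¹
  have hinp : Computable inp :=
    Computable.list_cons.comp (hI.coeff.comp hlead Computable.id) (Computable.const _)
  refine ⟨fun u => (alg (inp u)).bind fun B => (f (u, B)).map (out (u, B)),
    (halg.comp hinp).bind ((hf.comp (Computable.fst.pair Computable.snd)).map
      (hout.comp (Computable.fst.comp Computable.fst |>.pair (Computable.snd.comp Computable.fst))
        Computable.snd)), fun w hw => ?_⟩
  obtain ⟨hμ, ha, hwe⟩ := hgood w hw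
  set μ := lead (w : E) with hμd
  set a := hE.coeff μ (w : E) with had
  have hinpw : inp w = List.ofFn (Fin.cons a fun i => (d.a i)⁻¹ : Fin (e + 1) → F) := by
    rw [List.ofFn_succ]
    simp [inp, had, hμd]
  obtain ⟨r, v, hv, hspan⟩ := exists_ofFn_relations (hspec (inp w) (by
    intro x hx
    have : x ≠ 0 := by
      rcases List.mem_cons.1 hx with rfl | hx
      · exact ha
      · obtain ⟨i, rfl⟩ := List.mem_ofFn.1 hx
        exact inv_ne_zero (d.a_ne i)
    exact isUnit_iff_ne_zero.2 this)) hinpw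
  rw [← hinpw] at hv
  set B := List.ofFn fun j => List.ofFn (v j) with hB
  have hrow : ∀ l, (fun i : Fin (e + 1) => (List.ofFn (v l)).getD i 0) = v l := fun l =>
    funext fun i => getD_ofFn _ _ _
  have hhead : ∀ l, (List.ofFn (v l)).getD 0 0 = v l 0 := fun l => getD_ofFn (v l) 0 0
  have hTspec : ∀ κ q p, T (w, B) (κ, q, p) = true ↔
      (((∑ l : Fin r, κ.getD l 0 • v l) 0 ≠ 0 ∧ d.defect μ (∑ l : Fin r, κ.getD l 0 • v l) = 0) ∨
        (q ≠ 0 ∧ ∀ l, q * v l 0 = ∑ j, p j * d.defect μ (v l) j)) := by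
    intro κ q p
    simp only [T, hB, combineInt_ofFn, List.map_ofFn, Bool.or_eq_true, Bool.and_eq_true,
      decide_eq_true_eq, Bool.not_eq_true', decide_eq_false_iff_not, List.ofFn_inj, funext_iff,
      Function.comp_apply, hrow, hhead, ← hμd, ne_eq]
  -- Either some integer combination of the generators has zero defect and nonzero first entry, or
  -- the first entry vanishes whenever the defect does, and a certificate exists.
  have hex : ∃ c, T (w, B) c = true := by
    by_cases hκ : ∃ κ : Fin r → ℤ, (∀ j, ∑ l, κ l * d.defect μ (v l) j = 0) ∧ ∑ l, κ l * v l 0 ≠ 0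
    · obtain ⟨κ, h1, h2⟩ := hκ
      refine ⟨(List.ofFn κ, 0, 0), (hTspec _ _ _).2 (Or.inl ?_)⟩
      simp only [getD_ofFn]
      refine ⟨by simpa [Finset.sum_apply] using h2, ?_⟩
      ext j
      rw [map_sum, Finset.sum_apply, Pi.zero_apply, ← h1 j]
      exact Finset.sum_congr rfl fun l _ => by rw [map_smul, Pi.smul_apply, smul_eq_mul]
    · push Not at hκ
      obtain ⟨q, hq, p, hp⟩ := exists_integer_relation (fun l => v l 0)
        (fun l => d.defect μ (v l)) hκ
      exact ⟨([], q, p), (hTspec _ _ _).2 (Or.inr ⟨hq, hp⟩)⟩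
  have hdom := hf2 (w, B) hex
  obtain ⟨⟨κ, q, p⟩, hc⟩ := Part.dom_iff_mem.1 hdom
  refine ⟨out (w, B) (κ, q, p), Part.mem_bind hv (Part.mem_map _ hc), fun x hx i hi => ?_⟩
  rw [hwe] at hx
  rcases (hTspec κ q p).1 (hf1 _ _ hc) with ⟨h1, h2⟩ | ⟨hq, hp⟩
  · set m := ∑ l : Fin r, κ.getD l 0 • v l with hm
    have hmem : m ∈ multSet σ (Fin.cons a fun i => (d.a i)⁻¹ : Fin (e + 1) → F) := by
      rw [← hspan]
      exact Submodule.sum_mem _ fun l _ => Submodule.smul_mem _ _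
        (Submodule.subset_span (Set.mem_range_self l))
    have h3 := d.degLE_of_relation hs hper ha hμ h1 ((d.mem_multSet ha m).1 hmem) h2 hx hi
    refine IsRPSExtension.DegLE.mono hE h3 ?_
    have h4 : out (w, B) (κ, q, p) = ∑ i : Fin e, (m i.succ).natAbs := by
      simp only [out, hB, combineInt_ofFn, hm]
    rw [h4]
    exact Finset.single_le_sum (f := fun i : Fin e => (m i.succ).natAbs) (fun _ _ => Nat.zero_le _)
      (Finset.mem_univ i)
  · rw [d.eq_zero_of_certificate hs hper ha hμ hspan hq hp hx]
    exact fun j _ => map_zero _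

end MultiplicativeRelations

/-! ### Climbing the tower and returning to lists of terms -/

section Solution

variable {F E : Type*} [Field F] [CommRing E] [Algebra F E] {σ : RingAut F} {τ : RingAut E} {e : ℕ}
variable {kind : Fin e → MonomialKind} {t : Fin e → E}

theorem IsSimpleExtension.isUnitGroup_semiConst [CharZero F]
    (hs : IsSimpleExtension F τ kind t)
    (hE : IsRPSExtension σ τ kind t) :
    IsUnitGroup (semiConst τ (productGroup F kind t) \ {0}) := by
  have : Nontrivial E := hE.injective.nontrivial
  have hlev : level kind e = Set.univ := level_top
  rw [productGroup_eq hE.isMonomialBase]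
  refine ⟨{ carrier := {x | ∃ w ∈ prodGroup F hE.isMonomialBase Set.univ, τ x = w * x}
            one_mem' := ⟨1, one_mem _, by simp⟩
            mul_mem' := ?_
            inv_mem' := ?_ }, ?_⟩
  · rintro x y ⟨w, hw, hx⟩ ⟨w', hw', hy⟩
    -- Factors of semi-constants multiply; that nonzero semi-constants are units at all is the
    -- content of `IsRPSExtension.semiconst`, used below.
    refine ⟨w * w', mul_mem hw hw', ?_⟩
    rw [Units.val_mul, Units.val_mul, map_mul, hx, hy, mul_mul_mul_comm]
  · rintro x ⟨w, hw, hx⟩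
    refine ⟨w⁻¹, inv_mem hw, ?_⟩
    have h1 : τ (x : E) * τ ((x⁻¹ : Eˣ) : E) = 1 := by rw [← map_mul, Units.mul_inv, map_one]
    have h2 : (w : E) * ((w⁻¹ : Eˣ) : E) = 1 := Units.mul_inv w
    have h3 : (x : E) * ((x⁻¹ : Eˣ) : E) = 1 := Units.mul_inv x
    rw [hx] at h1
    linear_combination ((w⁻¹ : Eˣ) : E) * ((x⁻¹ : Eˣ) : E) * h1 -
      τ ((x⁻¹ : Eˣ) : E) * (x : E) * ((x⁻¹ : Eˣ) : E) * h2 - τ ((x⁻¹ : Eˣ) : E) * h3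
  · ext x
    constructor
    · rintro ⟨x, ⟨w, hw, hx⟩, rfl⟩
      exact ⟨⟨w, ⟨w, hw, rfl⟩, hx⟩, x.ne_zero⟩
    · rintro ⟨⟨_, ⟨w, hw, rfl⟩, hx⟩, hx0⟩
      obtain ⟨-, -, -, -, -, -, hu⟩ := hE.semiconst hs (k := e) le_rfl (x := x)
        (by rw [hlev, hE.monAlg_univ]; trivial) hx0 (by rw [hlev]; exact hw) hx
      exact ⟨hu.unit, ⟨w, hw, hx⟩, rfl⟩

variable [Primcodable F] [Primcodable E] {hE : IsRPSExtension σ τ kind t}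

theorem IsEffective.solvableAt_level [CharZero F] (hI : IsEffective hE)
    (hF : IsComputableDifferenceField σ)
    (hstable : IsConstantStable σ) (hs : IsSimpleExtension F τ kind t)
    (hper : ∀ i ∈ rootSet kind, ∃ p > 0, τ^[p] (t i) = t i)
    (hPFLDE : ∀ k : ℕ, 0 < k → PFLDESolvable (id : F → F) (σ ^ k) (unitSet F))
    (hcase : (∀ i, kind i ≠ MonomialKind.pi) ∨ PMTSolvable (id : F → F) σ (unitSet F))
    {k : ℕ} (hk : k ≤ e) : hE.SolvableAt (level kind k) := by
  induction k with
  | zero =>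
    rw [level_zero]
    exact hI.solvableAt_rootSet hF hstable hs hper hPFLDE
  | succ k ih =>
    have hsolv := ih (by omega)
    have hlev := level_succ (kind := kind) ⟨k, hk⟩
    simp only at hlev
    rw [hlev]
    generalize hi : (⟨k, hk⟩ : Fin e) = i at hlev
    obtain rfl : k = i := by rw [← hi]
    rcases hki : kind i with l | _ | _
    -- R-monomials were treated together at the lowest level.
    · rwa [Set.insert_eq_of_mem (rootSet_subset_level _ ⟨l, hki⟩)]
    · obtain ⟨h, hh, hτ⟩ := hs.exists_factor_pi hE hki
      obtain ⟨bound, hb, hbound⟩ := hI.exists_bound hs hper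
        (hcase.resolve_left fun h => h i hki)
      have hcl := IsSimpleExtension.isClosedUnder_level hE hs ((i : ℕ) + 1)
      rw [hlev] at hcl
      refine hI.solvableAt_insert_pi (not_mem_level i ?_) hki
        (IsSimpleExtension.isClosedUnder_level hE hs i)
        (fun x hx => hcl.map_monAlg hE.extends_aut hx)
        (prodGroup_mono _ (fun j hj => Or.inr hj) hh) hτ hF hsolv hb fun w hw => ?_
      · rintro ⟨l, hl⟩
        rw [hki] at hl
        cases hl
      · obtain ⟨b, hb, hbx⟩ := hbound w (prodGroup_mono _ (Set.subset_univ _) hw)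
        exact ⟨b, hb, fun x hx => hbx x hx i hki⟩
    · exact hI.solvableAt_insert_sigma hs i hki hsolv

/-- The solver works with unique codes of elements; here it is wrapped by the computable passages
from term lists to codes and back. -/
theorem IsEffective.exists_alg (hI : IsEffective hE) (hsolv : hE.SolvableAt Set.univ) :
    ∃ alg : List ((Fin e → ℤ) × F) × List (List ((Fin e → ℤ) × F)) →.
        List (List (List ((Fin e → ℤ) × F)) × List ((Fin e → ℤ) × F)), Partrec alg ∧
      ∀ u f, evalTerms kind t u ∈ productGroup F kind t →
        ∃ B ∈ alg (u, f), ∃ v : Fin B.length → (Fin f.length → E) × E,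
          (∀ j, (B.get j).1.map (evalTerms kind t) = List.ofFn (v j).1 ∧
            evalTerms kind t (B.get j).2 = (v j).2) ∧
          LinearIndependent (constRing τ) v ∧
          (Submodule.span (constRing τ) (Set.range v) : Set ((Fin f.length → E) × E)) =
            solutionSet τ (evalTerms kind t u) (fun i => evalTerms kind t (f.get i)) := by
  obtain ⟨alg, halg, hspec⟩ := hsolv
  obtain ⟨s, hs, hs'⟩ := hI.name
  let out : List E × E → List (List ((Fin e → ℤ) × F)) × List ((Fin e → ℤ) × F) :=
    fun b => (b.1.map s, s b.2)
  have hs₂ : Computable₂ fun (_ : List E × E) x => s x := hs.comp Computable.snd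
  have hout : Computable out :=
    (Computable.list_map Computable.fst hs₂).pair (hs.comp Computable.snd)
  have hev : Computable₂ fun (_ : List ((Fin e → ℤ) × F) × List (List ((Fin e → ℤ) × F))) r =>
      evalTerms (F := F) kind t r := hI.eval.comp Computable.snd
  have hout₂ : Computable₂ fun (_ : (List ((Fin e → ℤ) × F) × List (List ((Fin e → ℤ) × F))) ×
      List (List E × E)) b => out b := hout.comp Computable.snd
  have hmap : Computable₂ fun (_ : List ((Fin e → ℤ) × F) × List (List ((Fin e → ℤ) × F)))
      (B : List (List E × E)) => B.map out := Computable.list_map Computable.snd hout₂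
  refine ⟨fun p => (alg (evalTerms kind t p.1, p.2.map (evalTerms kind t))).map fun B => B.map out,
    (halg.comp ((hI.eval.comp Computable.fst).pair (Computable.list_map Computable.snd hev))).map
      hmap, fun u f hu => ?_⟩
  rw [productGroup_eq hE.isMonomialBase] at hu
  obtain ⟨w, hw, hu⟩ := hu
  have hf : f.map (evalTerms kind t) =
      List.ofFn fun i : Fin f.length => evalTerms (F := F) kind t (f.get i) := by
    conv_lhs => rw [← List.ofFn_get f, List.map_ofFn]
    rfl
  obtain ⟨_, hB, r, v, rfl, hli, hspan⟩ := hspec (evalTerms kind t u) ⟨w, hw, hu.symm⟩ f.length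
    (fun i => evalTerms kind t (f.get i)) fun i => by
      rw [hE.mem_constSub, hE.monAlg_univ]; trivial
  rw [← hf] at hB
  refine ⟨_, Part.mem_map _ hB, ?_⟩
  rw [List.map_ofFn]
  have hlen : (List.ofFn (out ∘ fun j => (List.ofFn (v j).1, (v j).2))).length = r := by simp
  refine ⟨v ∘ finCongr hlen, fun j => ?_, hli.comp _ (finCongr hlen).injective, ?_⟩
  · simp only [out, List.get_ofFn, Function.comp_apply, List.map_ofFn, hs', List.ofFn_inj]
    exact ⟨funext fun i => hs' _, rfl⟩
  · rw [(finCongr hlen).surjective.range_comp, hspan]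
    ext x
    refine and_congr Iff.rfl ⟨fun h => h.2, fun h => ⟨?_, h⟩⟩
    rw [hE.monAlg_univ]
    trivial

end Solution

theorem theorem6p8 {F E : Type*} [Field F] [CharZero F] [Primcodable F] [CommRing E] [Algebra F E]
    (σ : RingAut F) (hF : IsComputableDifferenceField σ) (hstable : IsConstantStable σ)
    (τ : RingAut E) {e : ℕ} (kind : Fin e → MonomialKind) (t : Fin e → E)
    (hE : IsRPSExtension σ τ kind t) (hsimple : IsSimpleExtension F τ kind t)
    -- the given orders and (positive) periods of the R-monomials
    (ord per : Fin e → ℕ)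
    (hord : ∀ i l, kind i = MonomialKind.root l → ord i = orderOf (t i))
    (hper : ∀ i l, kind i = MonomialKind.root l →
      per i = Function.minimalPeriod τ (t i) ∧ 0 < per i)
    (hPFLDE : ∀ k : ℕ, 0 < k → PFLDESolvable (id : F → F) (σ ^ k) (unitSet F))
    (hcase : (∀ i, kind i ≠ MonomialKind.pi) ∨ PMTSolvable (id : F → F) σ (unitSet F)) :
    PFLDESolvable (evalTerms (F := F) kind t) τ (productGroup F kind t) := by
  obtain ⟨_, hI⟩ := hE.exists_isEffective hF
  have hper' : ∀ i ∈ rootSet kind, ∃ p > 0, τ^[p] (t i) = t i := by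
    rintro i ⟨l, hl⟩
    obtain ⟨h1, h2⟩ := hper i l hl
    exact ⟨per i, h2, by rw [h1, Function.iterate_minimalPeriod]⟩
  have hsolv := hI.solvableAt_level hF hstable hsimple hper' hPFLDE hcase le_rfl
  rw [level_top] at hsolv
  exact ⟨⟨_, (productGroup_eq hE.isMonomialBase).symm⟩, hsimple.isUnitGroup_semiConst hE,
    hI.exists_alg hsolv⟩
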